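/- **Conventions.** All groups are second countable locally compact Hausdorff. A locally compact groupoid $X$ is a second countable locally compact Hausdorff topological groupoid whose range map $r:X\to X^{(0)}$ is open (as is automatic in the presence of a Haar system). A Banach bundle $p:A\to X$ is an upper semicontinuous bundle of complex Banach spaces whose space of continuous sections vanishing at infinity is separable. A Fell bundle over $X$ is such a bundle with a continuous, fibrewise bilinear, associative multiplication $A(x)\times A(y)\to A(xy)$ ($s(x)=r(y)$) and a continuous, conjugate-linear, involutive, antimultiplicative map $A(x)\to A(x^{-1})$, $a\mapsto a^*$, such that each $A(u)$, $u\in X^{(0)}$, is a $C^*$-algebra and each $A(x)$ is an $A(r(x))$–$A(s(x))$ imprimitivity bimodule with inner products $ab^*$ and $a^*b$. We write $s(a)=s(p(a))$ and $r(a)=r(p(a))$. **Theorem.** Let $p:A\to X$ be a Fell bundle over a locally compact groupoid, and let groups $G$ and $H$ act continuously on the left and right, respectively, of $A\to X$ by Fell bundle automorphisms (that is, continuously on both $A$ and $X$, by groupoid automorphisms of $X$ and compatibly with $p$ and with all operations and norms of $A$). Suppose that the actions commute (on $A$ and on $X$) and that the actions on $X$ are free and proper. The orbit spaces $X/H$ and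 $A/H$ carry the operations $(x\cdot H)(y\cdot H)=(xy)\cdot H$ if $s(x)=r(y)$, $(x\cdot H)^{-1}=x^{-1}\cdot H$; $p(a\cdot H)=p(a)\cdot H$, $(a\cdot H)(b\cdot H)=(ab)\cdot H$ if $s(a)=r(b)$, $(a\cdot H)^*=a^*\cdot H$, $\|a\cdot H\|=\|a\|$, and the linear operations induced from $A$; likewise for $G\backslash X$ and $G\backslash A$. Let $A/H\rtimes G$ be $A/H\times G$ over $X/H\rtimes G=X/H\times G$, with $$(a\cdot H,t)(b\cdot H,t')=\bigl((a\cdot H)(t\cdot b\cdot H),tt'\bigr),\qquad (a\cdot H,t)^*=(t^{-1}\cdot a^*\cdot H,t^{-1}),$$ and similarly on the base, so that $r(x\cdot H,t)=(r(x)\cdot H,e)$ and $s(x\cdot H,t)=(t^{-1}\cdot s(x)\cdot H,e)$. Let $H\ltimes G\backslash A$ be $H\times G\backslash A$ over $H\ltimes G\backslash X=H\times G\backslash X$, with $$(h,G\cdot a)(h',G\cdot b)=\bigl(hh',(G\cdot a\cdot h')(G\cdot b)\bigr),\qquad (h,G\cdot a)^*=(h^{-1},G\cdot a^*\cdot h^{-1}),$$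 and similarly on the base, so that $r(h,G\cdot x)=(e,G\cdot r(x)\cdot h^{-1})$ and $s(h,G\cdot x)=(e,G\cdot s(x))$. Then $A/H\rtimes G$ and $H\ltimes G\backslash A$ are Fell bundles over locally compact groupoids. The space $X$ is an equivalence between the groupoids $X/H\rtimes G$ and $H\ltimes G\backslash X$, with fibring maps $\rho(x)=(r(x)\cdot H,e)$, $\sigma(x)=(e,G\cdot s(x))$ and actions $(x\cdot H,t)\cdot y=x(t\cdot y)$ if $s(x)=r(t\cdot y)$ and $x\cdot(h,G\cdot y)=(x\cdot h)y$ if $s(x\cdot h)=r(y)$. Over it, the Banach bundle $A$ is an equivalence between the Fell bundles $A/H\rtimes G$ and $H\ltimes G\backslash A$, with the following well-defined operations: 1. $A/H\rtimes G$ acts on the left of $A$ by $(a\cdot H,t)\cdot b=a(t\cdot b)$ if $s(a)=r(t\cdot b)$; 2. the left inner product is ${}_L\langle a,b\rangle=\bigl(a(t\cdot b^*)\cdot H,t\bigr)$ if $G\cdot s(a)=G\cdot s(b)$, where $t$ is the unique element of $G$ with $s(a)=t\cdot s(b)$; 3. $H\ltimes G\backslash A$ acts on the right of $A$ by $a\cdot(h,G\cdot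 b)=(a\cdot h)b$ if $s(a\cdot h)=r(b)$; 4. the right inner product is $\langle a,b\rangle_R=\bigl(h,G\cdot(a^*\cdot h)b\bigr)$ if $r(a)\cdot H=r(b)\cdot H$, where $h$ is the unique element of $H$ with $r(a)\cdot h=r(b)$. *Equivalence of groupoids* is meant as follows: both groupoids act freely and properly on the space, the actions are continuous and commute, the fibring maps are continuous and open, and each fibring map induces a homeomorphism of the orbit space of the other groupoid onto the unit space. *Equivalence of Fell bundles* is meant in the sense of Muhly and Williams: writing $q:E\to T$ for the Banach bundle, $B$ and $C$ for the left and right Fell bundles, and $\rho$, $\sigma$ also for $\rho\circ q$, $\sigma\circ q$, - (a) $B$ and $C$ act on $E$ by continuous, fibrewise bilinear, associative, norm-submultiplicative maps that cover the groupoid actions, and the two actions commute; - (b) there are continuous maps ${}_L\langle\cdot,\cdot\rangle:\{\sigma(e)=\sigma(f)\}\to B$ and $\langle\cdot,\cdot\rangle_R:\{\rho(e)=\rho(f)\}\to C$, fibrewise sesquilinear (linear in the first and in the second variable, respectively), such that ${}_L\langle e,f\rangle$ lies over the arrow $\eta$ with $q(e)=\eta\cdot q(f)$ and $\langle e,f\rangle_R$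 over the arrow $\eta$ with $q(f)=q(e)\cdot\eta$; ${}_L\langle e,f\rangle^*={}_L\langle f,e\rangle$ and $\langle e,f\rangle_R^*=\langle f,e\rangle_R$; $b\,{}_L\langle e,f\rangle={}_L\langle b\cdot e,f\rangle$ and $\langle e,f\rangle_R\,c=\langle e,f\cdot c\rangle_R$; and ${}_L\langle e,f\rangle\cdot g=e\cdot\langle f,g\rangle_R$, whenever these make sense; - (c) with these operations each fibre $E(t)$ is a $B(\rho(t))$–$C(\sigma(t))$ imprimitivity bimodule (its norm being that of the bundle). -/

import Mathlib

open MulOpposite Set Filter Topology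

noncomputable section

namespace FellBundles

/-! ### Locally compact groupoids

A groupoid is given by its set of arrows; a unit is identified with its identity arrow.
All partial operations are total functions whose values outside of their domain are never used. -/

/-- The operations of a groupoid with set of arrows `X`.  The product `mul x y` is meaningful only
for composable pairs, that is, for `s x = r y`. -/
structure GroupoidData (X : Type*) where
  r : X → X
  s : X → X
  inv : X → X
  mul : X → X → X

/-- The unit space of a groupoid. -/
def GroupoidData.units {X : Type*} (𝒢 : GroupoidData X) : Set X := Set.range 𝒢.r

/-- A second countable locally compact Hausdorff groupoid whose range map onto the unit space is
open (the range map is open as soon as there is a Haar system). -/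
structure IsLCGroupoid {X : Type*} [TopologicalSpace X] (𝒢 : GroupoidData X) : Prop where
  t2 : T2Space X
  locallyCompact : LocallyCompactSpace X
  secondCountable : SecondCountableTopology X
  r_r : ∀ x, 𝒢.r (𝒢.r x) = 𝒢.r x
  s_r : ∀ x, 𝒢.s (𝒢.r x) = 𝒢.r x
  r_s : ∀ x, 𝒢.r (𝒢.s x) = 𝒢.s x
  s_s : ∀ x, 𝒢.s (𝒢.s x) = 𝒢.s x
  r_mul : ∀ x y, 𝒢.s x = 𝒢.r y → 𝒢.r (𝒢.mul x y) = 𝒢.r x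
  s_mul : ∀ x y, 𝒢.s x = 𝒢.r y → 𝒢.s (𝒢.mul x y) = 𝒢.s y
  mul_assoc : ∀ x y z, 𝒢.s x = 𝒢.r y → 𝒢.s y = 𝒢.r z →
    𝒢.mul (𝒢.mul x y) z = 𝒢.mul x (𝒢.mul y z)
  r_mul_self : ∀ x, 𝒢.mul (𝒢.r x) x = x
  mul_s_self : ∀ x, 𝒢.mul x (𝒢.s x) = x
  r_inv : ∀ x, 𝒢.r (𝒢.inv x) = 𝒢.s x
  s_inv : ∀ x, 𝒢.s (𝒢.inv x) = 𝒢.r x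
  mul_inv : ∀ x, 𝒢.mul x (𝒢.inv x) = 𝒢.r x
  inv_mul : ∀ x, 𝒢.mul (𝒢.inv x) x = 𝒢.s x
  continuous_inv : Continuous 𝒢.inv
  continuousOn_mul :
    ContinuousOn (fun q : X × X => 𝒢.mul q.1 q.2) {q | 𝒢.s q.1 = 𝒢.r q.2}
  isOpenMap_r : IsOpenMap (Set.rangeFactorization 𝒢.r)

/-! ### Banach bundles -/

/-- The operations of a bundle of complex normed spaces with base `X` and total space `E`.  The
sum `add a b` is meaningful only if `p a = p b`. -/
structure BundleData (X E : Type*) where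
  p : E → X
  zero : X → E
  add : E → E → E
  smul : ℂ → E → E
  norm : E → ℝ

/-- Difference of two elements of the same fibre. -/
def BundleData.sub {X E : Type*} (B : BundleData X E) (a b : E) : E := B.add a (B.smul (-1) b)

/-- Sum of a finite list of elements of the fibre over `x`. -/
def BundleData.listSum {X E : Type*} (B : BundleData X E) (x : X) (l : List E) : E :=
  l.foldr B.add (B.zero x)

/-- Continuous sections vanishing at infinity. -/
def BundleData.sectionsVanishing {X E : Type*} [TopologicalSpace X] [TopologicalSpace E]
    (B : BundleData X E) : Set (X → E) :=
  {f | Continuous f ∧ (∀ x, B.p (f x) = x) ∧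
    ∀ ε : ℝ, 0 < ε → IsCompact {x | ε ≤ B.norm (f x)}}

/-- A separable upper semicontinuous Banach bundle: `p` is a continuous open surjection (it is onto
because `p (zero x) = x`), every fibre is a complex Banach space, the norm is upper semicontinuous,
addition and each scalar multiplication are continuous, elements whose base points tend to `x`
and whose norms tend to `0` tend to the zero over `x`, and the sections vanishing at infinity are
separable for the supremum norm. -/
structure IsBanachBundle {X E : Type*} [TopologicalSpace X] [TopologicalSpace E]
    (B : BundleData X E) : Prop where
  continuous_p : Continuous B.p
  isOpenMap_p : IsOpenMap B.p
  p_zero : ∀ x, B.p (B.zero x) = x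
  p_add : ∀ a b, B.p a = B.p b → B.p (B.add a b) = B.p a
  p_smul : ∀ c a, B.p (B.smul c a) = B.p a
  add_assoc : ∀ a b c, B.p a = B.p b → B.p b = B.p c →
    B.add (B.add a b) c = B.add a (B.add b c)
  add_comm : ∀ a b, B.p a = B.p b → B.add a b = B.add b a
  add_zero : ∀ a, B.add a (B.zero (B.p a)) = a
  sub_self : ∀ a, B.sub a a = B.zero (B.p a)
  one_smul : ∀ a, B.smul 1 a = a
  mul_smul : ∀ c d a, B.smul (c * d) a = B.smul c (B.smul d a)
  add_smul : ∀ c d a, B.smul (c + d) a = B.add (B.smul c a) (B.smul d a)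
  smul_add : ∀ c a b, B.p a = B.p b → B.smul c (B.add a b) = B.add (B.smul c a) (B.smul c b)
  norm_nonneg : ∀ a, 0 ≤ B.norm a
  norm_eq_zero : ∀ a, B.norm a = 0 ↔ a = B.zero (B.p a)
  norm_add_le : ∀ a b, B.p a = B.p b → B.norm (B.add a b) ≤ B.norm a + B.norm b
  norm_smul : ∀ c a, B.norm (B.smul c a) = ‖c‖ * B.norm a
  complete : ∀ (x : X) (f : ℕ → E), (∀ n, B.p (f n) = x) →
    (∀ ε : ℝ, 0 < ε → ∃ N, ∀ m ≥ N, ∀ n ≥ N, B.norm (B.sub (f m) (f n)) < ε) →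
    ∃ a, B.p a = x ∧ Tendsto (fun n => B.norm (B.sub (f n) a)) atTop (𝓝 0)
  upperSemicontinuous_norm : UpperSemicontinuous B.norm
  continuousOn_add :
    ContinuousOn (fun q : E × E => B.add q.1 q.2) {q | B.p q.1 = B.p q.2}
  continuous_smul : ∀ c, Continuous (B.smul c)
  tendsto_zero : ∀ (x : X) (l : Filter E), Tendsto B.p l (𝓝 x) → Tendsto B.norm l (𝓝 0) →
    l ≤ 𝓝 (B.zero x)
  separable : ∃ S : Set (X → E), S.Countable ∧ S ⊆ B.sectionsVanishing ∧
    ∀ f ∈ B.sectionsVanishing, ∀ ε : ℝ, 0 < ε →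
      ∃ g ∈ S, ∀ x, B.norm (B.sub (f x) (g x)) < ε

/-! ### Fell bundles -/

/-- The operations of a Fell bundle.  The product `mul a b` is meaningful only if `p a` and `p b`
are composable. -/
structure FellData (X A : Type*) extends BundleData X A where
  mul : A → A → A
  star : A → A

/-- The fibre of the Banach bundle `E` over `t` is an imprimitivity bimodule between the
C*-algebras that are the fibres of `A` over `u` (left) and of `B` over `v` (right), for the
actions `la`, `ra` and the inner products `li` (left), `ri` (right): it is a full left and a full
right Hilbert module with adjointable actions, both Hilbert module norms are the norm of
the bundle, and `li e f · g = e · ri f g`.  An element of a C*-algebra is positive if it is of the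
form `c* c`. -/
structure IsImprimitivityBimodule {Y A Z B T E : Type*}
    (FA : FellData Y A) (u : Y) (FB : FellData Z B) (v : Z) (FE : BundleData T E) (t : T)
    (la : A → E → E) (ra : E → B → E) (li : E → E → A) (ri : E → E → B) : Prop where
  -- the left module structure
  p_la : ∀ a e, FA.p a = u → FE.p e = t → FE.p (la a e) = t
  add_la : ∀ a a' e, FA.p a = u → FA.p a' = u → FE.p e = t →
    la (FA.add a a') e = FE.add (la a e) (la a' e)
  la_add : ∀ a e e', FA.p a = u → FE.p e = t → FE.p e' = t →
    la a (FE.add e e') = FE.add (la a e) (la a e')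
  smul_la : ∀ c a e, FA.p a = u → FE.p e = t → la (FA.smul c a) e = FE.smul c (la a e)
  la_smul : ∀ c a e, FA.p a = u → FE.p e = t → la a (FE.smul c e) = FE.smul c (la a e)
  mul_la : ∀ a a' e, FA.p a = u → FA.p a' = u → FE.p e = t →
    la (FA.mul a a') e = la a (la a' e)
  -- the right module structure
  p_ra : ∀ e b, FE.p e = t → FB.p b = v → FE.p (ra e b) = t
  add_ra : ∀ e e' b, FE.p e = t → FE.p e' = t → FB.p b = v →
    ra (FE.add e e') b = FE.add (ra e b) (ra e' b)
  ra_add : ∀ e b b', FE.p e = t → FB.p b = v → FB.p b' = v →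
    ra e (FB.add b b') = FE.add (ra e b) (ra e b')
  smul_ra : ∀ c e b, FE.p e = t → FB.p b = v → ra (FE.smul c e) b = FE.smul c (ra e b)
  ra_smul : ∀ c e b, FE.p e = t → FB.p b = v → ra e (FB.smul c b) = FE.smul c (ra e b)
  ra_mul : ∀ e b b', FE.p e = t → FB.p b = v → FB.p b' = v →
    ra e (FB.mul b b') = ra (ra e b) b'
  la_ra : ∀ a e b, FA.p a = u → FE.p e = t → FB.p b = v → la a (ra e b) = ra (la a e) b
  -- the left inner product
  p_li : ∀ e f, FE.p e = t → FE.p f = t → FA.p (li e f) = u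
  add_li : ∀ e e' f, FE.p e = t → FE.p e' = t → FE.p f = t →
    li (FE.add e e') f = FA.add (li e f) (li e' f)
  smul_li : ∀ c e f, FE.p e = t → FE.p f = t → li (FE.smul c e) f = FA.smul c (li e f)
  la_li : ∀ a e f, FA.p a = u → FE.p e = t → FE.p f = t → li (la a e) f = FA.mul a (li e f)
  star_li : ∀ e f, FE.p e = t → FE.p f = t → FA.star (li e f) = li f e
  li_self_nonneg : ∀ e, FE.p e = t → ∃ c, FA.p c = u ∧ li e e = FA.mul (FA.star c) c
  norm_li_self : ∀ e, FE.p e = t → FA.norm (li e e) = FE.norm e ^ 2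
  li_full : ∀ a, FA.p a = u → ∀ ε : ℝ, 0 < ε → ∃ l : List (E × E),
    (∀ q ∈ l, FE.p q.1 = t ∧ FE.p q.2 = t) ∧
    FA.norm (FA.sub a (FA.listSum u (l.map fun q => li q.1 q.2))) < ε
  -- the right inner product
  p_ri : ∀ e f, FE.p e = t → FE.p f = t → FB.p (ri e f) = v
  ri_add : ∀ e f f', FE.p e = t → FE.p f = t → FE.p f' = t →
    ri e (FE.add f f') = FB.add (ri e f) (ri e f')
  ri_smul : ∀ c e f, FE.p e = t → FE.p f = t → ri e (FE.smul c f) = FB.smul c (ri e f)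
  ri_ra : ∀ e f b, FE.p e = t → FE.p f = t → FB.p b = v → ri e (ra f b) = FB.mul (ri e f) b
  star_ri : ∀ e f, FE.p e = t → FE.p f = t → FB.star (ri e f) = ri f e
  ri_self_nonneg : ∀ e, FE.p e = t → ∃ c, FB.p c = v ∧ ri e e = FB.mul (FB.star c) c
  norm_ri_self : ∀ e, FE.p e = t → FB.norm (ri e e) = FE.norm e ^ 2
  ri_full : ∀ b, FB.p b = v → ∀ ε : ℝ, 0 < ε → ∃ l : List (E × E),
    (∀ q ∈ l, FE.p q.1 = t ∧ FE.p q.2 = t) ∧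
    FB.norm (FB.sub b (FB.listSum v (l.map fun q => ri q.1 q.2))) < ε
  -- compatibility
  ri_la : ∀ a e f, FA.p a = u → FE.p e = t → FE.p f = t →
    ri (la a e) f = ri e (la (FA.star a) f)
  li_ra : ∀ e f b, FE.p e = t → FE.p f = t → FB.p b = v →
    li (ra e b) f = li e (ra f (FB.star b))
  li_la_eq_ra_ri : ∀ e f g, FE.p e = t → FE.p f = t → FE.p g = t →
    la (li e f) g = ra e (ri f g)

/-- `F` is a (saturated, separable, upper semicontinuous) Fell bundle over the groupoid `𝒢`. -/
structure IsFellBundle {X A : Type*} [TopologicalSpace X] [TopologicalSpace A]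
    (𝒢 : GroupoidData X) (F : FellData X A) : Prop
    extends IsBanachBundle F.toBundleData where
  p_mul : ∀ a b, 𝒢.s (F.p a) = 𝒢.r (F.p b) → F.p (F.mul a b) = 𝒢.mul (F.p a) (F.p b)
  p_star : ∀ a, F.p (F.star a) = 𝒢.inv (F.p a)
  mul_assoc : ∀ a b c, 𝒢.s (F.p a) = 𝒢.r (F.p b) → 𝒢.s (F.p b) = 𝒢.r (F.p c) →
    F.mul (F.mul a b) c = F.mul a (F.mul b c)
  add_mul : ∀ a a' b, F.p a = F.p a' → 𝒢.s (F.p a) = 𝒢.r (F.p b) →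
    F.mul (F.add a a') b = F.add (F.mul a b) (F.mul a' b)
  mul_add : ∀ a b b', F.p b = F.p b' → 𝒢.s (F.p a) = 𝒢.r (F.p b) →
    F.mul a (F.add b b') = F.add (F.mul a b) (F.mul a b')
  smul_mul : ∀ c a b, 𝒢.s (F.p a) = 𝒢.r (F.p b) →
    F.mul (F.smul c a) b = F.smul c (F.mul a b)
  mul_smul' : ∀ c a b, 𝒢.s (F.p a) = 𝒢.r (F.p b) →
    F.mul a (F.smul c b) = F.smul c (F.mul a b)
  star_star : ∀ a, F.star (F.star a) = a
  star_add : ∀ a b, F.p a = F.p b → F.star (F.add a b) = F.add (F.star a) (F.star b)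
  star_smul : ∀ c a, F.star (F.smul c a) = F.smul ((starRingEnd ℂ) c) (F.star a)
  star_mul : ∀ a b, 𝒢.s (F.p a) = 𝒢.r (F.p b) →
    F.star (F.mul a b) = F.mul (F.star b) (F.star a)
  continuousOn_mul :
    ContinuousOn (fun q : A × A => F.mul q.1 q.2) {q | 𝒢.s (F.p q.1) = 𝒢.r (F.p q.2)}
  continuous_star : Continuous F.star
  -- the fibres over units are C*-algebras
  norm_mul_le : ∀ u ∈ 𝒢.units, ∀ a b, F.p a = u → F.p b = u →
    F.norm (F.mul a b) ≤ F.norm a * F.norm b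
  norm_star_mul_self : ∀ u ∈ 𝒢.units, ∀ a, F.p a = u →
    F.norm (F.mul (F.star a) a) = F.norm a ^ 2
  imprimitivity : ∀ x, IsImprimitivityBimodule F (𝒢.r x) F (𝒢.s x) F.toBundleData x
    F.mul F.mul (fun a b => F.mul a (F.star b)) (fun a b => F.mul (F.star a) b)

/-! ### Actions and equivalences of groupoids -/

/-- A left action of a groupoid on the space `T` with continuous open fibring map `ρ` into the unit
space; `act y t` is meaningful only if `s y = ρ t`. -/
structure IsLeftAction {Y T : Type*} [TopologicalSpace Y] [TopologicalSpace T]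
    (𝒢 : GroupoidData Y) (ρ : T → Y) (act : Y → T → T) : Prop where
  anchor_mem : ∀ t, ρ t ∈ 𝒢.units
  continuous_anchor : Continuous ρ
  isOpenMap_anchor : IsOpenMap (Set.codRestrict ρ 𝒢.units anchor_mem)
  anchor_act : ∀ y t, 𝒢.s y = ρ t → ρ (act y t) = 𝒢.r y
  mul_act : ∀ x y t, 𝒢.s x = 𝒢.r y → 𝒢.s y = ρ t → act (𝒢.mul x y) t = act x (act y t)
  unit_act : ∀ t, act (ρ t) t = t
  continuousOn_act :
    ContinuousOn (fun q : Y × T => act q.1 q.2) {q | 𝒢.s q.1 = ρ q.2}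

/-- A right action of a groupoid on the space `T` with continuous open fibring map `σ` into the
unit space; `act t y` is meaningful only if `σ t = r y`. -/
structure IsRightAction {Y T : Type*} [TopologicalSpace Y] [TopologicalSpace T]
    (𝒢 : GroupoidData Y) (σ : T → Y) (act : T → Y → T) : Prop where
  anchor_mem : ∀ t, σ t ∈ 𝒢.units
  continuous_anchor : Continuous σ
  isOpenMap_anchor : IsOpenMap (Set.codRestrict σ 𝒢.units anchor_mem)
  anchor_act : ∀ t y, σ t = 𝒢.r y → σ (act t y) = 𝒢.s y
  act_mul : ∀ t x y, σ t = 𝒢.r x → 𝒢.s x = 𝒢.r y → act t (𝒢.mul x y) = act (act t x) y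
  act_unit : ∀ t, act t (σ t) = t
  continuousOn_act :
    ContinuousOn (fun q : T × Y => act q.1 q.2) {q | σ q.1 = 𝒢.r q.2}

/-- `T` is an equivalence between the groupoids `𝒢` (left) and `ℋ` (right): both actions are free
and proper, they commute, `ρ` induces a bijection (hence, being continuous and open, a
homeomorphism) of the space of `ℋ`-orbits onto the unit space of `𝒢`, and `σ` induces a bijection
of the space of `𝒢`-orbits onto the unit space of `ℋ`. -/
structure IsGroupoidEquivalence {Y Z T : Type*} [TopologicalSpace Y] [TopologicalSpace Z]
    [TopologicalSpace T] (𝒢 : GroupoidData Y) (ℋ : GroupoidData Z)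
    (ρ : T → Y) (lact : Y → T → T) (σ : T → Z) (ract : T → Z → T) : Prop where
  t2 : T2Space T
  locallyCompact : LocallyCompactSpace T
  secondCountable : SecondCountableTopology T
  left_action : IsLeftAction 𝒢 ρ lact
  left_free : ∀ y t, 𝒢.s y = ρ t → lact y t = t → y ∈ 𝒢.units
  left_proper : IsProperMap
    (fun q : {q : Y × T // 𝒢.s q.1 = ρ q.2} => (lact q.1.1 q.1.2, q.1.2))
  right_action : IsRightAction ℋ σ ract
  right_free : ∀ t z, σ t = ℋ.r z → ract t z = t → z ∈ ℋ.units
  right_proper : IsProperMap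
    (fun q : {q : T × Z // σ q.1 = ℋ.r q.2} => (q.1.1, ract q.1.1 q.1.2))
  anchor_lact : ∀ y t, 𝒢.s y = ρ t → σ (lact y t) = σ t
  anchor_ract : ∀ t z, σ t = ℋ.r z → ρ (ract t z) = ρ t
  commute : ∀ y t z, 𝒢.s y = ρ t → σ t = ℋ.r z → lact y (ract t z) = ract (lact y t) z
  surj_left : ∀ u ∈ 𝒢.units, ∃ t, ρ t = u
  orbit_right : ∀ t t', ρ t = ρ t' → ∃ z, σ t = ℋ.r z ∧ ract t z = t'
  surj_right : ∀ v ∈ ℋ.units, ∃ t, σ t = v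
  orbit_left : ∀ t t', σ t = σ t' → ∃ y, 𝒢.s y = ρ t ∧ lact y t = t'

/-! ### Equivalences of Fell bundles -/

/-- The operations of an equivalence of Fell bundles `A → Y` and `B → Z` carried by a bundle
`E → T`: fibring maps and actions of the groupoids on `T`, actions of the Fell bundles on `E`, and
the two inner products. -/
structure EquivalenceData (Y A Z B T E : Type*) where
  ρ : T → Y
  lact : Y → T → T
  σ : T → Z
  ract : T → Z → T
  la : A → E → E
  ra : E → B → E
  li : E → E → A
  ri : E → E → B

/-- A left action of the Fell bundle `FA` on the Banach bundle `FE`, over a left action of the base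
groupoid `𝒢` on the base of `FE`. -/
structure IsLeftFellAction {Y A T E : Type*} [TopologicalSpace A] [TopologicalSpace E]
    (𝒢 : GroupoidData Y) (FA : FellData Y A) (FE : BundleData T E)
    (ρ : T → Y) (lact : Y → T → T) (la : A → E → E) : Prop where
  p_la : ∀ a e, 𝒢.s (FA.p a) = ρ (FE.p e) → FE.p (la a e) = lact (FA.p a) (FE.p e)
  mul_la : ∀ a a' e, 𝒢.s (FA.p a) = 𝒢.r (FA.p a') → 𝒢.s (FA.p a') = ρ (FE.p e) →
    la (FA.mul a a') e = la a (la a' e)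
  norm_la_le : ∀ a e, 𝒢.s (FA.p a) = ρ (FE.p e) → FE.norm (la a e) ≤ FA.norm a * FE.norm e
  add_la : ∀ a a' e, FA.p a = FA.p a' → 𝒢.s (FA.p a) = ρ (FE.p e) →
    la (FA.add a a') e = FE.add (la a e) (la a' e)
  la_add : ∀ a e e', FE.p e = FE.p e' → 𝒢.s (FA.p a) = ρ (FE.p e) →
    la a (FE.add e e') = FE.add (la a e) (la a e')
  smul_la : ∀ c a e, 𝒢.s (FA.p a) = ρ (FE.p e) → la (FA.smul c a) e = FE.smul c (la a e)
  la_smul : ∀ c a e, 𝒢.s (FA.p a) = ρ (FE.p e) → la a (FE.smul c e) = FE.smul c (la a e)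
  continuousOn_la :
    ContinuousOn (fun q : A × E => la q.1 q.2) {q | 𝒢.s (FA.p q.1) = ρ (FE.p q.2)}

/-- A right action of the Fell bundle `FB` on the Banach bundle `FE`, over a right action of the
base groupoid `ℋ` on the base of `FE`. -/
structure IsRightFellAction {Z B T E : Type*} [TopologicalSpace B] [TopologicalSpace E]
    (ℋ : GroupoidData Z) (FB : FellData Z B) (FE : BundleData T E)
    (σ : T → Z) (ract : T → Z → T) (ra : E → B → E) : Prop where
  p_ra : ∀ e b, σ (FE.p e) = ℋ.r (FB.p b) → FE.p (ra e b) = ract (FE.p e) (FB.p b)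
  ra_mul : ∀ e b b', σ (FE.p e) = ℋ.r (FB.p b) → ℋ.s (FB.p b) = ℋ.r (FB.p b') →
    ra e (FB.mul b b') = ra (ra e b) b'
  norm_ra_le : ∀ e b, σ (FE.p e) = ℋ.r (FB.p b) → FE.norm (ra e b) ≤ FE.norm e * FB.norm b
  add_ra : ∀ e e' b, FE.p e = FE.p e' → σ (FE.p e) = ℋ.r (FB.p b) →
    ra (FE.add e e') b = FE.add (ra e b) (ra e' b)
  ra_add : ∀ e b b', FB.p b = FB.p b' → σ (FE.p e) = ℋ.r (FB.p b) →
    ra e (FB.add b b') = FE.add (ra e b) (ra e b')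
  smul_ra : ∀ c e b, σ (FE.p e) = ℋ.r (FB.p b) → ra (FE.smul c e) b = FE.smul c (ra e b)
  ra_smul : ∀ c e b, σ (FE.p e) = ℋ.r (FB.p b) → ra e (FB.smul c b) = FE.smul c (ra e b)
  continuousOn_ra :
    ContinuousOn (fun q : E × B => ra q.1 q.2) {q | σ (FE.p q.1) = ℋ.r (FB.p q.2)}

/-- The Banach bundle `FE` with the operations `D` is an equivalence, in the sense of Muhly and
Williams, between the Fell bundle `FA` over the groupoid `𝒢` and the Fell bundle `FB` over the
groupoid `ℋ`. -/
structure IsFellBundleEquivalence {Y A Z B T E : Type*}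
    [TopologicalSpace Y] [TopologicalSpace A] [TopologicalSpace Z] [TopologicalSpace B]
    [TopologicalSpace T] [TopologicalSpace E]
    (𝒢 : GroupoidData Y) (FA : FellData Y A) (ℋ : GroupoidData Z) (FB : FellData Z B)
    (FE : BundleData T E) (D : EquivalenceData Y A Z B T E) : Prop where
  -- the objects involved
  left_groupoid : IsLCGroupoid 𝒢
  left_fell : IsFellBundle 𝒢 FA
  right_groupoid : IsLCGroupoid ℋ
  right_fell : IsFellBundle ℋ FB
  banach : IsBanachBundle FE
  base : IsGroupoidEquivalence 𝒢 ℋ D.ρ D.lact D.σ D.ract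
  -- two commuting actions
  left_action : IsLeftFellAction 𝒢 FA FE D.ρ D.lact D.la
  right_action : IsRightFellAction ℋ FB FE D.σ D.ract D.ra
  commute : ∀ a e b, 𝒢.s (FA.p a) = D.ρ (FE.p e) → D.σ (FE.p e) = ℋ.r (FB.p b) →
    D.la a (D.ra e b) = D.ra (D.la a e) b
  -- the left inner product, a continuous sesquilinear map
  continuousOn_li : ContinuousOn (fun q : E × E => D.li q.1 q.2)
    {q | D.σ (FE.p q.1) = D.σ (FE.p q.2)}
  add_li : ∀ e e' f, FE.p e = FE.p e' → D.σ (FE.p e) = D.σ (FE.p f) →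
    D.li (FE.add e e') f = FA.add (D.li e f) (D.li e' f)
  smul_li : ∀ c e f, D.σ (FE.p e) = D.σ (FE.p f) →
    D.li (FE.smul c e) f = FA.smul c (D.li e f)
  li_add : ∀ e f f', FE.p f = FE.p f' → D.σ (FE.p e) = D.σ (FE.p f) →
    D.li e (FE.add f f') = FA.add (D.li e f) (D.li e f')
  li_smul : ∀ c e f, D.σ (FE.p e) = D.σ (FE.p f) →
    D.li e (FE.smul c f) = FA.smul ((starRingEnd ℂ) c) (D.li e f)
  -- the right inner product, a continuous sesquilinear map
  continuousOn_ri : ContinuousOn (fun q : E × E => D.ri q.1 q.2)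
    {q | D.ρ (FE.p q.1) = D.ρ (FE.p q.2)}
  add_ri : ∀ e e' f, FE.p e = FE.p e' → D.ρ (FE.p e) = D.ρ (FE.p f) →
    D.ri (FE.add e e') f = FB.add (D.ri e f) (D.ri e' f)
  smul_ri : ∀ c e f, D.ρ (FE.p e) = D.ρ (FE.p f) →
    D.ri (FE.smul c e) f = FB.smul ((starRingEnd ℂ) c) (D.ri e f)
  ri_add : ∀ e f f', FE.p f = FE.p f' → D.ρ (FE.p e) = D.ρ (FE.p f) →
    D.ri e (FE.add f f') = FB.add (D.ri e f) (D.ri e f')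
  ri_smul : ∀ c e f, D.ρ (FE.p e) = D.ρ (FE.p f) →
    D.ri e (FE.smul c f) = FB.smul c (D.ri e f)
  -- `p (li e f)` is the arrow that takes `p f` to `p e`, and `p (ri e f)` takes `p e` to `p f`
  p_li : ∀ e f, D.σ (FE.p e) = D.σ (FE.p f) →
    𝒢.s (FA.p (D.li e f)) = D.ρ (FE.p f) ∧ D.lact (FA.p (D.li e f)) (FE.p f) = FE.p e
  p_ri : ∀ e f, D.ρ (FE.p e) = D.ρ (FE.p f) →
    D.σ (FE.p e) = ℋ.r (FB.p (D.ri e f)) ∧ D.ract (FE.p e) (FB.p (D.ri e f)) = FE.p f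
  star_li : ∀ e f, D.σ (FE.p e) = D.σ (FE.p f) → FA.star (D.li e f) = D.li f e
  star_ri : ∀ e f, D.ρ (FE.p e) = D.ρ (FE.p f) → FB.star (D.ri e f) = D.ri f e
  mul_li : ∀ a e f, 𝒢.s (FA.p a) = D.ρ (FE.p e) → D.σ (FE.p e) = D.σ (FE.p f) →
    FA.mul a (D.li e f) = D.li (D.la a e) f
  ri_mul : ∀ e f b, D.ρ (FE.p e) = D.ρ (FE.p f) → D.σ (FE.p f) = ℋ.r (FB.p b) →
    FB.mul (D.ri e f) b = D.ri e (D.ra f b)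
  li_la_eq_ra_ri : ∀ e f g, D.σ (FE.p e) = D.σ (FE.p f) → D.ρ (FE.p f) = D.ρ (FE.p g) →
    D.la (D.li e f) g = D.ra e (D.ri f g)
  -- fibrewise imprimitivity bimodules
  imprimitivity : ∀ t, IsImprimitivityBimodule FA (D.ρ t) FB (D.σ t) FE t D.la D.ra D.li D.ri

/-! ### Group actions by automorphisms

Right actions of `H` are actions of the opposite group `Hᵐᵒᵖ`, with `x · h = op h • x`. -/

/-- `K` acts continuously on a topological groupoid by groupoid automorphisms. -/
structure ActsByGroupoidAut (K : Type*) {X : Type*} [Group K] [TopologicalSpace K]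
    [TopologicalSpace X] [MulAction K X] (𝒢 : GroupoidData X) : Prop where
  continuous_smul : Continuous fun q : K × X => q.1 • q.2
  r_smul : ∀ (k : K) x, 𝒢.r (k • x) = k • 𝒢.r x
  s_smul : ∀ (k : K) x, 𝒢.s (k • x) = k • 𝒢.s x
  inv_smul : ∀ (k : K) x, 𝒢.inv (k • x) = k • 𝒢.inv x
  mul_smul : ∀ (k : K) x y, 𝒢.s x = 𝒢.r y →
    𝒢.mul (k • x) (k • y) = k • 𝒢.mul x y

/-- `K` acts continuously on a Fell bundle by Fell bundle automorphisms. -/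
structure ActsByFellAut (K : Type*) {X A : Type*} [Group K] [TopologicalSpace K]
    [TopologicalSpace X] [TopologicalSpace A] [MulAction K X] [MulAction K A]
    (𝒢 : GroupoidData X) (F : FellData X A) : Prop where
  base : ActsByGroupoidAut K 𝒢
  continuous_smul : Continuous fun q : K × A => q.1 • q.2
  p_smul : ∀ (k : K) a, F.p (k • a) = k • F.p a
  add_smul : ∀ (k : K) a b, F.p a = F.p b → F.add (k • a) (k • b) = k • F.add a b
  zero_smul : ∀ (k : K) x, F.zero (k • x) = k • F.zero x
  smul_smul : ∀ (k : K) c a, F.smul c (k • a) = k • F.smul c a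
  norm_smul : ∀ (k : K) a, F.norm (k • a) = F.norm a
  mul_smul : ∀ (k : K) a b, 𝒢.s (F.p a) = 𝒢.r (F.p b) →
    F.mul (k • a) (k • b) = k • F.mul a b
  star_smul : ∀ (k : K) a, F.star (k • a) = k • F.star a

/-- The action is free and proper. -/
structure IsFreeProper (K X : Type*) [Group K] [TopologicalSpace K] [TopologicalSpace X]
    [MulAction K X] : Prop where
  free : ∀ (k : K) (x : X), k • x = x → k = 1
  proper : ProperSMul K X

/-! ### Orbit groupoids and orbit Fell bundles -/

/-- The orbit space, with the quotient topology. -/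
abbrev Orbits (K X : Type*) [Group K] [MulAction K X] : Type _ := MulAction.orbitRel.Quotient K X

/-- The orbit of a point. -/
def orb (K : Type*) {X : Type*} [Group K] [MulAction K X] (x : X) : Orbits K X :=
  Quotient.mk (MulAction.orbitRel K X) x

/-- The map of orbit spaces induced by an equivariant map. -/
def orbitMap {K X X' : Type*} [Group K] [MulAction K X] [MulAction K X']
    (f : X → X') (hf : ∀ (k : K) x, f (k • x) = k • f x) : Orbits K X → Orbits K X' :=
  Quotient.map f (by rintro _ b ⟨k, rfl⟩; exact ⟨k, (hf k b).symm⟩)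

/-- The partial binary operation on orbits induced by a partial binary operation `f` with domain
`dom`: the result for `P` and `Q` is the orbit of `f a b`, where `a` in `P` and `b` in `Q` are
any representatives such that `f a b` is defined. -/
def orbitOp (K : Type*) {X : Type*} [Group K] [MulAction K X] (dom : X → X → Prop)
    (f : X → X → X) (P Q : Orbits K X) : Orbits K X :=
  haveI : Nonempty (Orbits K X) := ⟨P⟩
  Classical.epsilon fun R => ∃ a b, orb K a = P ∧ orb K b = Q ∧ dom a b ∧ R = orb K (f a b)

/-- The orbit groupoid. -/
def orbitGroupoid {K X : Type*} [Group K] [TopologicalSpace K] [TopologicalSpace X]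
    [MulAction K X] (𝒢 : GroupoidData X) (h : ActsByGroupoidAut K 𝒢) :
    GroupoidData (Orbits K X) where
  r := orbitMap 𝒢.r h.r_smul
  s := orbitMap 𝒢.s h.s_smul
  inv := orbitMap 𝒢.inv h.inv_smul
  mul := orbitOp K (fun x y => 𝒢.s x = 𝒢.r y) 𝒢.mul

/-- The orbit Fell bundle. -/
def orbitFell {K X A : Type*} [Group K] [TopologicalSpace K] [TopologicalSpace X]
    [TopologicalSpace A] [MulAction K X] [MulAction K A]
    (𝒢 : GroupoidData X) (F : FellData X A) (h : ActsByFellAut K 𝒢 F) :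
    FellData (Orbits K X) (Orbits K A) where
  p := orbitMap F.p h.p_smul
  zero := orbitMap F.zero h.zero_smul
  add := orbitOp K (fun a b => F.p a = F.p b) F.add
  smul c := orbitMap (F.smul c) fun k a => h.smul_smul k c a
  norm := Quotient.lift F.norm (by rintro _ b ⟨k, rfl⟩; exact h.norm_smul k b)
  mul := orbitOp K (fun a b => 𝒢.s (F.p a) = 𝒢.r (F.p b)) F.mul
  star := orbitMap F.star h.star_smul

/-- For commuting actions, the action of `G` on the space of `H`-orbits. -/
def leftOrbitAct {G H X : Type*} [Group G] [Group H] [MulAction G X] [MulAction Hᵐᵒᵖ X]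
    [SMulCommClass G Hᵐᵒᵖ X] (g : G) : Orbits Hᵐᵒᵖ X → Orbits Hᵐᵒᵖ X :=
  orbitMap (fun x => g • x) fun k x => smul_comm g k x

/-- For commuting actions, the right action of `H` on the space of `G`-orbits;
`rightOrbitAct h y` is `y · h`. -/
def rightOrbitAct {G H X : Type*} [Group G] [Group H] [MulAction G X] [MulAction Hᵐᵒᵖ X]
    [SMulCommClass G Hᵐᵒᵖ X] (h : H) : Orbits G X → Orbits G X :=
  orbitMap (fun x => op h • x) fun g x => (smul_comm g (op h) x).symm

/-! ### Semidirect products -/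

/-- The semidirect-product groupoid for a left action `act` by automorphisms. -/
def semidirectGroupoid {Y G : Type*} [Group G] (𝒢 : GroupoidData Y) (act : G → Y → Y) :
    GroupoidData (Y × G) where
  r x := (𝒢.r x.1, 1)
  s x := (act x.2⁻¹ (𝒢.s x.1), 1)
  inv x := (act x.2⁻¹ (𝒢.inv x.1), x.2⁻¹)
  mul x y := (𝒢.mul x.1 (act x.2 y.1), x.2 * y.2)

/-- The semidirect-product Fell bundle for a left action by automorphisms, given by `actA` on the
total space. -/
def semidirectFell {Y A G : Type*} [Group G] (F : FellData Y A) (actA : G → A → A) :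
    FellData (Y × G) (A × G) where
  p a := (F.p a.1, a.2)
  zero x := (F.zero x.1, x.2)
  add a b := (F.add a.1 b.1, a.2)
  smul c a := (F.smul c a.1, a.2)
  norm a := F.norm a.1
  mul a b := (F.mul a.1 (actA a.2 b.1), a.2 * b.2)
  star a := (actA a.2⁻¹ (F.star a.1), a.2⁻¹)

/-- The semidirect-product groupoid for a right action by automorphisms; `act h y` is `y · h`. -/
def rightSemidirectGroupoid {Y H : Type*} [Group H] (𝒢 : GroupoidData Y) (act : H → Y → Y) :
    GroupoidData (H × Y) where
  r x := (1, act x.1⁻¹ (𝒢.r x.2))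
  s x := (1, 𝒢.s x.2)
  inv x := (x.1⁻¹, act x.1⁻¹ (𝒢.inv x.2))
  mul x y := (x.1 * y.1, 𝒢.mul (act y.1 x.2) y.2)

/-- The semidirect-product Fell bundle for a right action by automorphisms, given by `actA` on the
total space; `actA h a` is `a · h`. -/
def rightSemidirectFell {Y A H : Type*} [Group H] (F : FellData Y A) (actA : H → A → A) :
    FellData (H × Y) (H × A) where
  p a := (a.1, F.p a.2)
  zero x := (x.1, F.zero x.2)
  add a b := (a.1, F.add a.2 b.2)
  smul c a := (a.1, F.smul c a.2)
  norm a := F.norm a.2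
  mul a b := (a.1 * b.1, F.mul (actA b.1 a.2) b.2)
  star a := (a.1⁻¹, actA a.1⁻¹ (F.star a.2))

end FellBundles

end

open FellBundles

noncomputable section

namespace FellBundles

/-! ### Orbit maps, translations and representatives -/

section Core

/-! Freeness and properness of an action of `K` on `X` say that the element of `K` taking `x` to
`y`, defined when the two lie in one orbit, is unique and depends continuously on the pair
(`continuousOn_transl`). Hence an orbit in `A` has exactly one representative whose source (or
range, or base point) is a prescribed point of the corresponding orbit in `X`, and this
representative `rep` depends continuously on the data (`continuousOn_rep`). Two orbits that are
composable therefore have composable representatives, unique up to a common translation. So all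
partial operations descend to orbits (`orbitOp_orb`), they stay continuous because orbit maps are
open (`continuousOn_orbitOp`), and every algebraic identity is checked on composable
representatives, where it is an identity in the original bundle.

The analytic content of the fibres does not change: the fibre of the orbit bundle over the orbit of
`x`, and the fibre of a semidirect product over `(x, t)`, are isometric copies of the fibre over
`x`. The many axioms of an imprimitivity bimodule are therefore proved once to be invariant under
isomorphisms of the three fibres involved (`IsImprimitivityBimodule.transport`) and then only
transported.

Separability of the sections vanishing at infinity is not a fibrewise matter. A section of the orbit
bundle is an equivariant section of the bundle above, and a section over `Y × G` is a function on
`G` with values in sections over `Y`. After multiplication by cutoff functions both kinds of objects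
land in second countable spaces, and `exists_countable_dense_sections` turns this into separability.

For the equivalence, if `t` takes the source of `y` to that of `x`, then the orbit of `x (t · y⁻¹)`
together with `t` is an arrow taking `y` to `x`, and it depends continuously on `(x, y)`. The action
map thus has a continuous inverse defined on a closed set of pairs, which makes it proper
(`isProperMap_of_inverse`). The inner products are the same formulas with stars in place of
inverses. The relation between the two inner products, like the commutation of the two actions,
becomes associativity of one triple product once representatives are translated suitably; for the
inner products the product is `(k · e)(t · k · f*)(t · g)` (`leftInner_act_eq`). Submultiplicativity
of the actions needs the norm inequality between different fibres, which follows from the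
C*-identity and the positivity of `b b*` (`IsFellBundle.norm_mul_le_mul_norm`). -/

theorem continuousOn_of_isOpenQuotientMap {α β γ : Type*} [TopologicalSpace α]
    [TopologicalSpace β] [TopologicalSpace γ] {π : α → β} (hπ : IsOpenQuotientMap π) {f : β → γ}
    {S : Set β} (h : ContinuousOn (f ∘ π) (π ⁻¹' S)) : ContinuousOn f S := by
  intro b hb
  obtain ⟨a, rfl⟩ := hπ.surjective b
  intro U hU
  obtain ⟨V, hV, haV, hsub⟩ := mem_nhdsWithin.1 (h a hb hU)
  -- The preimage of `S` is saturated, so any preimage in `V` of a point of `S` already lies in it;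
  -- this is why no condition on `S` is needed.
  refine mem_nhdsWithin.2 ⟨π '' V, hπ.isOpenMap V hV, ⟨a, haV, rfl⟩, ?_⟩
  rintro _ ⟨⟨a', ha', rfl⟩, hS⟩
  exact hsub ⟨ha', hS⟩

variable {K X A : Type*} [Group K] [MulAction K X] [MulAction K A]

theorem orb_eq_iff {x y : X} : orb K x = orb K y ↔ ∃ k : K, k • y = x :=
  Quotient.eq (r := MulAction.orbitRel K X)

@[simp] theorem orb_smul (k : K) (x : X) : orb K (k • x) = orb K x := orb_eq_iff.2 ⟨k, rfl⟩

theorem orb_surjective (P : Orbits K X) : ∃ x, orb K x = P := Quotient.exists_rep P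

theorem orb_out (P : Orbits K X) : orb K P.out = P := Quotient.out_eq P

@[simp] theorem orbitMap_orb {X' : Type*} [MulAction K X'] (f : X → X')
    (hf : ∀ (k : K) x, f (k • x) = k • f x) (x : X) :
    orbitMap f hf (orb K x) = orb K (f x) := rfl

/-- A representative of an orbit can be chosen with a prescribed image under an equivariant map. -/
theorem exists_orb_eq {f : A → X} {hf : ∀ (k : K) a, f (k • a) = k • f a} {P : Orbits K A} {u : X}
    (h : orbitMap f hf P = orb K u) : ∃ a, orb K a = P ∧ f a = u := by
  obtain ⟨a, rfl⟩ := orb_surjective P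
  obtain ⟨k, hk⟩ := orb_eq_iff.1 h.symm
  exact ⟨k • a, by simp, by rw [hf, hk]⟩

variable (K) in
/-- A group element that takes `x` to `y`. -/
def transl (x y : X) : K := Classical.epsilon fun k => k • x = y

theorem transl_smul {x y : X} (h : orb K x = orb K y) : transl K x y • x = y :=
  Classical.epsilon_spec (p := fun k : K => k • x = y) (orb_eq_iff.1 h.symm)

/-- The representative of the orbit `P` that the equivariant map `f` takes to `u`. -/
def rep (f : A → X) (P : Orbits K A) (u : X) : A := transl K (f P.out) u • P.out

/-- Existence of a suitable translate needs only equality of orbits; freeness enters later, to make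
the representative unique. -/
theorem rep_spec {f : A → X} {hf : ∀ (k : K) a, f (k • a) = k • f a} {P : Orbits K A} {u : X}
    (h : orbitMap f hf P = orb K u) : orb K (rep f P u) = P ∧ f (rep f P u) = u := by
  refine ⟨by rw [rep, orb_smul, orb_out], ?_⟩
  rw [rep, hf]
  apply transl_smul
  rw [← h, ← orbitMap_orb f hf, orb_out]

theorem continuous_orbitMap {X' : Type*} [MulAction K X'] [TopologicalSpace X]
    [TopologicalSpace X'] {f : X → X'} {hf : ∀ (k : K) x, f (k • x) = k • f x} (hc : Continuous f) : Continuous (orbitMap f hf) :=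
  hc.quotient_map' _

variable [TopologicalSpace K] [TopologicalSpace X]

theorem isOpenQuotientMap_orb (h : Continuous fun q : K × X => q.1 • q.2) :
    IsOpenQuotientMap (orb K : X → Orbits K X) :=
  haveI : ContinuousSMul K X := ⟨h⟩
  MulAction.isOpenQuotientMap_quotientMk

theorem IsFreeProper.eq_of_smul_eq (h : IsFreeProper K X) {k l : K} {x : X}
    (hkl : k • x = l • x) : k = l := by
  have := h.free (l⁻¹ * k) x (by rw [mul_smul, hkl, inv_smul_smul])
  exact (inv_mul_eq_one.1 this).symm

theorem transl_eq (h : IsFreeProper K X) {k : K} {x y : X} (hk : k • x = y) :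
    transl K x y = k := by
  refine h.eq_of_smul_eq (x := x) ?_
  rw [hk]
  exact transl_smul (orb_eq_iff.2 ⟨k⁻¹, by rw [← hk, inv_smul_smul]⟩)

theorem IsFreeProper.isClosedEmbedding (h : IsFreeProper K X) :
    IsClosedEmbedding fun q : K × X => (q.1 • q.2, q.2) := by
  have hp := h.proper.isProperMap_smul_pair
  refine .of_continuous_injective_isClosedMap hp.continuous ?_ hp.isClosedMap
  rintro ⟨k, x⟩ ⟨l, y⟩ hq
  obtain ⟨h1, rfl⟩ := Prod.mk.inj hq
  rw [show k = l from h.eq_of_smul_eq h1]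

/-- Since `(k, x) ↦ (k • x, x)` is a closed embedding, convergence of the pair `(transl x y, x)` may
be tested on its image `(y, x)`, where it is obvious. -/
theorem continuousOn_transl (h : IsFreeProper K X) :
    ContinuousOn (fun q : X × X => transl K q.1 q.2) {q | orb K q.1 = orb K q.2} := by
  intro q hq
  have key : Tendsto (fun q : X × X => (transl K q.1 q.2, q.1))
      (𝓝[{q | orb K q.1 = orb K q.2}] q) (𝓝 (transl K q.1 q.2, q.1)) := by
    rw [h.isClosedEmbedding.isInducing.tendsto_nhds_iff]
    have h1 : Tendsto (fun q : X × X => (q.2, q.1)) (𝓝[{q | orb K q.1 = orb K q.2}] q)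
        (𝓝 (q.2, q.1)) := (continuous_swap.tendsto q).mono_left nhdsWithin_le_nhds
    rw [transl_smul hq]
    refine h1.congr' ?_
    filter_upwards [self_mem_nhdsWithin] with q' hq'
    simp only [Function.comp, transl_smul hq']
  exact (continuous_fst.tendsto _).comp key

/-- `rep` is built from the arbitrary representative `P.out`. Freeness makes the result independent
of that choice: replacing `P.out = k • a` by `a` changes the translating element by `k`, and the two
changes cancel. -/
theorem rep_orb_eq (h : IsFreeProper K X) {f : A → X} (hf : ∀ (k : K) a, f (k • a) = k • f a)
    {a : A} {u : X} (hu : orb K (f a) = orb K u) :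
    rep f (orb K a) u = transl K (f a) u • a := by
  obtain ⟨k, hk⟩ := orb_eq_iff.1 (orb_out (orb K a))
  obtain ⟨l, rfl⟩ := orb_eq_iff.1 hu.symm
  rw [rep, ← hk, hf, transl_eq h (k := l) rfl, transl_eq h (k := l * k⁻¹), smul_smul]
  · simp
  · rw [smul_smul]; simp

theorem rep_orb (h : IsFreeProper K X) {f : A → X} (hf : ∀ (k : K) a, f (k • a) = k • f a)
    {a : A} {u : X} (hu : f a = u) : rep f (orb K a) u = a := by
  subst hu
  rw [rep_orb_eq h hf rfl, transl_eq h (one_smul K _), one_smul]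

/-- Any other composable pair of representatives is `(k • a, l • b)`. Comparing the anchors gives `k
• f₂ b = l • f₂ b`, so freeness forces `k = l`, and the value only moves within its orbit. -/
theorem orbitOp_orb (h : IsFreeProper K X) {f₁ f₂ : A → X} {op : A → A → A}
    (h₁ : ∀ (k : K) a, f₁ (k • a) = k • f₁ a) (h₂ : ∀ (k : K) a, f₂ (k • a) = k • f₂ a)
    (hop : ∀ (k : K) a b, f₁ a = f₂ b → op (k • a) (k • b) = k • op a b)
    {a b : A} (hab : f₁ a = f₂ b) :
    orbitOp K (fun a b => f₁ a = f₂ b) op (orb K a) (orb K b) = orb K (op a b) := by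
  have hex : ∃ R, ∃ a' b', orb K a' = orb K a ∧ orb K b' = orb K b ∧ f₁ a' = f₂ b' ∧
      R = orb K (op a' b') := ⟨_, a, b, rfl, rfl, hab, rfl⟩
  obtain ⟨a', b', ha, hb, hab', hR⟩ := Classical.epsilon_spec hex
  refine hR.trans ?_
  obtain ⟨k, rfl⟩ := orb_eq_iff.1 ha
  obtain ⟨l, rfl⟩ := orb_eq_iff.1 hb
  rw [h₁, h₂, hab] at hab'
  rw [h.eq_of_smul_eq hab', hop _ _ _ hab, orb_smul]

variable [TopologicalSpace A]

theorem continuousOn_rep (h : IsFreeProper K X) (hA : Continuous fun q : K × A => q.1 • q.2)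
    {f : A → X} (hf : ∀ (k : K) a, f (k • a) = k • f a) (hc : Continuous f) :
    ContinuousOn (fun q : Orbits K A × X => rep f q.1 q.2)
      {q | orbitMap f hf q.1 = orb K q.2} := by
  refine continuousOn_of_isOpenQuotientMap ((isOpenQuotientMap_orb hA).prodMap .id) ?_
  have h1 : ContinuousOn (fun q : A × X => transl K (f q.1) q.2 • q.1)
      {q | orb K (f q.1) = orb K q.2} := by
    refine hA.comp_continuousOn (ContinuousOn.prodMk ?_ continuousOn_fst)
    exact (continuousOn_transl h).comp (f := fun q : A × X => (f q.1, q.2))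
      (by fun_prop) fun q hq => hq
  exact h1.congr fun q hq => rep_orb_eq h hf hq

theorem continuousOn_orbitOp (h : IsFreeProper K X)
    (hA : Continuous fun q : K × A => q.1 • q.2) {f₁ f₂ : A → X} {op : A → A → A}
    (h₁ : ∀ (k : K) a, f₁ (k • a) = k • f₁ a) (h₂ : ∀ (k : K) a, f₂ (k • a) = k • f₂ a)
    (hop : ∀ (k : K) a b, f₁ a = f₂ b → op (k • a) (k • b) = k • op a b)
    (hc₁ : Continuous f₁) (hc₂ : Continuous f₂)
    (hc : ContinuousOn (fun q : A × A => op q.1 q.2) {q | f₁ q.1 = f₂ q.2}) :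
    ContinuousOn (fun q : Orbits K A × Orbits K A =>
        orbitOp K (fun a b => f₁ a = f₂ b) op q.1 q.2)
      {q | orbitMap f₁ h₁ q.1 = orbitMap f₂ h₂ q.2} := by
  have hπ := isOpenQuotientMap_orb hA
  -- Only the first argument is lifted. The second remains an orbit, and `rep` selects its
  -- representative composable with the lift; lifting both would leave an incomposable pair.
  refine continuousOn_of_isOpenQuotientMap (hπ.prodMap .id) ?_
  have h1 : ContinuousOn (fun q : A × Orbits K A => rep f₂ q.2 (f₁ q.1))
      {q | orbitMap f₂ h₂ q.2 = orb K (f₁ q.1)} :=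
    (continuousOn_rep h hA h₂ hc₂).comp (f := fun q : A × Orbits K A => (q.2, f₁ q.1))
      (by fun_prop) fun q hq => hq
  have h2 : ContinuousOn (fun q : A × Orbits K A => orb K (op q.1 (rep f₂ q.2 (f₁ q.1))))
      {q | orbitMap f₂ h₂ q.2 = orb K (f₁ q.1)} :=
    hπ.continuous.comp_continuousOn
      (hc.comp (continuousOn_fst.prodMk h1) fun q hq => (rep_spec hq).2.symm)
  refine (h2.mono fun q hq => Eq.symm hq).congr ?_
  rintro ⟨a, Q⟩ hq
  obtain ⟨hQ, hb⟩ := rep_spec (Eq.symm hq)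
  simp only at hQ hb
  generalize rep f₂ Q (f₁ a) = b at hQ hb
  subst hQ
  simp only [Function.comp, Prod.map, id]
  rw [orbitOp_orb h h₁ h₂ hop hb.symm, rep_orb h h₂ hb]

end Core

/-! ### Groupoids and orbit groupoids -/

section Groupoids

/-- Openness onto a subspace, expressed by filters of the ambient space. In this form it composes
with orbit maps and multiplies with constant factors without handling subtypes. -/
theorem isOpenMap_codRestrict_iff {α β : Type*} [TopologicalSpace α] [TopologicalSpace β]
    {f : α → β} {S : Set β} (h : ∀ a, f a ∈ S) :
    IsOpenMap (Set.codRestrict f S h) ↔ ∀ a, 𝓝[S] (f a) ≤ map f (𝓝 a) := by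
  rw [isOpenMap_iff_nhds_le]
  refine forall_congr' fun a => ?_
  rw [← map_le_map_iff Subtype.val_injective, map_map]
  have : map Subtype.val (𝓝 (codRestrict f S h a)) = 𝓝[S] (f a) := map_nhds_subtype_val _
  rw [this]
  rfl

theorem isOpenMap_rangeFactorization_iff {α β : Type*} [TopologicalSpace α] [TopologicalSpace β]
    {f : α → β} : IsOpenMap (Set.rangeFactorization f) ↔ ∀ a, 𝓝[range f] (f a) ≤ map f (𝓝 a) :=
  isOpenMap_codRestrict_iff (S := range f) fun a => ⟨a, rfl⟩

/-- Openness of the orbit map relative to an invariant set: a point whose orbit meets `S` lies in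
`S`. -/
theorem nhdsWithin_orb_le {K X : Type*} [Group K] [MulAction K X] [TopologicalSpace K]
    [TopologicalSpace X] (hX : Continuous fun q : K × X => q.1 • q.2) {S : Set X}
    (hS : ∀ (k : K), ∀ x ∈ S, k • x ∈ S) (x : X) :
    𝓝[orb K '' S] (orb K x) ≤ map (orb K) (𝓝[S] x) := by
  intro t ht
  obtain ⟨V, hV, hxV, hsub⟩ := mem_nhdsWithin.1 (mem_map.1 ht)
  refine mem_nhdsWithin.2 ⟨orb K '' V, (isOpenQuotientMap_orb hX).isOpenMap V hV,
    ⟨x, hxV, rfl⟩, ?_⟩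
  rintro _ ⟨⟨v, hv, rfl⟩, ⟨s, hs, hsv⟩⟩
  obtain ⟨k, rfl⟩ := orb_eq_iff.1 hsv.symm
  exact hsub ⟨hv, hS k s hs⟩

variable {X : Type*} [TopologicalSpace X] {𝒢 : GroupoidData X}

/-! ### Consequences of the groupoid axioms -/

namespace IsLCGroupoid

variable (h : IsLCGroupoid 𝒢)
include h

/-- Continuity of the range and source maps is not an axiom; it follows from `r x = x x⁻¹` and `s x
= x⁻¹ x`. -/
theorem continuous_r : Continuous 𝒢.r := by
  have : Continuous fun x => 𝒢.mul x (𝒢.inv x) :=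
    h.continuousOn_mul.comp_continuous (continuous_id.prodMk h.continuous_inv)
      fun x => (h.r_inv x).symm
  simpa only [h.mul_inv] using this

theorem continuous_s : Continuous 𝒢.s := by
  have : Continuous fun x => 𝒢.mul (𝒢.inv x) x :=
    h.continuousOn_mul.comp_continuous (h.continuous_inv.prodMk continuous_id) h.s_inv
  simpa only [h.inv_mul] using this

theorem mem_units_iff {u : X} : u ∈ 𝒢.units ↔ 𝒢.r u = u :=
  ⟨by rintro ⟨x, rfl⟩; exact h.r_r x, fun hu => ⟨u, hu⟩⟩

theorem r_of_mem {u : X} (hu : u ∈ 𝒢.units) : 𝒢.r u = u := h.mem_units_iff.1 hu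

theorem s_of_mem {u : X} (hu : u ∈ 𝒢.units) : 𝒢.s u = u := by
  rw [← h.r_of_mem hu, h.s_r]

theorem s_mem (x : X) : 𝒢.s x ∈ 𝒢.units := ⟨𝒢.s x, h.r_s x⟩

theorem inv_inv (x : X) : 𝒢.inv (𝒢.inv x) = x := by
  have h1 : 𝒢.s (𝒢.inv (𝒢.inv x)) = 𝒢.s x := by rw [h.s_inv, h.r_inv]
  calc 𝒢.inv (𝒢.inv x) = 𝒢.mul (𝒢.inv (𝒢.inv x)) (𝒢.mul (𝒢.inv x) x) := by
        rw [h.inv_mul, ← h1, h.mul_s_self]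
    _ = x := by
        rw [← h.mul_assoc _ _ _ (h.s_inv _) (h.s_inv _), h.inv_mul, h.s_inv, h.r_mul_self]

theorem mul_inv_cancel_right {x y : X} (hxy : 𝒢.s x = 𝒢.r y) :
    𝒢.mul (𝒢.mul x y) (𝒢.inv y) = x := by
  rw [h.mul_assoc _ _ _ hxy (h.r_inv y).symm, h.mul_inv, ← hxy, h.mul_s_self]

theorem inv_mul_cancel_right {x y : X} (hxy : 𝒢.s x = 𝒢.s y) :
    𝒢.mul (𝒢.mul x (𝒢.inv y)) y = x := by
  rw [h.mul_assoc _ _ _ (hxy.trans (h.r_inv y).symm) (h.s_inv y), h.inv_mul, ← hxy, h.mul_s_self]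

theorem inv_mul_cancel_left {x y : X} (hxy : 𝒢.s x = 𝒢.r y) :
    𝒢.mul (𝒢.inv x) (𝒢.mul x y) = y := by
  rw [← h.mul_assoc _ _ _ (h.s_inv x) hxy, h.inv_mul, hxy, h.r_mul_self]

theorem mul_inv_cancel_left {x y : X} (hxy : 𝒢.r x = 𝒢.r y) :
    𝒢.mul x (𝒢.mul (𝒢.inv x) y) = y := by
  rw [← h.mul_assoc _ _ _ (h.r_inv x).symm ((h.s_inv x).trans hxy), h.mul_inv, hxy, h.r_mul_self]

theorem mem_units_of_mul_eq_right {x y : X} (hxy : 𝒢.s x = 𝒢.r y) (he : 𝒢.mul x y = y) :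
    x ∈ 𝒢.units := by
  have := h.mul_inv_cancel_right hxy
  rw [he, h.mul_inv] at this
  exact ⟨y, this⟩

theorem mem_units_of_mul_eq_left {x y : X} (hxy : 𝒢.s x = 𝒢.r y) (he : 𝒢.mul x y = x) :
    y ∈ 𝒢.units := by
  have := h.inv_mul_cancel_left hxy
  rw [he, h.inv_mul] at this
  exact ⟨𝒢.s x, by rw [h.r_s, this]⟩

theorem nhdsWithin_units_le_map_r (x : X) : 𝓝[𝒢.units] (𝒢.r x) ≤ map 𝒢.r (𝓝 x) :=
  isOpenMap_rangeFactorization_iff.1 h.isOpenMap_r x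

/-- The source map is the range map after inversion, and inversion is open because it is a
continuous involution. -/
theorem nhdsWithin_units_le_map_s (x : X) : 𝓝[𝒢.units] (𝒢.s x) ≤ map 𝒢.s (𝓝 x) := by
  have hs : 𝒢.s = 𝒢.r ∘ 𝒢.inv := funext fun x => (h.r_inv x).symm
  have h1 : 𝓝 (𝒢.inv x) ≤ map 𝒢.inv (𝓝 x) := by
    refine le_map_of_right_inverse (mba := 𝒢.inv) (Eventually.of_forall h.inv_inv) ?_
    simpa only [h.inv_inv] using h.continuous_inv.tendsto (𝒢.inv x)
  rw [hs, ← map_map]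
  exact (h.nhdsWithin_units_le_map_r _).trans (map_mono h1)

end IsLCGroupoid

/-! ### Orbit groupoids -/

variable {K : Type*} [Group K] [TopologicalSpace K] [MulAction K X]

theorem ActsByGroupoidAut.smul_mem_units (hK : ActsByGroupoidAut K 𝒢) (k : K) :
    ∀ u ∈ 𝒢.units, k • u ∈ 𝒢.units := by
  rintro _ ⟨x, rfl⟩
  exact ⟨k • x, hK.r_smul k x⟩

theorem orbitGroupoid_mul_orb (hK : ActsByGroupoidAut K 𝒢) (hfp : IsFreeProper K X) {x y : X}
    (hxy : 𝒢.s x = 𝒢.r y) :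
    (orbitGroupoid 𝒢 hK).mul (orb K x) (orb K y) = orb K (𝒢.mul x y) :=
  orbitOp_orb hfp hK.s_smul hK.r_smul hK.mul_smul hxy

@[simp] theorem orbitGroupoid_r_orb (hK : ActsByGroupoidAut K 𝒢) (x : X) :
    (orbitGroupoid 𝒢 hK).r (orb K x) = orb K (𝒢.r x) := rfl

@[simp] theorem orbitGroupoid_s_orb (hK : ActsByGroupoidAut K 𝒢) (x : X) :
    (orbitGroupoid 𝒢 hK).s (orb K x) = orb K (𝒢.s x) := rfl

@[simp] theorem orbitGroupoid_inv_orb (hK : ActsByGroupoidAut K 𝒢) (x : X) :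
    (orbitGroupoid 𝒢 hK).inv (orb K x) = orb K (𝒢.inv x) := rfl

theorem orbitGroupoid_units (hK : ActsByGroupoidAut K 𝒢) :
    (orbitGroupoid 𝒢 hK).units = orb K '' 𝒢.units := by
  ext P
  constructor
  · rintro ⟨Q, rfl⟩
    obtain ⟨x, rfl⟩ := orb_surjective Q
    exact ⟨_, ⟨x, rfl⟩, rfl⟩
  · rintro ⟨_, ⟨x, rfl⟩, rfl⟩
    exact ⟨orb K x, rfl⟩

theorem exists_orb_s_eq (hK : ActsByGroupoidAut K 𝒢) {P : Orbits K X} {u : X}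
    (h : (orbitGroupoid 𝒢 hK).s P = orb K u) : ∃ x, orb K x = P ∧ 𝒢.s x = u :=
  exists_orb_eq (hf := hK.s_smul) h

theorem exists_orb_r_eq (hK : ActsByGroupoidAut K 𝒢) {P : Orbits K X} {u : X}
    (h : orb K u = (orbitGroupoid 𝒢 hK).r P) : ∃ x, orb K x = P ∧ u = 𝒢.r x := by
  obtain ⟨x, hx, rfl⟩ := exists_orb_eq (hf := hK.r_smul) h.symm
  exact ⟨x, hx, rfl⟩

theorem isLCGroupoid_orbitGroupoid (h : IsLCGroupoid 𝒢) (hK : ActsByGroupoidAut K 𝒢)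
    (hfp : IsFreeProper K X) : IsLCGroupoid (orbitGroupoid 𝒢 hK) := by
  have hπ := isOpenQuotientMap_orb hK.continuous_smul
  have := hfp.proper
  have := h.locallyCompact
  have := h.secondCountable
  -- Properness of the action is what makes the orbit space Hausdorff.
  have hT2 : T2Space (Orbits K X) := t2Space_quotient_mulAction_of_properSMul
  have hmul := @orbitGroupoid_mul_orb X _ 𝒢 K _ _ _ hK hfp
  -- Every axiom about composable orbits is reduced to composable representatives: the first is
  -- arbitrary and the second is translated to fit.
  have hex1 : ∀ {P Q : Orbits K X}, (orbitGroupoid 𝒢 hK).s P = (orbitGroupoid 𝒢 hK).r Q →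
      ∃ x y, orb K x = P ∧ orb K y = Q ∧ 𝒢.s x = 𝒢.r y := by
    intro P Q hPQ
    obtain ⟨x, rfl⟩ := orb_surjective P
    obtain ⟨y, hy, hxy⟩ := exists_orb_r_eq hK hPQ
    exact ⟨x, y, rfl, hy, hxy⟩
  exact
  { t2 := hT2
    locallyCompact := hπ.locallyCompactSpace
    secondCountable := ContinuousConstSMul.secondCountableTopology
    r_r := fun P => by
      obtain ⟨x, rfl⟩ := orb_surjective P
      simp [h.r_r]
    s_r := fun P => by
      obtain ⟨x, rfl⟩ := orb_surjective P
      simp [h.s_r]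
    r_s := fun P => by
      obtain ⟨x, rfl⟩ := orb_surjective P
      simp [h.r_s]
    s_s := fun P => by
      obtain ⟨x, rfl⟩ := orb_surjective P
      simp [h.s_s]
    r_mul := fun P Q hPQ => by
      obtain ⟨x, y, rfl, rfl, hxy⟩ := hex1 hPQ
      simp [hmul hxy, h.r_mul _ _ hxy]
    s_mul := fun P Q hPQ => by
      obtain ⟨x, y, rfl, rfl, hxy⟩ := hex1 hPQ
      simp [hmul hxy, h.s_mul _ _ hxy]
    mul_assoc := fun P Q R hPQ hQR => by
      obtain ⟨x, y, rfl, rfl, hxy⟩ := hex1 hPQ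
      obtain ⟨z, rfl, hyz⟩ := exists_orb_r_eq hK hQR
      rw [hmul hxy, hmul hyz, hmul (by rw [h.s_mul _ _ hxy, hyz]),
        hmul (by rw [h.r_mul _ _ hyz, hxy]), h.mul_assoc _ _ _ hxy hyz]
    r_mul_self := fun P => by
      obtain ⟨x, rfl⟩ := orb_surjective P
      rw [orbitGroupoid_r_orb, hmul (h.s_r x), h.r_mul_self]
    mul_s_self := fun P => by
      obtain ⟨x, rfl⟩ := orb_surjective P
      rw [orbitGroupoid_s_orb, hmul (h.r_s x).symm, h.mul_s_self]
    r_inv := fun P => by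
      obtain ⟨x, rfl⟩ := orb_surjective P
      simp [h.r_inv]
    s_inv := fun P => by
      obtain ⟨x, rfl⟩ := orb_surjective P
      simp [h.s_inv]
    mul_inv := fun P => by
      obtain ⟨x, rfl⟩ := orb_surjective P
      rw [orbitGroupoid_inv_orb, hmul (h.r_inv x).symm, h.mul_inv, orbitGroupoid_r_orb]
    inv_mul := fun P => by
      obtain ⟨x, rfl⟩ := orb_surjective P
      rw [orbitGroupoid_inv_orb, hmul (h.s_inv x), h.inv_mul, orbitGroupoid_s_orb]
    continuous_inv := continuous_orbitMap (hf := hK.inv_smul) h.continuous_inv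
    continuousOn_mul := continuousOn_orbitOp hfp hK.continuous_smul hK.s_smul hK.r_smul
      hK.mul_smul h.continuous_s h.continuous_r h.continuousOn_mul
    isOpenMap_r := by
      rw [isOpenMap_rangeFactorization_iff]
      intro P
      obtain ⟨x, rfl⟩ := orb_surjective P
      change 𝓝[(orbitGroupoid 𝒢 hK).units] _ ≤ _
      rw [orbitGroupoid_units, ← hπ.map_nhds_eq, map_map]
      refine (nhdsWithin_orb_le hK.continuous_smul hK.smul_mem_units (𝒢.r x)).trans ?_
      refine (map_mono (h.nhdsWithin_units_le_map_r x)).trans_eq ?_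
      rw [map_map]
      rfl }

end Groupoids

/-! ### Transport of imprimitivity bimodules along isomorphisms of fibres -/

section Transport

/-- `φ` is an isometric isomorphism of the fibre of `B` over `x` onto the fibre of `B'`
over `x'`. -/
structure IsFibreIso {X E X' E' : Type*} (B : BundleData X E) (x : X) (B' : BundleData X' E')
    (x' : X') (φ : E → E') : Prop where
  map_p : ∀ a, B.p a = x → B'.p (φ a) = x'
  surj : ∀ a', B'.p a' = x' → ∃ a, B.p a = x ∧ φ a = a'
  map_zero : φ (B.zero x) = B'.zero x'
  map_add : ∀ a b, B.p a = x → B.p b = x → φ (B.add a b) = B'.add (φ a) (φ b)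
  map_smul : ∀ c a, B.p a = x → φ (B.smul c a) = B'.smul c (φ a)
  map_norm : ∀ a, B.p a = x → B'.norm (φ a) = B.norm a

/-- `φ` is an isomorphism of the C*-algebra that is the fibre of `F` over `u` onto the fibre of `F'`
over `u'`. -/
structure IsFibreStarIso {X A X' A' : Type*} (F : FellData X A) (u : X) (F' : FellData X' A')
    (u' : X') (φ : A → A') : Prop
    extends IsFibreIso F.toBundleData u F'.toBundleData u' φ where
  p_mul : ∀ a b, F.p a = u → F.p b = u → F.p (F.mul a b) = u
  p_star : ∀ a, F.p a = u → F.p (F.star a) = u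
  map_mul : ∀ a b, F.p a = u → F.p b = u → φ (F.mul a b) = F'.mul (φ a) (φ b)
  map_star : ∀ a, F.p a = u → φ (F.star a) = F'.star (φ a)

namespace IsFibreIso

variable {X E X' E' : Type*} [TopologicalSpace X] [TopologicalSpace E] {B : BundleData X E} {x : X}
  {B' : BundleData X' E'} {x' : X'} {φ : E → E'}

theorem p_listSum (hB : IsBanachBundle B) :
    ∀ l : List E, (∀ a ∈ l, B.p a = x) → B.p (B.listSum x l) = x
  | [], _ => hB.p_zero x
  | a :: l, hl => by
    have h1 := p_listSum hB l fun b hb => hl b (List.mem_cons_of_mem _ hb)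
    have h2 := hl a List.mem_cons_self
    exact (hB.p_add _ _ (h2.trans h1.symm)).trans h2

theorem map_listSum (h : IsFibreIso B x B' x' φ) (hB : IsBanachBundle B) :
    ∀ l : List E, (∀ a ∈ l, B.p a = x) → φ (B.listSum x l) = B'.listSum x' (l.map φ)
  | [], _ => h.map_zero
  | a :: l, hl => by
    have h1 : ∀ b ∈ l, B.p b = x := fun b hb => hl b (List.mem_cons_of_mem _ hb)
    have h2 := h.map_listSum hB l h1
    exact (h.map_add _ _ (hl a List.mem_cons_self) (p_listSum hB l h1)).trans
      (congrArg (B'.add (φ a)) h2)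

theorem map_sub (h : IsFibreIso B x B' x' φ) (hB : IsBanachBundle B) {a b : E} (ha : B.p a = x)
    (hb : B.p b = x) : φ (B.sub a b) = B'.sub (φ a) (φ b) := by
  rw [BundleData.sub, h.map_add _ _ ha ((hB.p_smul _ _).trans hb), h.map_smul _ _ hb]
  rfl

end IsFibreIso

theorem IsBanachBundle.p_sub {X E : Type*} [TopologicalSpace X] [TopologicalSpace E]
    {B : BundleData X E} (hB : IsBanachBundle B) {a b : E} (hab : B.p a = B.p b) :
    B.p (B.sub a b) = B.p a :=
  hB.p_add _ _ (hab.trans (hB.p_smul _ _).symm)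

/-- Each axiom speaks only of elements of three fibres, so its arguments can be pulled back by
surjectivity, the axiom applied there, and the result pushed forward. The Banach bundle hypotheses
serve to keep sums and scalar multiples in the fibre, where the maps are known to respect the
operations. -/
theorem IsImprimitivityBimodule.transport {Y A Z B T E Y' A' Z' B' T' E' : Type*}
    [TopologicalSpace Y] [TopologicalSpace A] [TopologicalSpace Z] [TopologicalSpace B]
    [TopologicalSpace T] [TopologicalSpace E]
    {FA : FellData Y A} {u : Y} {FB : FellData Z B} {v : Z} {FE : BundleData T E} {t : T}
    {la : A → E → E} {ra : E → B → E} {li : E → E → A} {ri : E → E → B}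
    {FA' : FellData Y' A'} {u' : Y'} {FB' : FellData Z' B'} {v' : Z'} {FE' : BundleData T' E'}
    {t' : T'} {la' : A' → E' → E'} {ra' : E' → B' → E'} {li' : E' → E' → A'} {ri' : E' → E' → B'}
    (h : IsImprimitivityBimodule FA u FB v FE t la ra li ri)
    (bA : IsBanachBundle FA.toBundleData) (bB : IsBanachBundle FB.toBundleData)
    (bE : IsBanachBundle FE) {φ : A → A'} {ψ : B → B'} {χ : E → E'}
    (hφ : IsFibreStarIso FA u FA' u' φ) (hψ : IsFibreStarIso FB v FB' v' ψ)
    (hχ : IsFibreIso FE t FE' t' χ)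
    (hla : ∀ a e, FA.p a = u → FE.p e = t → la' (φ a) (χ e) = χ (la a e))
    (hra : ∀ e b, FE.p e = t → FB.p b = v → ra' (χ e) (ψ b) = χ (ra e b))
    (hli : ∀ e f, FE.p e = t → FE.p f = t → li' (χ e) (χ f) = φ (li e f))
    (hri : ∀ e f, FE.p e = t → FE.p f = t → ri' (χ e) (χ f) = ψ (ri e f)) :
    IsImprimitivityBimodule FA' u' FB' v' FE' t' la' ra' li' ri' := by
  have aA : ∀ {a b}, FA.p a = u → FA.p b = u → FA.p (FA.add a b) = u := fun ha hb =>
    (bA.p_add _ _ (ha.trans hb.symm)).trans ha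
  have aB : ∀ {a b}, FB.p a = v → FB.p b = v → FB.p (FB.add a b) = v := fun ha hb =>
    (bB.p_add _ _ (ha.trans hb.symm)).trans ha
  have aE : ∀ {a b}, FE.p a = t → FE.p b = t → FE.p (FE.add a b) = t := fun ha hb =>
    (bE.p_add _ _ (ha.trans hb.symm)).trans ha
  have sA : ∀ {a} c, FA.p a = u → FA.p (FA.smul c a) = u := fun c ha => (bA.p_smul _ _).trans ha
  have sB : ∀ {a} c, FB.p a = v → FB.p (FB.smul c a) = v := fun c ha => (bB.p_smul _ _).trans ha
  have sE : ∀ {a} c, FE.p a = t → FE.p (FE.smul c a) = t := fun c ha => (bE.p_smul _ _).trans ha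
  constructor
  case p_la =>
    intro a e ha₀ he₀
    obtain ⟨a, ha, rfl⟩ := hφ.surj a ha₀
    obtain ⟨e, he, rfl⟩ := hχ.surj e he₀
    rw [hla _ _ ha he]
    exact hχ.map_p _ (h.p_la _ _ ha he)
  case add_la =>
    intro a a' e ha₀ ha'₀ he₀
    obtain ⟨a, ha, rfl⟩ := hφ.surj a ha₀
    obtain ⟨a', ha', rfl⟩ := hφ.surj a' ha'₀
    obtain ⟨e, he, rfl⟩ := hχ.surj e he₀
    rw [← hφ.map_add _ _ ha ha', hla _ _ ha he, hla _ _ ha' he, hla _ _ (aA ha ha') he,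
      h.add_la _ _ _ ha ha' he, hχ.map_add _ _ (h.p_la _ _ ha he) (h.p_la _ _ ha' he)]
  case la_add =>
    intro a e e' ha₀ he₀ he'₀
    obtain ⟨a, ha, rfl⟩ := hφ.surj a ha₀
    obtain ⟨e, he, rfl⟩ := hχ.surj e he₀
    obtain ⟨e', he', rfl⟩ := hχ.surj e' he'₀
    rw [← hχ.map_add _ _ he he', hla _ _ ha he, hla _ _ ha he', hla _ _ ha (aE he he'),
      h.la_add _ _ _ ha he he', hχ.map_add _ _ (h.p_la _ _ ha he) (h.p_la _ _ ha he')]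
  case smul_la =>
    intro c a e ha₀ he₀
    obtain ⟨a, ha, rfl⟩ := hφ.surj a ha₀
    obtain ⟨e, he, rfl⟩ := hχ.surj e he₀
    rw [← hφ.map_smul _ _ ha, hla _ _ (sA c ha) he, hla _ _ ha he, h.smul_la _ _ _ ha he,
      hχ.map_smul _ _ (h.p_la _ _ ha he)]
  case la_smul =>
    intro c a e ha₀ he₀
    obtain ⟨a, ha, rfl⟩ := hφ.surj a ha₀
    obtain ⟨e, he, rfl⟩ := hχ.surj e he₀
    rw [← hχ.map_smul _ _ he, hla _ _ ha (sE c he), hla _ _ ha he, h.la_smul _ _ _ ha he,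
      hχ.map_smul _ _ (h.p_la _ _ ha he)]
  case mul_la =>
    intro a a' e ha₀ ha'₀ he₀
    obtain ⟨a, ha, rfl⟩ := hφ.surj a ha₀
    obtain ⟨a', ha', rfl⟩ := hφ.surj a' ha'₀
    obtain ⟨e, he, rfl⟩ := hχ.surj e he₀
    rw [← hφ.map_mul _ _ ha ha', hla _ _ ha' he, hla _ _ ha (h.p_la _ _ ha' he),
      hla _ _ (hφ.p_mul _ _ ha ha') he, h.mul_la _ _ _ ha ha' he]
  case p_ra =>
    intro e b he₀ hb₀
    obtain ⟨b, hb, rfl⟩ := hψ.surj b hb₀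
    obtain ⟨e, he, rfl⟩ := hχ.surj e he₀
    rw [hra _ _ he hb]
    exact hχ.map_p _ (h.p_ra _ _ he hb)
  case add_ra =>
    intro e e' b he₀ he'₀ hb₀
    obtain ⟨b, hb, rfl⟩ := hψ.surj b hb₀
    obtain ⟨e, he, rfl⟩ := hχ.surj e he₀
    obtain ⟨e', he', rfl⟩ := hχ.surj e' he'₀
    rw [← hχ.map_add _ _ he he', hra _ _ he hb, hra _ _ he' hb, hra _ _ (aE he he') hb,
      h.add_ra _ _ _ he he' hb, hχ.map_add _ _ (h.p_ra _ _ he hb) (h.p_ra _ _ he' hb)]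
  case ra_add =>
    intro e b b' he₀ hb₀ hb'₀
    obtain ⟨b, hb, rfl⟩ := hψ.surj b hb₀
    obtain ⟨b', hb', rfl⟩ := hψ.surj b' hb'₀
    obtain ⟨e, he, rfl⟩ := hχ.surj e he₀
    rw [← hψ.map_add _ _ hb hb', hra _ _ he hb, hra _ _ he hb', hra _ _ he (aB hb hb'),
      h.ra_add _ _ _ he hb hb', hχ.map_add _ _ (h.p_ra _ _ he hb) (h.p_ra _ _ he hb')]
  case smul_ra =>
    intro c e b he₀ hb₀
    obtain ⟨b, hb, rfl⟩ := hψ.surj b hb₀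
    obtain ⟨e, he, rfl⟩ := hχ.surj e he₀
    rw [← hχ.map_smul _ _ he, hra _ _ (sE c he) hb, hra _ _ he hb, h.smul_ra _ _ _ he hb,
      hχ.map_smul _ _ (h.p_ra _ _ he hb)]
  case ra_smul =>
    intro c e b he₀ hb₀
    obtain ⟨b, hb, rfl⟩ := hψ.surj b hb₀
    obtain ⟨e, he, rfl⟩ := hχ.surj e he₀
    rw [← hψ.map_smul _ _ hb, hra _ _ he (sB c hb), hra _ _ he hb, h.ra_smul _ _ _ he hb,
      hχ.map_smul _ _ (h.p_ra _ _ he hb)]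
  case ra_mul =>
    intro e b b' he₀ hb₀ hb'₀
    obtain ⟨b, hb, rfl⟩ := hψ.surj b hb₀
    obtain ⟨b', hb', rfl⟩ := hψ.surj b' hb'₀
    obtain ⟨e, he, rfl⟩ := hχ.surj e he₀
    rw [← hψ.map_mul _ _ hb hb', hra _ _ he hb, hra _ _ (h.p_ra _ _ he hb) hb',
      hra _ _ he (hψ.p_mul _ _ hb hb'), h.ra_mul _ _ _ he hb hb']
  case la_ra =>
    intro a e b ha₀ he₀ hb₀
    obtain ⟨a, ha, rfl⟩ := hφ.surj a ha₀
    obtain ⟨b, hb, rfl⟩ := hψ.surj b hb₀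
    obtain ⟨e, he, rfl⟩ := hχ.surj e he₀
    rw [hra _ _ he hb, hla _ _ ha he, hla _ _ ha (h.p_ra _ _ he hb),
      hra _ _ (h.p_la _ _ ha he) hb, h.la_ra _ _ _ ha he hb]
  case p_li =>
    intro e f he₀ hf₀
    obtain ⟨e, he, rfl⟩ := hχ.surj e he₀
    obtain ⟨f, hf, rfl⟩ := hχ.surj f hf₀
    rw [hli _ _ he hf]
    exact hφ.map_p _ (h.p_li _ _ he hf)
  case add_li =>
    intro e e' f he₀ he'₀ hf₀
    obtain ⟨e, he, rfl⟩ := hχ.surj e he₀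
    obtain ⟨e', he', rfl⟩ := hχ.surj e' he'₀
    obtain ⟨f, hf, rfl⟩ := hχ.surj f hf₀
    rw [← hχ.map_add _ _ he he', hli _ _ (aE he he') hf, hli _ _ he hf, hli _ _ he' hf,
      h.add_li _ _ _ he he' hf, hφ.map_add _ _ (h.p_li _ _ he hf) (h.p_li _ _ he' hf)]
  case smul_li =>
    intro c e f he₀ hf₀
    obtain ⟨e, he, rfl⟩ := hχ.surj e he₀
    obtain ⟨f, hf, rfl⟩ := hχ.surj f hf₀
    rw [← hχ.map_smul _ _ he, hli _ _ (sE c he) hf, hli _ _ he hf, h.smul_li _ _ _ he hf,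
      hφ.map_smul _ _ (h.p_li _ _ he hf)]
  case la_li =>
    intro a e f ha₀ he₀ hf₀
    obtain ⟨a, ha, rfl⟩ := hφ.surj a ha₀
    obtain ⟨e, he, rfl⟩ := hχ.surj e he₀
    obtain ⟨f, hf, rfl⟩ := hχ.surj f hf₀
    rw [hla _ _ ha he, hli _ _ (h.p_la _ _ ha he) hf, hli _ _ he hf, h.la_li _ _ _ ha he hf,
      hφ.map_mul _ _ ha (h.p_li _ _ he hf)]
  case star_li =>
    intro e f he₀ hf₀
    obtain ⟨e, he, rfl⟩ := hχ.surj e he₀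
    obtain ⟨f, hf, rfl⟩ := hχ.surj f hf₀
    rw [hli _ _ he hf, hli _ _ hf he, ← hφ.map_star _ (h.p_li _ _ he hf), h.star_li _ _ he hf]
  case li_self_nonneg =>
    intro e he₀
    obtain ⟨e, he, rfl⟩ := hχ.surj e he₀
    obtain ⟨c, hc, hec⟩ := h.li_self_nonneg e he
    exact ⟨φ c, hφ.map_p _ hc, by
      rw [hli _ _ he he, hec, hφ.map_mul _ _ (hφ.p_star _ hc) hc, hφ.map_star _ hc]⟩
  case norm_li_self =>
    intro e he₀
    obtain ⟨e, he, rfl⟩ := hχ.surj e he₀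
    rw [hli _ _ he he, hφ.map_norm _ (h.p_li _ _ he he), hχ.map_norm _ he, h.norm_li_self _ he]
  case li_full =>
    intro a ha₀ ε hε
    obtain ⟨a, ha, rfl⟩ := hφ.surj a ha₀
    obtain ⟨l, hl, hla⟩ := h.li_full a ha ε hε
    -- The image of an approximating list works with the same `ε`, because `φ` is additive and
    -- isometric on the fibre.
    refine ⟨l.map (Prod.map χ χ), ?_, ?_⟩
    · simp only [List.mem_map, forall_exists_index, and_imp, forall_apply_eq_imp_iff₂]
      exact fun q hq => ⟨hχ.map_p _ (hl q hq).1, hχ.map_p _ (hl q hq).2⟩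
    · have h1 : (l.map (Prod.map χ χ)).map (fun q => li' q.1 q.2)
          = (l.map fun q => li q.1 q.2).map φ := by
        rw [List.map_map, List.map_map]
        exact List.map_congr_left fun q hq => hli _ _ (hl q hq).1 (hl q hq).2
      have h2 : ∀ b ∈ l.map (fun q => li q.1 q.2), FA.p b = u := by
        simp only [List.mem_map, forall_exists_index, and_imp, forall_apply_eq_imp_iff₂]
        exact fun q hq => h.p_li _ _ (hl q hq).1 (hl q hq).2
      have h3 := IsFibreIso.p_listSum bA _ h2
      rw [h1, ← hφ.map_listSum bA _ h2, ← hφ.map_sub bA ha h3, hφ.map_norm]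
      · exact hla
      · exact (bA.p_sub (ha.trans h3.symm)).trans ha
  case p_ri =>
    intro e f he₀ hf₀
    obtain ⟨e, he, rfl⟩ := hχ.surj e he₀
    obtain ⟨f, hf, rfl⟩ := hχ.surj f hf₀
    rw [hri _ _ he hf]
    exact hψ.map_p _ (h.p_ri _ _ he hf)
  case ri_add =>
    intro e f f' he₀ hf₀ hf'₀
    obtain ⟨e, he, rfl⟩ := hχ.surj e he₀
    obtain ⟨f, hf, rfl⟩ := hχ.surj f hf₀
    obtain ⟨f', hf', rfl⟩ := hχ.surj f' hf'₀
    rw [← hχ.map_add _ _ hf hf', hri _ _ he (aE hf hf'), hri _ _ he hf, hri _ _ he hf',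
      h.ri_add _ _ _ he hf hf', hψ.map_add _ _ (h.p_ri _ _ he hf) (h.p_ri _ _ he hf')]
  case ri_smul =>
    intro c e f he₀ hf₀
    obtain ⟨e, he, rfl⟩ := hχ.surj e he₀
    obtain ⟨f, hf, rfl⟩ := hχ.surj f hf₀
    rw [← hχ.map_smul _ _ hf, hri _ _ he (sE c hf), hri _ _ he hf, h.ri_smul _ _ _ he hf,
      hψ.map_smul _ _ (h.p_ri _ _ he hf)]
  case ri_ra =>
    intro e f b he₀ hf₀ hb₀
    obtain ⟨b, hb, rfl⟩ := hψ.surj b hb₀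
    obtain ⟨e, he, rfl⟩ := hχ.surj e he₀
    obtain ⟨f, hf, rfl⟩ := hχ.surj f hf₀
    rw [hra _ _ hf hb, hri _ _ he (h.p_ra _ _ hf hb), hri _ _ he hf, h.ri_ra _ _ _ he hf hb,
      hψ.map_mul _ _ (h.p_ri _ _ he hf) hb]
  case star_ri =>
    intro e f he₀ hf₀
    obtain ⟨e, he, rfl⟩ := hχ.surj e he₀
    obtain ⟨f, hf, rfl⟩ := hχ.surj f hf₀
    rw [hri _ _ he hf, hri _ _ hf he, ← hψ.map_star _ (h.p_ri _ _ he hf), h.star_ri _ _ he hf]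
  case ri_self_nonneg =>
    intro e he₀
    obtain ⟨e, he, rfl⟩ := hχ.surj e he₀
    obtain ⟨c, hc, hec⟩ := h.ri_self_nonneg e he
    exact ⟨ψ c, hψ.map_p _ hc, by
      rw [hri _ _ he he, hec, hψ.map_mul _ _ (hψ.p_star _ hc) hc, hψ.map_star _ hc]⟩
  case norm_ri_self =>
    intro e he₀
    obtain ⟨e, he, rfl⟩ := hχ.surj e he₀
    rw [hri _ _ he he, hψ.map_norm _ (h.p_ri _ _ he he), hχ.map_norm _ he, h.norm_ri_self _ he]
  case ri_full =>
    intro b hb₀ ε hε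
    obtain ⟨b, hb, rfl⟩ := hψ.surj b hb₀
    obtain ⟨l, hl, hlb⟩ := h.ri_full b hb ε hε
    refine ⟨l.map (Prod.map χ χ), ?_, ?_⟩
    · simp only [List.mem_map, forall_exists_index, and_imp, forall_apply_eq_imp_iff₂]
      exact fun q hq => ⟨hχ.map_p _ (hl q hq).1, hχ.map_p _ (hl q hq).2⟩
    · have h1 : (l.map (Prod.map χ χ)).map (fun q => ri' q.1 q.2)
          = (l.map fun q => ri q.1 q.2).map ψ := by
        rw [List.map_map, List.map_map]
        exact List.map_congr_left fun q hq => hri _ _ (hl q hq).1 (hl q hq).2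
      have h2 : ∀ b ∈ l.map (fun q => ri q.1 q.2), FB.p b = v := by
        simp only [List.mem_map, forall_exists_index, and_imp, forall_apply_eq_imp_iff₂]
        exact fun q hq => h.p_ri _ _ (hl q hq).1 (hl q hq).2
      have h3 := IsFibreIso.p_listSum bB _ h2
      rw [h1, ← hψ.map_listSum bB _ h2, ← hψ.map_sub bB hb h3, hψ.map_norm]
      · exact hlb
      · exact (bB.p_sub (hb.trans h3.symm)).trans hb
  case ri_la =>
    intro a e f ha₀ he₀ hf₀
    obtain ⟨a, ha, rfl⟩ := hφ.surj a ha₀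
    obtain ⟨e, he, rfl⟩ := hχ.surj e he₀
    obtain ⟨f, hf, rfl⟩ := hχ.surj f hf₀
    rw [← hφ.map_star _ ha, hla _ _ ha he, hla _ _ (hφ.p_star _ ha) hf,
      hri _ _ (h.p_la _ _ ha he) hf, hri _ _ he (h.p_la _ _ (hφ.p_star _ ha) hf),
      h.ri_la _ _ _ ha he hf]
  case li_ra =>
    intro e f b he₀ hf₀ hb₀
    obtain ⟨b, hb, rfl⟩ := hψ.surj b hb₀
    obtain ⟨e, he, rfl⟩ := hχ.surj e he₀
    obtain ⟨f, hf, rfl⟩ := hχ.surj f hf₀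
    rw [← hψ.map_star _ hb, hra _ _ he hb, hra _ _ hf (hψ.p_star _ hb),
      hli _ _ (h.p_ra _ _ he hb) hf, hli _ _ he (h.p_ra _ _ hf (hψ.p_star _ hb)),
      h.li_ra _ _ _ he hf hb]
  case li_la_eq_ra_ri =>
    intro e f g he₀ hf₀ hg₀
    obtain ⟨e, he, rfl⟩ := hχ.surj e he₀
    obtain ⟨f, hf, rfl⟩ := hχ.surj f hf₀
    obtain ⟨g, hg, rfl⟩ := hχ.surj g hg₀
    rw [hli _ _ he hf, hri _ _ hf hg, hla _ _ (h.p_li _ _ he hf) hg,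
      hra _ _ he (h.p_ri _ _ hf hg), h.li_la_eq_ra_ri _ _ _ he hf hg]

end Transport

/-! ### Sections of Banach bundles -/

section Sections

variable {X E : Type*} [TopologicalSpace X] [TopologicalSpace E] {B : BundleData X E}

namespace IsBanachBundle

variable (h : IsBanachBundle B)
include h

theorem zero_add {a : E} {x : X} (ha : B.p a = x) : B.add (B.zero x) a = a := by
  subst ha
  rw [h.add_comm _ _ (h.p_zero _), h.add_zero]

theorem norm_zero (x : X) : B.norm (B.zero x) = 0 := by
  rw [h.norm_eq_zero, h.p_zero]

theorem norm_neg (a : E) : B.norm (B.smul (-1) a) = B.norm a := by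
  rw [h.norm_smul]; simp

theorem norm_sub_le {a b : E} (hab : B.p a = B.p b) :
    B.norm (B.sub a b) ≤ B.norm a + B.norm b :=
  (h.norm_add_le _ _ (hab.trans (h.p_smul _ _).symm)).trans_eq (by rw [h.norm_neg])

theorem norm_sub_comm {a b : E} (hab : B.p a = B.p b) :
    B.norm (B.sub a b) = B.norm (B.sub b a) := by
  have hb : B.p a = B.p (B.smul (-1) b) := hab.trans (h.p_smul _ _).symm
  rw [← h.norm_neg (B.sub a b), BundleData.sub, h.smul_add _ _ _ hb, ← h.mul_smul]
  simp only [mul_neg, mul_one, neg_neg, h.one_smul]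
  rw [h.add_comm _ _ ((h.p_smul _ _).trans hab)]
  rfl

theorem norm_sub_le_norm_sub_add_norm_sub {a b c : E} (hab : B.p a = B.p b)
    (hbc : B.p b = B.p c) :
    B.norm (B.sub a c) ≤ B.norm (B.sub a b) + B.norm (B.sub b c) := by
  have hc : B.p b = B.p (B.smul (-1) c) := hbc.trans (h.p_smul _ _).symm
  have hb : B.p a = B.p (B.smul (-1) b) := hab.trans (h.p_smul _ _).symm
  have hb' : B.p (B.smul (-1) b) = B.p b := h.p_smul _ _
  have key : B.sub a c = B.add (B.sub a b) (B.sub b c) := by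
    rw [BundleData.sub, BundleData.sub, BundleData.sub,
      h.add_assoc _ _ _ hb (hb'.trans (h.p_add _ _ hc).symm),
      ← h.add_assoc _ _ _ hb' hc, h.add_comm _ _ hb']
    have := h.sub_self b
    rw [BundleData.sub] at this
    rw [this, h.zero_add hc.symm]
  rw [key]
  exact h.norm_add_le _ _ (by rw [h.p_sub hab, h.p_sub hbc, hab])

theorem sub_smul_smul (c : ℂ) {a b : E} (hab : B.p a = B.p b) :
    B.sub (B.smul c a) (B.smul c b) = B.smul c (B.sub a b) := by
  rw [BundleData.sub, BundleData.sub, h.smul_add _ _ _ (hab.trans (h.p_smul _ _).symm),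
    ← h.mul_smul, ← h.mul_smul, mul_comm]

theorem continuousOn_sub :
    ContinuousOn (fun q : E × E => B.sub q.1 q.2) {q | B.p q.1 = B.p q.2} := by
  have hs := h.continuous_smul (-1)
  exact h.continuousOn_add.comp (f := fun q : E × E => (q.1, B.smul (-1) q.2)) (by fun_prop)
    fun q hq => Eq.trans hq (h.p_smul _ _).symm

theorem isOpen_norm_lt (ε : ℝ) : IsOpen {a | B.norm a < ε} :=
  isOpen_iff_mem_nhds.2 fun a ha => h.upperSemicontinuous_norm a ε ha

/-- The filter axiom `tendsto_zero` in the form of basic neighbourhoods: a neighbourhood of a zero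
contains all elements of small norm over some neighbourhood of the base point. -/
theorem exists_nhds_zero {x : X} {U : Set E} (hU : U ∈ 𝓝 (B.zero x)) :
    ∃ V ∈ 𝓝 x, ∃ ε > 0, ∀ a, B.p a ∈ V → B.norm a < ε → a ∈ U := by
  -- This is the largest filter to which the axiom applies.
  have hl := h.tendsto_zero x (comap B.p (𝓝 x) ⊓ comap B.norm (𝓝 0))
    (tendsto_comap.mono_left inf_le_left) (tendsto_comap.mono_left inf_le_right) hU
  obtain ⟨s, ⟨V, hV, hVs⟩, t, ⟨W, hW, hWt⟩, hst⟩ := mem_inf_iff_superset.1 hl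
  obtain ⟨ε, hε, hεW⟩ := Metric.mem_nhds_iff.1 hW
  refine ⟨V, hV, ε, hε, fun a ha hna => hst ⟨hVs ha, hWt (hεW ?_)⟩⟩
  rwa [Metric.mem_ball, Real.dist_eq, sub_zero, abs_of_nonneg (h.norm_nonneg a)]

/-- Scalar multiplication is jointly continuous. -/
theorem continuous_smul_uncurry : Continuous fun q : ℂ × E => B.smul q.1 q.2 := by
  rw [continuous_iff_continuousAt]
  rintro ⟨c, a⟩
  -- The first summand has a fixed scalar and is continuous by axiom. The second has norm tending to
  -- `0`, so it tends to the zero over `B.p a`.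
  have hsplit : (fun q : ℂ × E => B.smul q.1 q.2)
      = fun q => B.add (B.smul c q.2) (B.smul (q.1 - c) q.2) := by
    funext q
    rw [← h.add_smul]
    simp
  have hz : Tendsto (fun q : ℂ × E => B.smul (q.1 - c) q.2) (𝓝 (c, a)) (𝓝 (B.zero (B.p a))) := by
    refine h.tendsto_zero _ _ ?_ ?_
    · rw [tendsto_map'_iff]
      have : B.p ∘ (fun q : ℂ × E => B.smul (q.1 - c) q.2) = B.p ∘ Prod.snd :=
        funext fun q => h.p_smul _ _
      rw [this]
      exact (h.continuous_p.comp continuous_snd).tendsto (c, a)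
    · rw [tendsto_map'_iff]
      -- Upper semicontinuity is enough here, since only a local upper bound on the norm is
      -- required.
      have hb : ∀ᶠ q : ℂ × E in 𝓝 (c, a), B.norm q.2 < B.norm a + 1 :=
        continuous_snd.tendsto (c, a) (h.upperSemicontinuous_norm a _ (lt_add_one _))
      have h0 : Tendsto (fun q : ℂ × E => ‖q.1 - c‖ * (B.norm a + 1)) (𝓝 (c, a)) (𝓝 0) := by
        have : Continuous fun q : ℂ × E => ‖q.1 - c‖ * (B.norm a + 1) := by fun_prop
        simpa using this.tendsto (c, a)
      refine tendsto_of_tendsto_of_tendsto_of_le_of_le' tendsto_const_nhds h0 ?_ ?_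
      · exact Eventually.of_forall fun q => h.norm_nonneg _
      · filter_upwards [hb] with q hq
        simp only [Function.comp, h.norm_smul]
        gcongr
  have hpair : Tendsto (fun q : ℂ × E => (B.smul c q.2, B.smul (q.1 - c) q.2)) (𝓝 (c, a))
      (𝓝[{q | B.p q.1 = B.p q.2}] (B.smul c a, B.zero (B.p a))) := by
    refine tendsto_nhdsWithin_iff.2 ⟨?_, Eventually.of_forall fun q => ?_⟩
    · exact (((h.continuous_smul c).comp continuous_snd).tendsto (c, a)).prodMk_nhds hz
    · exact (h.p_smul _ _).trans (h.p_smul _ _).symm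
  have hadd := h.continuousOn_add (B.smul c a, B.zero (B.p a))
    ((h.p_smul _ _).trans (h.p_zero _).symm)
  have hval : B.add (B.smul c a) (B.zero (B.p a)) = B.smul c a := by
    conv_lhs => rw [← h.p_smul c a, h.add_zero]
  rw [ContinuousAt, hsplit]
  have := hadd.tendsto.comp hpair
  simpa only [Function.comp_def, sub_self, hval, ← h.add_smul, add_zero] using this

end IsBanachBundle

/-- The sections vanishing at infinity. -/
def VanishingSection (B : BundleData X E) : Type _ := B.sectionsVanishing

namespace VanishingSection

/-- The supremum distance of sections. -/
@[reducible] def pseudoEMetricSpace (h : IsBanachBundle B) :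
    PseudoEMetricSpace (VanishingSection B) where
  -- With extended values the supremum needs no proof of boundedness.
  edist f g := ⨆ x, ENNReal.ofReal (B.norm (B.sub (f.1 x) (g.1 x)))
  edist_self f := by simp [h.sub_self, h.norm_zero]
  edist_comm f g := by
    refine iSup_congr fun x => ?_
    rw [h.norm_sub_comm ((f.2.2.1 x).trans (g.2.2.1 x).symm)]
  edist_triangle f g k := by
    refine iSup_le fun x => ?_
    refine (ENNReal.ofReal_le_ofReal (h.norm_sub_le_norm_sub_add_norm_sub
      ((f.2.2.1 x).trans (g.2.2.1 x).symm) ((g.2.2.1 x).trans (k.2.2.1 x).symm))).trans ?_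
    rw [ENNReal.ofReal_add (h.norm_nonneg _) (h.norm_nonneg _)]
    exact add_le_add (le_iSup (fun x => ENNReal.ofReal (B.norm (B.sub (f.1 x) (g.1 x)))) x)
      (le_iSup (fun x => ENNReal.ofReal (B.norm (B.sub (g.1 x) (k.1 x)))) x)

theorem edist_le (h : IsBanachBundle B) {f g : VanishingSection B} {ε : ℝ}
    (hε : ∀ x, B.norm (B.sub (f.1 x) (g.1 x)) ≤ ε) :
    (pseudoEMetricSpace h).edist f g ≤ ENNReal.ofReal ε :=
  iSup_le fun x => ENNReal.ofReal_le_ofReal (hε x)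

theorem norm_sub_lt (h : IsBanachBundle B) {f g : VanishingSection B} {ε : ℝ}
    (hfg : (pseudoEMetricSpace h).edist f g < ENNReal.ofReal ε) (x : X) :
    B.norm (B.sub (f.1 x) (g.1 x)) < ε :=
  (ENNReal.ofReal_lt_ofReal_iff_of_nonneg (h.norm_nonneg _)).1 <|
    (le_iSup (fun x => ENNReal.ofReal (B.norm (B.sub (f.1 x) (g.1 x)))) x).trans_lt hfg

/-- Second countability, unlike separability, passes to subsets and to induced topologies; this is
the form of the separability axiom that is used below. -/
theorem secondCountableTopology (h : IsBanachBundle B) :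
    @SecondCountableTopology (VanishingSection B)
      (pseudoEMetricSpace h).toUniformSpace.toTopologicalSpace := by
  let _ := pseudoEMetricSpace h
  have : TopologicalSpace.SeparableSpace (VanishingSection B) := by
    obtain ⟨S, hSc, hS, hd⟩ := h.separable
    refine ⟨⟨Subtype.val ⁻¹' S, hSc.preimage Subtype.val_injective, fun f => ?_⟩⟩
    rw [EMetric.mem_closure_iff]
    intro ε hε
    obtain ⟨δ, hδ0, hδ⟩ := ENNReal.lt_iff_exists_nnreal_btwn.1 hε
    obtain ⟨g, hg, hfg⟩ := hd f.1 f.2 δ (by exact_mod_cast hδ0)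
    refine ⟨⟨g, hS hg⟩, hg, lt_of_le_of_lt (edist_le h fun x => (hfg x).le) ?_⟩
    simpa using hδ
  exact UniformSpace.secondCountable_of_separable _

end VanishingSection

/-- Multiplication of a section by a compactly supported function. -/
theorem smul_mem_sectionsVanishing (h : IsBanachBundle B) {φ : X → ℝ} (hφ : Continuous φ)
    (hc : HasCompactSupport φ) {f : X → E} (hf : Continuous f) (hp : ∀ x, B.p (f x) = x) :
    (fun x => B.smul (φ x) (f x)) ∈ B.sectionsVanishing := by
  have hcont : Continuous fun x => B.smul (φ x) (f x) :=
    h.continuous_smul_uncurry.comp ((Complex.continuous_ofReal.comp hφ).prodMk hf)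
  refine ⟨hcont, fun x => (h.p_smul _ _).trans (hp x), fun ε hε => ?_⟩
  refine hc.isCompact.of_isClosed_subset ?_ ?_
  · have : {x | ε ≤ B.norm (B.smul (φ x) (f x))}
        = ((fun x => B.smul (φ x) (f x)) ⁻¹' {a | B.norm a < ε})ᶜ := by
      ext x; simp
    rw [this]
    exact ((h.isOpen_norm_lt ε).preimage hcont).isClosed_compl
  · intro x hx
    by_contra hx'
    have : φ x = 0 := image_eq_zero_of_notMem_tsupport hx'
    rw [mem_ofPred_eq, h.norm_smul, this] at hx
    simp at hx
    linarith

/-- A criterion for the separability of the space of sections vanishing at infinity: it suffices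
to control sections on the members of a sequence of sets that absorbs all compact sets. -/
theorem exists_countable_dense_sections
    (hsub : ∀ a b, B.p a = B.p b → B.norm (B.sub a b) ≤ B.norm a + B.norm b)
    {M : ℕ → Type*} [∀ n, TopologicalSpace (M n)] [∀ n, SecondCountableTopology (M n)]
    (L : ℕ → Set X) (hL : ∀ Q : Set X, IsCompact Q → ∃ n, Q ⊆ L n)
    (Φ : ∀ n, B.sectionsVanishing → M n)
    (hΦ : ∀ n f (ε : ℝ), 0 < ε → ∃ U ∈ 𝓝 (Φ n f), ∀ g, Φ n g ∈ U →
      ∀ x ∈ L n, B.norm (B.sub (f.1 x) (g.1 x)) < ε) :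
    ∃ S : Set (X → E), S.Countable ∧ S ⊆ B.sectionsVanishing ∧
      ∀ f ∈ B.sectionsVanishing, ∀ ε : ℝ, 0 < ε →
        ∃ g ∈ S, ∀ x, B.norm (B.sub (f x) (g x)) < ε := by
  have key : ∀ n k : ℕ, ∃ T : Set B.sectionsVanishing, T.Countable ∧
      ∀ f : B.sectionsVanishing, (∀ x ∉ L n, B.norm (f.1 x) < 1 / (k + 1)) →
        ∀ ε : ℝ, 0 < ε → ∃ g ∈ T, (∀ x ∉ L n, B.norm (g.1 x) < 1 / (k + 1)) ∧
          ∀ x ∈ L n, B.norm (B.sub (f.1 x) (g.1 x)) < ε := by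
    intro n k
    -- The sections that are small off `L n`. Density is required inside this class, so that the
    -- approximants are small off `L n` too; `Φ n` sees them only on `L n`.
    let C : Set B.sectionsVanishing := {f | ∀ x ∉ L n, B.norm (f.1 x) < 1 / (k + 1)}
    -- The topology is pulled back from `M n`, so it is second countable although `Φ n` need not be
    -- injective.
    let _ : TopologicalSpace C := TopologicalSpace.induced (fun f => Φ n f.1) inferInstance
    have : SecondCountableTopology C := TopologicalSpace.secondCountableTopology_induced _ _ _
    obtain ⟨T, hTc, hTd⟩ := TopologicalSpace.exists_countable_dense C
    refine ⟨Subtype.val '' T, hTc.image _, fun f hf ε hε => ?_⟩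
    obtain ⟨U, hU, hUε⟩ := hΦ n f ε hε
    have hnhds : (fun g : C => Φ n g.1) ⁻¹' U ∈ 𝓝 (⟨f, hf⟩ : C) := by
      rw [nhds_induced]
      exact preimage_mem_comap hU
    obtain ⟨g, hgU, hgT⟩ := mem_closure_iff_nhds.1 (hTd ⟨f, hf⟩) _ hnhds
    exact ⟨g.1, ⟨g, hgT, rfl⟩, g.2, hUε g.1 hgU⟩
  choose T hTc hT using key
  refine ⟨⋃ n, ⋃ k, Subtype.val '' T n k,
    countable_iUnion fun n => countable_iUnion fun k => (hTc n k).image _, ?_, ?_⟩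
  · simp only [iUnion_subset_iff]
    rintro n k _ ⟨g, -, rfl⟩
    exact g.2
  · intro f hf ε hε
    -- Off `L n` both sections have norm below `1 / (k + 1) < ε / 2`, so the triangle inequality
    -- suffices there.
    obtain ⟨k, hk⟩ := exists_nat_one_div_lt (half_pos hε)
    obtain ⟨n, hn⟩ := hL _ (hf.2.2 (1 / (k + 1)) (by positivity))
    have hf' : ∀ x ∉ L n, B.norm (f x) < 1 / (k + 1) := fun x hx =>
      not_le.1 fun hle => hx (hn hle)
    obtain ⟨g, hgT, hg, hfg⟩ := hT n k ⟨f, hf⟩ hf' ε hε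
    refine ⟨g.1, mem_iUnion₂.2 ⟨n, k, g, hgT, rfl⟩, fun x => ?_⟩
    by_cases hx : x ∈ L n
    · exact hfg x hx
    · have := hsub (f x) (g.1 x) ((hf.2.1 x).trans (g.2.2.1 x).symm)
      linarith [hf' x hx, hg x hx]

end Sections

/-! ### Orbit Fell bundles -/

section OrbitBundle

variable {X A : Type*} [TopologicalSpace X] [TopologicalSpace A] {𝒢 : GroupoidData X}
  {F : FellData X A}

theorem IsLCGroupoid.inv_of_mem (h : IsLCGroupoid 𝒢) {u : X} (hu : u ∈ 𝒢.units) :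
    𝒢.inv u = u := by
  have h1 : 𝒢.s (𝒢.inv u) = u := by rw [h.s_inv, h.r_of_mem hu]
  have h2 := h.mul_s_self (𝒢.inv u)
  rw [h1, h.inv_mul, h.s_of_mem hu] at h2
  exact h2.symm

theorem IsLCGroupoid.mul_of_mem (h : IsLCGroupoid 𝒢) {u : X} (hu : u ∈ 𝒢.units) :
    𝒢.mul u u = u := by
  conv_lhs => rw [← h.r_of_mem hu, h.r_of_mem (h.r_of_mem hu ▸ hu)]
  have := h.r_mul_self u
  rwa [h.r_of_mem hu] at this

theorem IsFellBundle.p_mul_of_mem (hF : IsFellBundle 𝒢 F) (h : IsLCGroupoid 𝒢) {u : X}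
    (hu : u ∈ 𝒢.units) {a b : A} (ha : F.p a = u) (hb : F.p b = u) : F.p (F.mul a b) = u := by
  rw [hF.p_mul _ _ (by rw [ha, hb, h.s_of_mem hu, h.r_of_mem hu]), ha, hb, h.mul_of_mem hu]

theorem IsFellBundle.p_star_of_mem (hF : IsFellBundle 𝒢 F) (h : IsLCGroupoid 𝒢) {u : X}
    (hu : u ∈ 𝒢.units) {a : A} (ha : F.p a = u) : F.p (F.star a) = u := by
  rw [hF.p_star, ha, h.inv_of_mem hu]

/-! ### Operations and fibres of the orbit bundle -/

variable {K : Type*} [Group K] [TopologicalSpace K] [MulAction K X] [MulAction K A]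
  (hK : ActsByFellAut K 𝒢 F)

@[simp] theorem orbitFell_p_orb (a : A) : (orbitFell 𝒢 F hK).p (orb K a) = orb K (F.p a) := rfl

@[simp] theorem orbitFell_zero_orb (x : X) :
    (orbitFell 𝒢 F hK).zero (orb K x) = orb K (F.zero x) := rfl

@[simp] theorem orbitFell_smul_orb (c : ℂ) (a : A) :
    (orbitFell 𝒢 F hK).smul c (orb K a) = orb K (F.smul c a) := rfl

@[simp] theorem orbitFell_norm_orb (a : A) : (orbitFell 𝒢 F hK).norm (orb K a) = F.norm a := rfl

@[simp] theorem orbitFell_star_orb (a : A) :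
    (orbitFell 𝒢 F hK).star (orb K a) = orb K (F.star a) := rfl

theorem orbitFell_add_orb (hfp : IsFreeProper K X) {a b : A} (hab : F.p a = F.p b) :
    (orbitFell 𝒢 F hK).add (orb K a) (orb K b) = orb K (F.add a b) :=
  orbitOp_orb hfp hK.p_smul hK.p_smul hK.add_smul hab

theorem ActsByFellAut.s_p_smul (hK : ActsByFellAut K 𝒢 F) (k : K) (a : A) :
    𝒢.s (F.p (k • a)) = k • 𝒢.s (F.p a) := by
  rw [hK.p_smul, hK.base.s_smul]

theorem ActsByFellAut.r_p_smul (hK : ActsByFellAut K 𝒢 F) (k : K) (a : A) :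
    𝒢.r (F.p (k • a)) = k • 𝒢.r (F.p a) := by
  rw [hK.p_smul, hK.base.r_smul]

theorem orbitFell_mul_orb (hfp : IsFreeProper K X) {a b : A}
    (hab : 𝒢.s (F.p a) = 𝒢.r (F.p b)) :
    (orbitFell 𝒢 F hK).mul (orb K a) (orb K b) = orb K (F.mul a b) :=
  orbitOp_orb hfp hK.s_p_smul hK.r_p_smul hK.mul_smul hab

theorem exists_orb_p_eq {P : Orbits K A} {x : X} (h : (orbitFell 𝒢 F hK).p P = orb K x) :
    ∃ a, orb K a = P ∧ F.p a = x :=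
  exists_orb_eq (hf := hK.p_smul) h

theorem exists_orb_p_eq_p {P Q : Orbits K A}
    (h : (orbitFell 𝒢 F hK).p P = (orbitFell 𝒢 F hK).p Q) :
    ∃ a b, orb K a = P ∧ orb K b = Q ∧ F.p a = F.p b := by
  obtain ⟨b, rfl⟩ := orb_surjective Q
  obtain ⟨a, ha, hab⟩ := exists_orb_p_eq hK h
  exact ⟨a, b, ha, rfl, hab⟩

theorem orbitFell_sub_orb (hfp : IsFreeProper K X) (hF : IsBanachBundle F.toBundleData) {a b : A}
    (hab : F.p a = F.p b) :
    (orbitFell 𝒢 F hK).sub (orb K a) (orb K b) = orb K (F.sub a b) :=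
  orbitFell_add_orb hK hfp (hab.trans (hF.p_smul _ _).symm)

/-- The equivariant section of the bundle that corresponds to a section of the orbit bundle is
continuous. -/
theorem continuous_rep_section (hfp : IsFreeProper K X) (hF : IsBanachBundle F.toBundleData)
    {f : Orbits K X → Orbits K A} (hf : Continuous f)
    (hp : ∀ P, (orbitFell 𝒢 F hK).p (f P) = P) :
    Continuous fun x => rep F.p (f (orb K x)) x :=
  (continuousOn_rep hfp hK.continuous_smul hK.p_smul hF.continuous_p).comp_continuous
    ((hf.comp (isOpenQuotientMap_orb hK.base.continuous_smul).continuous).prodMk continuous_id)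
    fun x => hp (orb K x)

/-- A section of the orbit bundle lifts to an equivariant section of the bundle above. The lift need
not vanish at infinity, but its product with a cutoff function does, and where the cutoff is `1` the
distance of two lifts is the distance of the original sections. Thus sections are controlled on the
orbits that meet a compact set. -/
theorem orbitFell_separable [T2Space X] [LocallyCompactSpace X] [SecondCountableTopology X]
    (hfp : IsFreeProper K X) (hF : IsBanachBundle F.toBundleData) :
    ∃ S : Set (Orbits K X → Orbits K A), S.Countable ∧
      S ⊆ (orbitFell 𝒢 F hK).sectionsVanishing ∧
      ∀ f ∈ (orbitFell 𝒢 F hK).sectionsVanishing, ∀ ε : ℝ, 0 < ε →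
        ∃ g ∈ S, ∀ x, (orbitFell 𝒢 F hK).norm ((orbitFell 𝒢 F hK).sub (f x) (g x)) < ε := by
  have hπ := isOpenQuotientMap_orb hK.base.continuous_smul
  let C : CompactExhaustion X := default
  have hφ : ∀ n, ∃ φ : C(X, ℝ), EqOn φ 1 (C n) ∧ EqOn φ 0 (∅ : Set X) ∧ HasCompactSupport φ ∧
      ∀ x, φ x ∈ Icc (0 : ℝ) 1 := fun n =>
    exists_continuous_one_zero_of_isCompact (C.isCompact n) isClosed_empty (disjoint_empty _)
  choose φ hφ1 _ hφc _ using hφ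
  let _ := VanishingSection.pseudoEMetricSpace hF
  have := VanishingSection.secondCountableTopology hF
  let Φ : ℕ → (orbitFell 𝒢 F hK).sectionsVanishing → VanishingSection F.toBundleData := fun n f =>
    ⟨fun x => F.smul (φ n x) (rep F.p (f.1 (orb K x)) x),
      smul_mem_sectionsVanishing hF (φ n).continuous (hφc n)
        (continuous_rep_section hK hfp hF f.2.1 f.2.2.1)
        fun x => (rep_spec (hf := hK.p_smul) (f.2.2.1 (orb K x))).2⟩
  refine exists_countable_dense_sections (M := fun _ => VanishingSection F.toBundleData)
    ?_ (fun n => orb K '' C n) ?_ Φ ?_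
  · intro P Q hPQ
    obtain ⟨a, b, rfl, rfl, hab⟩ := exists_orb_p_eq_p hK hPQ
    rw [orbitFell_sub_orb hK hfp hF hab]
    exact hF.norm_sub_le hab
  · intro Q hQ
    -- Since the orbit map is open, the images of the interiors form an increasing open cover of the
    -- orbit space, and a compact set lies in one of them.
    have hcover : Q ⊆ ⋃ n, orb K '' interior (C n) := fun P _ => by
      obtain ⟨x, rfl⟩ := orb_surjective P
      obtain ⟨n, hn⟩ := C.exists_mem_nhds x
      exact mem_iUnion.2 ⟨n, x, mem_interior_iff_mem_nhds.2 hn, rfl⟩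
    have hdir : Directed (· ⊆ ·) fun n => orb K '' interior (C n) :=
      Monotone.directed_le fun m n hmn => image_mono (interior_mono (C.subset hmn))
    obtain ⟨n, hn⟩ := hQ.elim_directed_cover _
      (fun n => hπ.isOpenMap _ isOpen_interior) hcover hdir
    exact ⟨n, hn.trans (image_mono interior_subset)⟩
  · intro n f ε hε
    refine ⟨Metric.eball (Φ n f) (ENNReal.ofReal ε),
      Metric.eball_mem_nhds _ (ENNReal.ofReal_pos.2 hε), ?_⟩
    rintro g hg _ ⟨x, hx, rfl⟩
    rw [Metric.mem_eball, edist_comm] at hg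
    have h1 := VanishingSection.norm_sub_lt hF hg x
    obtain ⟨hf1, hf2⟩ := rep_spec (hf := hK.p_smul) (f.2.2.1 (orb K x))
    obtain ⟨hg1, hg2⟩ := rep_spec (hf := hK.p_smul) (g.2.2.1 (orb K x))
    simp only [Φ, hφ1 n hx, Pi.one_apply, Complex.ofReal_one, hF.one_smul] at h1
    rw [← hf1, ← hg1, orbitFell_sub_orb hK hfp hF (hf2.trans hg2.symm)]
    exact h1

theorem isBanachBundle_orbitFell [T2Space X] [LocallyCompactSpace X] [SecondCountableTopology X]
    (hfp : IsFreeProper K X) (hF : IsBanachBundle F.toBundleData) :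
    IsBanachBundle (orbitFell 𝒢 F hK).toBundleData := by
  have hπX := isOpenQuotientMap_orb hK.base.continuous_smul
  have hπA := isOpenQuotientMap_orb hK.continuous_smul
  have hadd : ∀ {a b : A}, F.p a = F.p b → _ := orbitFell_add_orb hK hfp
  exact
  { continuous_p := continuous_orbitMap (hf := hK.p_smul) hF.continuous_p
    isOpenMap_p := hπA.isOpenMap_iff.2 (hπX.isOpenMap.comp hF.isOpenMap_p)
    p_zero := fun P => by
      obtain ⟨x, rfl⟩ := orb_surjective P
      simp [hF.p_zero]
    p_add := fun P Q hPQ => by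
      obtain ⟨a, b, rfl, rfl, hab⟩ := exists_orb_p_eq_p hK hPQ
      simp [hadd hab, hF.p_add _ _ hab]
    p_smul := fun c P => by
      obtain ⟨a, rfl⟩ := orb_surjective P
      simp [hF.p_smul]
    add_assoc := fun P Q R hPQ hQR => by
      obtain ⟨a, b, rfl, rfl, hab⟩ := exists_orb_p_eq_p hK hPQ
      obtain ⟨c, rfl, hbc⟩ := exists_orb_p_eq hK hQR.symm
      rw [hadd hab, hadd hbc.symm, hadd (by rw [hF.p_add _ _ hab, hab, hbc]),
        hadd (by rw [hF.p_add _ _ hbc.symm, hab]), hF.add_assoc _ _ _ hab hbc.symm]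
    add_comm := fun P Q hPQ => by
      obtain ⟨a, b, rfl, rfl, hab⟩ := exists_orb_p_eq_p hK hPQ
      rw [hadd hab, hadd hab.symm, hF.add_comm _ _ hab]
    add_zero := fun P => by
      obtain ⟨a, rfl⟩ := orb_surjective P
      rw [orbitFell_p_orb, orbitFell_zero_orb, hadd (hF.p_zero _).symm, hF.add_zero]
    sub_self := fun P => by
      obtain ⟨a, rfl⟩ := orb_surjective P
      rw [orbitFell_sub_orb hK hfp hF rfl, hF.sub_self]
      rfl
    one_smul := fun P => by
      obtain ⟨a, rfl⟩ := orb_surjective P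
      simp [hF.one_smul]
    mul_smul := fun c d P => by
      obtain ⟨a, rfl⟩ := orb_surjective P
      simp [hF.mul_smul]
    add_smul := fun c d P => by
      obtain ⟨a, rfl⟩ := orb_surjective P
      simp only [orbitFell_smul_orb]
      rw [hadd ((hF.p_smul _ _).trans (hF.p_smul _ _).symm), hF.add_smul]
    smul_add := fun c P Q hPQ => by
      obtain ⟨a, b, rfl, rfl, hab⟩ := exists_orb_p_eq_p hK hPQ
      simp only [orbitFell_smul_orb]
      rw [hadd hab, hadd ((hF.p_smul _ _).trans (hab.trans (hF.p_smul _ _).symm)),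
        orbitFell_smul_orb, hF.smul_add _ _ _ hab]
    norm_nonneg := fun P => by
      obtain ⟨a, rfl⟩ := orb_surjective P
      exact hF.norm_nonneg a
    norm_eq_zero := fun P => by
      obtain ⟨a, rfl⟩ := orb_surjective P
      refine ⟨fun h => congrArg (orb K) ((hF.norm_eq_zero a).1 h), fun h => ?_⟩
      rw [h, orbitFell_p_orb, orbitFell_zero_orb, orbitFell_norm_orb, hF.norm_zero]
    norm_add_le := fun P Q hPQ => by
      obtain ⟨a, b, rfl, rfl, hab⟩ := exists_orb_p_eq_p hK hPQ
      rw [hadd hab]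
      exact hF.norm_add_le _ _ hab
    norm_smul := fun c P => by
      obtain ⟨a, rfl⟩ := orb_surjective P
      exact hF.norm_smul c a
    complete := fun P f hf hC => by
      obtain ⟨x, rfl⟩ := orb_surjective P
      -- All terms are lifted to the single fibre over `x`, where the norms of differences are
      -- unchanged and completeness applies.
      choose g hg hgx using fun n => exists_orb_p_eq hK (hf n)
      obtain rfl : f = fun n => orb K (g n) := funext fun n => (hg n).symm
      simp only [fun m n => orbitFell_sub_orb hK hfp hF ((hgx m).trans (hgx n).symm)] at hC
      obtain ⟨a, ha, hlim⟩ := hF.complete x g hgx hC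
      refine ⟨orb K a, congrArg (orb K) ha, ?_⟩
      simp only [fun n => orbitFell_sub_orb hK hfp hF ((hgx n).trans ha.symm)]
      exact hlim
    upperSemicontinuous_norm := fun P c hc => by
      obtain ⟨a, rfl⟩ := orb_surjective P
      rw [← hπA.map_nhds_eq]
      exact hF.upperSemicontinuous_norm a c hc
    continuousOn_add := continuousOn_orbitOp hfp hK.continuous_smul hK.p_smul hK.p_smul
      hK.add_smul hF.continuous_p hF.continuous_p hF.continuousOn_add
    continuous_smul := fun c => continuous_orbitMap (hf := fun k a => hK.smul_smul k c a)
      (hF.continuous_smul c)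
    tendsto_zero := fun P l hp hn W hW => by
      obtain ⟨x, rfl⟩ := orb_surjective P
      rw [orbitFell_zero_orb, ← hπA.map_nhds_eq] at hW
      -- An orbit of small norm whose base point lies in the orbit image of `V` has a representative
      -- over `V`, which then lies in the preimage of `W`.
      obtain ⟨V, hV, ε, hε, hVε⟩ := hF.exists_nhds_zero hW
      have h1 : orb K '' V ∈ 𝓝 (orb K x) := hπX.isOpenMap.image_mem_nhds hV
      filter_upwards [hp h1, hn (Iio_mem_nhds hε)] with P hPV hPε
      obtain ⟨y, hy, hyP⟩ := hPV
      obtain ⟨a, rfl, rfl⟩ := exists_orb_p_eq hK hyP.symm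
      exact hVε a hy hPε
    separable := orbitFell_separable hK hfp hF }

/-- An orbit over that of `x` has a representative over `x` itself, so the fibre is not collapsed or
enlarged by passing to orbits; this is the isomorphism along which the bimodules are transported. -/
theorem isFibreIso_orb (hfp : IsFreeProper K X) (x : X) :
    IsFibreIso F.toBundleData x (orbitFell 𝒢 F hK).toBundleData (orb K x) (orb K) where
  map_p a ha := congrArg (orb K) ha
  surj P hP := by
    obtain ⟨a, ha, hax⟩ := exists_orb_p_eq hK hP
    exact ⟨a, hax, ha⟩
  map_zero := rfl
  map_add a b ha hb := (orbitFell_add_orb hK hfp (ha.trans hb.symm)).symm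
  map_smul _ _ _ := rfl
  map_norm _ _ := rfl

theorem isFibreStarIso_orb (h : IsLCGroupoid 𝒢) (hfp : IsFreeProper K X)
    (hF : IsFellBundle 𝒢 F) {u : X} (hu : u ∈ 𝒢.units) :
    IsFibreStarIso F u (orbitFell 𝒢 F hK) (orb K u) (orb K) where
  toIsFibreIso := isFibreIso_orb hK hfp u
  p_mul _ _ ha hb := hF.p_mul_of_mem h hu ha hb
  p_star _ ha := hF.p_star_of_mem h hu ha
  map_mul a b ha hb :=
    (orbitFell_mul_orb hK hfp (by rw [ha, hb, h.s_of_mem hu, h.r_of_mem hu])).symm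
  map_star _ _ := rfl

theorem exists_orb_composable {P Q : Orbits K A}
    (h : (orbitGroupoid 𝒢 hK.base).s ((orbitFell 𝒢 F hK).p P)
      = (orbitGroupoid 𝒢 hK.base).r ((orbitFell 𝒢 F hK).p Q)) :
    ∃ a b, orb K a = P ∧ orb K b = Q ∧ 𝒢.s (F.p a) = 𝒢.r (F.p b) := by
  obtain ⟨a, rfl⟩ := orb_surjective P
  obtain ⟨y, hy, hxy⟩ := exists_orb_r_eq hK.base h
  obtain ⟨b, hb, rfl⟩ := exists_orb_p_eq hK hy.symm
  exact ⟨a, b, rfl, hb, hxy⟩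

theorem isFellBundle_orbitFell (h : IsLCGroupoid 𝒢) (hfp : IsFreeProper K X)
    (hF : IsFellBundle 𝒢 F) : IsFellBundle (orbitGroupoid 𝒢 hK.base) (orbitFell 𝒢 F hK) := by
  have := h.t2
  have := h.locallyCompact
  have := h.secondCountable
  have hB := isBanachBundle_orbitFell hK hfp hF.toIsBanachBundle
  have hadd : ∀ {a b : A}, F.p a = F.p b → _ := orbitFell_add_orb hK hfp
  have hmul : ∀ {a b : A}, 𝒢.s (F.p a) = 𝒢.r (F.p b) → _ := orbitFell_mul_orb hK hfp
  have hsi : ∀ a b, 𝒢.s (F.p a) = 𝒢.r (F.p b) →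
      𝒢.s (F.p (F.star b)) = 𝒢.r (F.p (F.star a)) := fun a b hab => by
    rw [hF.p_star, hF.p_star, h.s_inv, h.r_inv, hab]
  exact
  { toIsBanachBundle := hB
    p_mul := fun P Q hPQ => by
      obtain ⟨a, b, rfl, rfl, hab⟩ := exists_orb_composable hK hPQ
      rw [hmul hab, orbitFell_p_orb, orbitFell_p_orb, orbitFell_p_orb,
        orbitGroupoid_mul_orb hK.base hfp hab, hF.p_mul _ _ hab]
    p_star := fun P => by
      obtain ⟨a, rfl⟩ := orb_surjective P
      simp [hF.p_star]
    mul_assoc := fun P Q R hPQ hQR => by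
      obtain ⟨a, b, rfl, rfl, hab⟩ := exists_orb_composable hK hPQ
      obtain ⟨y, hy, hxy⟩ := exists_orb_r_eq hK.base hQR
      obtain ⟨c, rfl, rfl⟩ := exists_orb_p_eq hK hy.symm
      rw [hmul hab, hmul hxy, hmul, hmul, hF.mul_assoc _ _ _ hab hxy]
      · rw [hF.p_mul _ _ hxy, h.r_mul _ _ hxy, hab]
      · rw [hF.p_mul _ _ hab, h.s_mul _ _ hab, hxy]
    add_mul := fun P P' Q hPP hPQ => by
      obtain ⟨a, b, rfl, rfl, hab⟩ := exists_orb_composable hK hPQ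
      obtain ⟨a', rfl, ha'⟩ := exists_orb_p_eq hK hPP.symm
      have hab' : 𝒢.s (F.p a') = 𝒢.r (F.p b) := by rw [ha', hab]
      rw [hadd ha'.symm, hmul hab, hmul hab', hmul, hadd, hF.add_mul _ _ _ ha'.symm hab]
      · rw [hF.p_mul _ _ hab, hF.p_mul _ _ hab', ha']
      · rw [hF.p_add _ _ ha'.symm, hab]
    mul_add := fun P Q Q' hQQ hPQ => by
      obtain ⟨a, b, rfl, rfl, hab⟩ := exists_orb_composable hK hPQ
      obtain ⟨b', rfl, hb'⟩ := exists_orb_p_eq hK hQQ.symm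
      have hab' : 𝒢.s (F.p a) = 𝒢.r (F.p b') := by rw [hb', hab]
      rw [hadd hb'.symm, hmul hab, hmul hab', hmul, hadd, hF.mul_add _ _ _ hb'.symm hab]
      · rw [hF.p_mul _ _ hab, hF.p_mul _ _ hab', hb']
      · rw [hF.p_add _ _ hb'.symm, hab]
    smul_mul := fun c P Q hPQ => by
      obtain ⟨a, b, rfl, rfl, hab⟩ := exists_orb_composable hK hPQ
      rw [hmul hab, orbitFell_smul_orb, orbitFell_smul_orb, hmul, hF.smul_mul _ _ _ hab]
      rw [hF.p_smul, hab]
    mul_smul' := fun c P Q hPQ => by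
      obtain ⟨a, b, rfl, rfl, hab⟩ := exists_orb_composable hK hPQ
      rw [hmul hab, orbitFell_smul_orb, orbitFell_smul_orb, hmul, hF.mul_smul' _ _ _ hab]
      rw [hF.p_smul, hab]
    star_star := fun P => by
      obtain ⟨a, rfl⟩ := orb_surjective P
      simp [hF.star_star]
    star_add := fun P Q hPQ => by
      obtain ⟨a, b, rfl, rfl, hab⟩ := exists_orb_p_eq_p hK hPQ
      rw [hadd hab, orbitFell_star_orb, orbitFell_star_orb, orbitFell_star_orb, hadd,
        hF.star_add _ _ hab]
      rw [hF.p_star, hF.p_star, hab]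
    star_smul := fun c P => by
      obtain ⟨a, rfl⟩ := orb_surjective P
      simp [hF.star_smul]
    star_mul := fun P Q hPQ => by
      obtain ⟨a, b, rfl, rfl, hab⟩ := exists_orb_composable hK hPQ
      rw [hmul hab, orbitFell_star_orb, orbitFell_star_orb, orbitFell_star_orb,
        hmul (hsi _ _ hab), hF.star_mul _ _ hab]
    continuousOn_mul := by
      refine (continuousOn_orbitOp hfp hK.continuous_smul hK.s_p_smul hK.r_p_smul hK.mul_smul
        (h.continuous_s.comp hF.continuous_p) (h.continuous_r.comp hF.continuous_p)
        hF.continuousOn_mul).mono ?_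
      -- The map induced by a composite agrees with the composite of the induced maps only after
      -- representatives are chosen.
      rintro ⟨P, Q⟩ hPQ
      obtain ⟨a, rfl⟩ := orb_surjective P
      obtain ⟨b, rfl⟩ := orb_surjective Q
      exact hPQ
    continuous_star := continuous_orbitMap (hf := hK.star_smul) hF.continuous_star
    norm_mul_le := fun U hU P Q hP hQ => by
      rw [orbitGroupoid_units] at hU
      obtain ⟨u, hu, rfl⟩ := hU
      obtain ⟨a, rfl, ha⟩ := exists_orb_p_eq hK hP
      obtain ⟨b, rfl, hb⟩ := exists_orb_p_eq hK hQ
      rw [← (isFibreStarIso_orb hK h hfp hF hu).map_mul _ _ ha hb]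
      exact hF.norm_mul_le u hu a b ha hb
    norm_star_mul_self := fun U hU P hP => by
      rw [orbitGroupoid_units] at hU
      obtain ⟨u, hu, rfl⟩ := hU
      obtain ⟨a, rfl, ha⟩ := exists_orb_p_eq hK hP
      rw [orbitFell_star_orb, ← (isFibreStarIso_orb hK h hfp hF hu).map_mul _ _
        (hF.p_star_of_mem h hu ha) ha]
      exact hF.norm_star_mul_self u hu a ha
    imprimitivity := fun P => by
      obtain ⟨x, rfl⟩ := orb_surjective P
      refine (hF.imprimitivity x).transport hF.toIsBanachBundle hF.toIsBanachBundle
        hF.toIsBanachBundle (isFibreStarIso_orb hK h hfp hF ⟨x, rfl⟩)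
        (isFibreStarIso_orb hK h hfp hF (h.s_mem x)) (isFibreIso_orb hK hfp x) ?_ ?_ ?_ ?_
      · intro a e ha he
        exact hmul (by rw [ha, he, h.s_r])
      · intro e b he hb
        exact hmul (by rw [he, hb, h.r_s])
      · intro e f he hf
        exact hmul (b := F.star f) (by rw [hF.p_star, he, hf, h.r_inv])
      · intro e f he hf
        exact hmul (a := F.star e) (by rw [hF.p_star, he, hf, h.s_inv]) }

end OrbitBundle

/-! ### Semidirect products -/

section Semidirect

variable {Y B G : Type*} [Group G] {𝒢 : GroupoidData Y} {F : FellData Y B}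

/-! ### The Banach bundle of a semidirect product -/

section Product

variable {actA : G → B → B}

theorem isFibreIso_semidirect_prod (x : Y) (t : G) :
    IsFibreIso F.toBundleData x (semidirectFell F actA).toBundleData (x, t) (fun a => (a, t)) where
  map_p _ ha := congrArg (fun x => (x, t)) ha
  surj := by
    rintro ⟨a, t'⟩ ha
    obtain ⟨hx, rfl⟩ : F.p a = x ∧ t' = t := Prod.mk.inj ha
    exact ⟨a, hx, rfl⟩
  map_zero := rfl
  map_add _ _ _ _ := rfl
  map_smul _ _ _ := rfl
  map_norm _ _ := rfl

variable [TopologicalSpace Y] [TopologicalSpace B] [TopologicalSpace G]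

/-- After a cutoff in the `Y`-direction a section over `Y × G` is a continuous map from `G` to the
sections over `Y` with the supremum distance. The space of such maps, with the compact-open
topology, is second countable, and closeness in it on `D n` means closeness of the sections on `C n
×ˢ D n`. -/
theorem semidirectFell_separable [T2Space Y] [LocallyCompactSpace Y] [SecondCountableTopology Y]
    [LocallyCompactSpace G] [SecondCountableTopology G]
    (hF : IsBanachBundle F.toBundleData) :
    ∃ S : Set (Y × G → B × G), S.Countable ∧
      S ⊆ (semidirectFell F actA).sectionsVanishing ∧
      ∀ f ∈ (semidirectFell F actA).sectionsVanishing, ∀ ε : ℝ, 0 < ε →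
        ∃ g ∈ S, ∀ x,
          (semidirectFell F actA).norm ((semidirectFell F actA).sub (f x) (g x)) < ε := by
  let C : CompactExhaustion Y := default
  let D : CompactExhaustion G := default
  have hφ : ∀ n, ∃ φ : C(Y, ℝ), EqOn φ 1 (C n) ∧ EqOn φ 0 (∅ : Set Y) ∧ HasCompactSupport φ ∧
      ∀ x, φ x ∈ Icc (0 : ℝ) 1 := fun n =>
    exists_continuous_one_zero_of_isCompact (C.isCompact n) isClosed_empty (disjoint_empty _)
  choose φ hφ1 _ hφc hφI using hφ
  let _ := VanishingSection.pseudoEMetricSpace hF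
  have := VanishingSection.secondCountableTopology hF
  have hp : ∀ f ∈ (semidirectFell F actA).sectionsVanishing, ∀ x t,
      F.p (f (x, t)).1 = x ∧ (f (x, t)).2 = t := fun f hf x t => Prod.mk.inj (hf.2.1 (x, t))
  let Ψ : ℕ → (semidirectFell F actA).sectionsVanishing → G → VanishingSection F.toBundleData :=
    fun n f t => ⟨fun x => F.smul (φ n x) (f.1 (x, t)).1,
      smul_mem_sectionsVanishing hF (φ n).continuous (hφc n)
        (continuous_fst.comp (f.2.1.comp (by fun_prop))) fun x => (hp f.1 f.2 x t).1⟩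
  have hΨ : ∀ n f, Continuous (Ψ n f) := by
    intro n f
    rw [continuous_iff_continuousAt]
    intro t
    rw [ContinuousAt, EMetric.tendsto_nhds]
    intro ε hε
    obtain ⟨δ, hδ0, hδ⟩ := ENNReal.lt_iff_exists_nnreal_btwn.1 hε
    have hcont : Continuous fun q : G × Y => F.sub (f.1 (q.2, q.1)).1 (f.1 (q.2, t)).1 := by
      have hf := f.2.1
      refine hF.continuousOn_sub.comp_continuous
        (f := fun q : G × Y => ((f.1 (q.2, q.1)).1, (f.1 (q.2, t)).1)) (by fun_prop) fun q => ?_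
      exact (hp f.1 f.2 _ _).1.trans (hp f.1 f.2 _ _).1.symm
    -- The difference vanishes at `t' = t`, so by upper semicontinuity its norm is small near each
    -- `(t, x)`; compactness of the support makes this uniform in `x`.
    have hev : ∀ᶠ t' in 𝓝 t, ∀ x ∈ tsupport (φ n),
        F.norm (F.sub (f.1 (x, t')).1 (f.1 (x, t)).1) < δ := by
      refine (hφc n).isCompact.eventually_forall_of_forall_eventually fun x _ => ?_
      refine (hcont.continuousAt (x := (t, x))).eventually (p := fun a => F.norm a < δ) ?_
      refine hF.upperSemicontinuous_norm _ _ ?_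
      simpa only [hF.sub_self, hF.norm_zero] using (by exact_mod_cast hδ0 : (0 : ℝ) < δ)
    filter_upwards [hev] with t' ht'
    refine lt_of_le_of_lt (VanishingSection.edist_le hF (ε := δ) fun x => ?_) (by simpa using hδ)
    have hpp : F.p (f.1 (x, t')).1 = F.p (f.1 (x, t)).1 :=
      (hp f.1 f.2 _ _).1.trans (hp f.1 f.2 _ _).1.symm
    simp only [Ψ]
    rw [hF.sub_smul_smul _ hpp, hF.norm_smul]
    by_cases hx : x ∈ tsupport (φ n)
    · have h1 := (ht' x hx).le
      have h2 : ‖(φ n x : ℂ)‖ ≤ 1 := by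
        rw [Complex.norm_real, Real.norm_of_nonneg (hφI n x).1]
        exact (hφI n x).2
      exact (mul_le_of_le_one_left (hF.norm_nonneg _) h2).trans h1
    · rw [image_eq_zero_of_notMem_tsupport hx]
      simp
  let Φ : ℕ → (semidirectFell F actA).sectionsVanishing → C(G, VanishingSection F.toBundleData) :=
    fun n f => ⟨Ψ n f, hΨ n f⟩
  refine exists_countable_dense_sections (M := fun _ => C(G, VanishingSection F.toBundleData))
    ?_ (fun n => C n ×ˢ D n) ?_ Φ ?_
  · rintro ⟨a, t⟩ ⟨b, t'⟩ hab
    exact hF.norm_sub_le (Prod.mk.inj hab).1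
  · intro Q hQ
    have hcover : Q ⊆ ⋃ n, interior (C n) ×ˢ interior (D n) := by
      rintro ⟨x, t⟩ _
      obtain ⟨m, hm⟩ := C.exists_mem_nhds x
      obtain ⟨n, hn⟩ := D.exists_mem_nhds t
      refine mem_iUnion.2 ⟨max m n, ?_, ?_⟩
      · exact interior_mono (C.subset (le_max_left m n)) (mem_interior_iff_mem_nhds.2 hm)
      · exact interior_mono (D.subset (le_max_right m n)) (mem_interior_iff_mem_nhds.2 hn)
    have hdir : Directed (· ⊆ ·) fun n => interior (C n) ×ˢ interior (D n) :=
      Monotone.directed_le fun m n hmn =>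
        prod_mono (interior_mono (C.subset hmn)) (interior_mono (D.subset hmn))
    obtain ⟨n, hn⟩ := hQ.elim_directed_cover _
      (fun n => isOpen_interior.prod isOpen_interior) hcover hdir
    exact ⟨n, hn.trans (prod_mono interior_subset interior_subset)⟩
  · intro n f ε hε
    -- Uniform closeness to `Φ n f` on the compact set `D n` is a neighbourhood in the compact-open
    -- topology.
    have hU := EMetric.tendstoUniformlyOn_iff.1
      (ContinuousMap.tendsto_iff_forall_isCompact_tendstoUniformlyOn.1
        (tendsto_id (x := 𝓝 (Φ n f))) (D n) (D.isCompact n)) _ (ENNReal.ofReal_pos.2 hε)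
    refine ⟨_, hU, ?_⟩
    rintro g hg ⟨x, t⟩ ⟨hx, ht⟩
    have h1 : F.norm (F.sub (F.smul (φ n x) (f.1 (x, t)).1) (F.smul (φ n x) (g.1 (x, t)).1)) < ε :=
      VanishingSection.norm_sub_lt hF (hg t ht) x
    simp only [hφ1 n hx, Pi.one_apply, Complex.ofReal_one, hF.one_smul] at h1
    exact h1

/-- The linear structure does not involve the action, so `actA` is an arbitrary map; the
right-handed product later reuses this with a trivial `actA`. -/
theorem isBanachBundle_semidirect [T2Space Y] [LocallyCompactSpace Y]
    [SecondCountableTopology Y] [LocallyCompactSpace G] [SecondCountableTopology G]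
    (hF : IsBanachBundle F.toBundleData) :
    IsBanachBundle (semidirectFell F actA).toBundleData where
  continuous_p := hF.continuous_p.prodMap continuous_id
  isOpenMap_p := hF.isOpenMap_p.prodMap IsOpenMap.id
  p_zero x := congrArg (fun y => (y, x.2)) (hF.p_zero x.1)
  p_add := by
    rintro ⟨a, t⟩ ⟨b, t'⟩ hab
    exact congrArg (fun y => (y, t)) (hF.p_add a b (Prod.mk.inj hab).1)
  p_smul c a := congrArg (fun y => (y, a.2)) (hF.p_smul c a.1)
  add_assoc := by
    rintro ⟨a, t⟩ ⟨b, t'⟩ ⟨c, t''⟩ hab hbc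
    exact congrArg (fun y => (y, t)) (hF.add_assoc a b c (Prod.mk.inj hab).1 (Prod.mk.inj hbc).1)
  add_comm := by
    rintro ⟨a, t⟩ ⟨b, t'⟩ hab
    obtain ⟨hp, rfl⟩ : F.p a = F.p b ∧ t = t' := Prod.mk.inj hab
    exact congrArg (fun y => (y, t)) (hF.add_comm a b hp)
  add_zero a := congrArg (fun y => (y, a.2)) (hF.add_zero a.1)
  sub_self a := congrArg (fun y => (y, a.2)) (hF.sub_self a.1)
  one_smul a := congrArg (fun y => (y, a.2)) (hF.one_smul a.1)
  mul_smul c d a := congrArg (fun y => (y, a.2)) (hF.mul_smul c d a.1)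
  add_smul c d a := congrArg (fun y => (y, a.2)) (hF.add_smul c d a.1)
  smul_add := by
    rintro c ⟨a, t⟩ ⟨b, t'⟩ hab
    exact congrArg (fun y => (y, t)) (hF.smul_add c a b (Prod.mk.inj hab).1)
  norm_nonneg a := hF.norm_nonneg a.1
  norm_eq_zero a := by
    refine (hF.norm_eq_zero a.1).trans ⟨fun h => Prod.ext h rfl, fun h => congrArg Prod.fst h⟩
  norm_add_le := by
    rintro ⟨a, t⟩ ⟨b, t'⟩ hab
    exact hF.norm_add_le a b (Prod.mk.inj hab).1
  norm_smul c a := hF.norm_smul c a.1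
  complete := by
    rintro ⟨x, t⟩ f hf hC
    obtain ⟨a, ha, hlim⟩ := hF.complete x (fun n => (f n).1) (fun n => (Prod.mk.inj (hf n)).1) hC
    exact ⟨(a, t), congrArg (fun y => (y, t)) ha, hlim⟩
  upperSemicontinuous_norm a c hc :=
    continuous_fst.continuousAt.eventually (hF.upperSemicontinuous_norm a.1 c hc)
  continuousOn_add := by
    have h1 : ContinuousOn (fun q : (B × G) × (B × G) => F.add q.1.1 q.2.1)
        {q | F.p q.1.1 = F.p q.2.1} :=
      hF.continuousOn_add.comp (f := fun q : (B × G) × (B × G) => (q.1.1, q.2.1))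
        (by fun_prop) fun q hq => hq
    refine ContinuousOn.prodMk (h1.mono fun q hq => (Prod.mk.inj hq).1) ?_
    exact (continuous_snd.comp continuous_fst).continuousOn
  continuous_smul c := (hF.continuous_smul c).prodMap continuous_id
  tendsto_zero := by
    rintro ⟨x, t⟩ l hp hn
    have h1 : Tendsto Prod.fst l (𝓝 (F.zero x)) := by
      refine hF.tendsto_zero x (map Prod.fst l) ?_ ?_
      · exact tendsto_map'_iff.2 ((continuous_fst.tendsto (x, t)).comp hp)
      · exact tendsto_map'_iff.2 hn
    have h2 : Tendsto Prod.snd l (𝓝 t) := (continuous_snd.tendsto (x, t)).comp hp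
    exact h1.prodMk_nhds h2
  separable := semidirectFell_separable hF

end Product

/-! ### Groupoid and Fell bundle structure of a semidirect product -/

variable [MulAction G Y] [MulAction G B]

theorem semidirectGroupoid_units :
    (semidirectGroupoid 𝒢 fun (g : G) (y : Y) => g • y).units = 𝒢.units ×ˢ {1} := by
  ext ⟨y, t⟩
  constructor
  · rintro ⟨x, hx⟩
    obtain ⟨h1, h2⟩ : 𝒢.r x.1 = y ∧ 1 = t := Prod.mk.inj hx
    exact ⟨⟨x.1, h1⟩, h2.symm⟩
  · rintro ⟨⟨x, hx⟩, ht⟩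
    exact ⟨(x, 1), Prod.ext hx (Eq.symm ht)⟩

variable [TopologicalSpace Y] [TopologicalSpace B] [TopologicalSpace G]

/-- Moving the inverse translation from the source to the other factor turns composability in the
product into composability of `x.1` with `x.2 • y.1`, which is the pair that is actually multiplied.
-/
theorem semidirectGroupoid_s_eq_r_iff (hG : ActsByGroupoidAut G 𝒢) {x y : Y × G} :
    (semidirectGroupoid 𝒢 fun (g : G) (y : Y) => g • y).s x
      = (semidirectGroupoid 𝒢 fun (g : G) (y : Y) => g • y).r y ↔
    𝒢.s x.1 = 𝒢.r (x.2 • y.1) := by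
  simp only [semidirectGroupoid, Prod.mk.injEq, and_true]
  rw [inv_smul_eq_iff, hG.r_smul]

theorem isLCGroupoid_semidirect [IsTopologicalGroup G] [T2Space G] [LocallyCompactSpace G]
    [SecondCountableTopology G] (h : IsLCGroupoid 𝒢) (hG : ActsByGroupoidAut G 𝒢) :
    IsLCGroupoid (semidirectGroupoid 𝒢 fun (g : G) (y : Y) => g • y) := by
  have := h.t2
  have := h.locallyCompact
  have := h.secondCountable
  have : ContinuousSMul G Y := ⟨hG.continuous_smul⟩
  have hc := h.continuous_inv
  have hiff := fun x y => semidirectGroupoid_s_eq_r_iff (x := x) (y := y) hG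
  exact
  { t2 := inferInstance
    locallyCompact := inferInstance
    secondCountable := inferInstance
    r_r := fun x => by simp [semidirectGroupoid, h.r_r]
    s_r := fun x => by simp [semidirectGroupoid, h.s_r]
    r_s := fun x => by simp [semidirectGroupoid, hG.r_smul, h.r_s]
    s_s := fun x => by simp [semidirectGroupoid, hG.s_smul, h.s_s]
    r_mul := fun x y hxy => by
      rw [hiff] at hxy
      simp [semidirectGroupoid, h.r_mul _ _ hxy]
    s_mul := fun x y hxy => by
      rw [hiff] at hxy
      simp [semidirectGroupoid, h.s_mul _ _ hxy, hG.s_smul, mul_smul]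
    mul_assoc := fun x y z hxy hyz => by
      rw [hiff] at hxy hyz
      have hyz' : 𝒢.s (x.2 • y.1) = 𝒢.r ((x.2 * y.2) • z.1) := by
        rw [mul_smul, hG.s_smul, hyz, hG.r_smul x.2]
      simp only [semidirectGroupoid, Prod.mk.injEq, mul_assoc, and_true]
      rw [h.mul_assoc _ _ _ hxy hyz', ← hG.mul_smul _ _ _ hyz, mul_smul]
    r_mul_self := fun x => by simp [semidirectGroupoid, h.r_mul_self]
    mul_s_self := fun x => by simp [semidirectGroupoid, h.mul_s_self]
    r_inv := fun x => by simp [semidirectGroupoid, hG.r_smul, h.r_inv]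
    s_inv := fun x => by simp [semidirectGroupoid, hG.s_smul, h.s_inv]
    mul_inv := fun x => by simp [semidirectGroupoid, h.mul_inv]
    inv_mul := fun x => by
      simp [semidirectGroupoid, hG.mul_smul _ _ _ (h.s_inv x.1), h.inv_mul]
    continuous_inv := by
      simp only [semidirectGroupoid]
      fun_prop
    continuousOn_mul := by
      have h1 : ContinuousOn (fun q : (Y × G) × (Y × G) => 𝒢.mul q.1.1 (q.1.2 • q.2.1))
          {q | 𝒢.s q.1.1 = 𝒢.r (q.1.2 • q.2.1)} :=
        h.continuousOn_mul.comp (f := fun q : (Y × G) × (Y × G) => (q.1.1, q.1.2 • q.2.1))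
          (by fun_prop) fun q hq => hq
      refine ContinuousOn.prodMk (h1.mono fun q hq => (hiff _ _).1 hq) ?_
      fun_prop
    isOpenMap_r := by
      rw [isOpenMap_rangeFactorization_iff]
      rintro ⟨y, t⟩
      change 𝓝[(semidirectGroupoid 𝒢 fun (g : G) (y : Y) => g • y).units] (𝒢.r y, 1)
        ≤ map (Prod.map 𝒢.r fun _ => 1) (𝓝 (y, t))
      rw [semidirectGroupoid_units, nhdsWithin_prod_eq, nhdsWithin_singleton, nhds_prod_eq,
        ← prod_map_map_eq', Filter.map_const]
      exact Filter.prod_mono (h.nhdsWithin_units_le_map_r y) le_rfl }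

/-- A translation by `g` is built in because the source of `(y, t)` is `t⁻¹ • s y`: the right
coefficient algebra over `(y, t)` is identified with the fibre over `s y` through `g = t⁻¹`, the
left one with the fibre over `r y` through `g = 1`. -/
theorem isFibreStarIso_semidirect (h : IsLCGroupoid 𝒢) (hF : IsFellBundle 𝒢 F)
    (hG : ActsByFellAut G 𝒢 F) {u : Y} (hu : u ∈ 𝒢.units) (g : G) :
    IsFibreStarIso F u (semidirectFell F fun (g : G) (b : B) => g • b) (g • u, 1)
      (fun b => (g • b, 1)) where
  map_p a ha := Prod.ext ((hG.p_smul g a).trans (congrArg (g • ·) ha)) rfl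
  surj := by
    rintro ⟨a, t⟩ ha
    obtain ⟨hu, rfl⟩ : F.p a = g • u ∧ t = 1 := Prod.mk.inj ha
    exact ⟨g⁻¹ • a, by rw [hG.p_smul, hu, inv_smul_smul], by simp⟩
  map_zero := Prod.ext (hG.zero_smul g u).symm rfl
  map_add a b ha hb := Prod.ext (hG.add_smul g a b (ha.trans hb.symm)).symm rfl
  map_smul c a _ := Prod.ext (hG.smul_smul g c a).symm rfl
  map_norm a _ := hG.norm_smul g a
  p_mul _ _ ha hb := hF.p_mul_of_mem h hu ha hb
  p_star _ ha := hF.p_star_of_mem h hu ha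
  map_mul a b ha hb := by
    have hab : 𝒢.s (F.p a) = 𝒢.r (F.p b) := by rw [ha, hb, h.s_of_mem hu, h.r_of_mem hu]
    simp [semidirectFell, hG.mul_smul g _ _ hab]
  map_star a _ := by simp [semidirectFell, hG.star_smul]

theorem semidirectFell_s_eq_r_iff (hG : ActsByFellAut G 𝒢 F) {a b : B × G} :
    (semidirectGroupoid 𝒢 fun (g : G) (y : Y) => g • y).s
        ((semidirectFell F fun (g : G) (b : B) => g • b).p a)
      = (semidirectGroupoid 𝒢 fun (g : G) (y : Y) => g • y).r
        ((semidirectFell F fun (g : G) (b : B) => g • b).p b) ↔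
    𝒢.s (F.p a.1) = 𝒢.r (F.p (a.2 • b.1)) := by
  rw [semidirectGroupoid_s_eq_r_iff hG.base, hG.p_smul]
  rfl

theorem isFellBundle_semidirect [IsTopologicalGroup G] [LocallyCompactSpace G]
    [SecondCountableTopology G] (h : IsLCGroupoid 𝒢) (hF : IsFellBundle 𝒢 F)
    (hG : ActsByFellAut G 𝒢 F) :
    IsFellBundle (semidirectGroupoid 𝒢 fun (g : G) (y : Y) => g • y)
      (semidirectFell F fun (g : G) (b : B) => g • b) := by
  have := h.t2
  have := h.locallyCompact
  have := h.secondCountable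
  have : ContinuousSMul G B := ⟨hG.continuous_smul⟩
  have hc := hF.continuous_star
  have hiff := fun a b => semidirectFell_s_eq_r_iff (a := a) (b := b) hG
  exact
  { toIsBanachBundle := isBanachBundle_semidirect hF.toIsBanachBundle
    p_mul := fun a b hab => by
      rw [hiff] at hab
      simp [semidirectFell, semidirectGroupoid, hF.p_mul _ _ hab, hG.p_smul]
    p_star := fun a => by simp [semidirectFell, semidirectGroupoid, hF.p_star, hG.p_smul]
    mul_assoc := fun a b c hab hbc => by
      rw [hiff] at hab hbc
      -- Translated by `a.2`, the composable pair `b.1`, `b.2 • c.1` becomes the second and third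
      -- factors of a triple product in `F`.
      have hbc' : 𝒢.s (F.p (a.2 • b.1)) = 𝒢.r (F.p ((a.2 * b.2) • c.1)) := by
        rw [mul_smul, hG.s_p_smul, hbc, hG.r_p_smul a.2]
      simp only [semidirectFell, Prod.mk.injEq, mul_assoc, and_true]
      rw [hF.mul_assoc _ _ _ hab hbc', ← hG.mul_smul _ _ _ hbc, mul_smul]
    add_mul := fun a a' b haa hab => by
      rw [hiff] at hab
      simp only [semidirectFell, Prod.mk.injEq, and_true] at haa ⊢
      rw [← haa.2, hF.add_mul _ _ _ haa.1 hab]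
    mul_add := fun a b b' hbb hab => by
      rw [hiff] at hab
      simp only [semidirectFell, Prod.mk.injEq, and_true] at hbb ⊢
      rw [← hG.add_smul _ _ _ hbb.1, hF.mul_add _ _ _ _ hab]
      rw [hG.p_smul, hG.p_smul, hbb.1]
    smul_mul := fun c a b hab => by
      rw [hiff] at hab
      simp [semidirectFell, hF.smul_mul _ _ _ hab]
    mul_smul' := fun c a b hab => by
      rw [hiff] at hab
      simp [semidirectFell, ← hG.smul_smul, hF.mul_smul' _ _ _ hab]
    star_star := fun a => by simp [semidirectFell, hG.star_smul, hF.star_star]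
    star_add := fun a b hab => by
      simp only [semidirectFell, Prod.mk.injEq, and_true] at hab ⊢
      rw [hF.star_add _ _ hab.1, ← hab.2, hG.add_smul]
      rw [hF.p_star, hF.p_star, hab.1]
    star_smul := fun c a => by simp [semidirectFell, hF.star_smul, hG.smul_smul]
    star_mul := fun a b hab => by
      rw [hiff] at hab
      have hab' : 𝒢.s (F.p (F.star (a.2 • b.1))) = 𝒢.r (F.p (F.star a.1)) := by
        rw [hF.p_star, hF.p_star, h.s_inv, h.r_inv, hab]
      simp only [semidirectFell, Prod.mk.injEq, mul_inv_rev, and_true]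
      rw [hF.star_mul _ _ hab, ← hG.mul_smul _ _ _ hab', hG.star_smul, mul_smul, mul_smul,
        inv_smul_smul]
    continuousOn_mul := by
      have h1 : ContinuousOn (fun q : (B × G) × (B × G) => F.mul q.1.1 (q.1.2 • q.2.1))
          {q | 𝒢.s (F.p q.1.1) = 𝒢.r (F.p (q.1.2 • q.2.1))} :=
        hF.continuousOn_mul.comp (f := fun q : (B × G) × (B × G) => (q.1.1, q.1.2 • q.2.1))
          (by fun_prop) fun q hq => hq
      refine ContinuousOn.prodMk (h1.mono fun q hq => (hiff _ _).1 hq) ?_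
      fun_prop
    continuous_star := by
      simp only [semidirectFell]
      fun_prop
    norm_mul_le := by
      rw [semidirectGroupoid_units]
      rintro ⟨u, _⟩ ⟨hu, rfl⟩ ⟨a, s⟩ ⟨b, t⟩ has hbt
      obtain ⟨ha, rfl⟩ : F.p a = u ∧ s = 1 := Prod.mk.inj has
      obtain ⟨hb, rfl⟩ : F.p b = u ∧ t = 1 := Prod.mk.inj hbt
      simpa [semidirectFell] using hF.norm_mul_le u hu a b ha hb
    norm_star_mul_self := by
      rw [semidirectGroupoid_units]
      rintro ⟨u, _⟩ ⟨hu, rfl⟩ ⟨a, s⟩ has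
      obtain ⟨ha, rfl⟩ : F.p a = u ∧ s = 1 := Prod.mk.inj has
      simpa [semidirectFell] using hF.norm_star_mul_self u hu a ha
    imprimitivity := by
      rintro ⟨y, t⟩
      have h1 := isFibreStarIso_semidirect h hF hG (u := 𝒢.r y) ⟨y, rfl⟩ 1
      simp only [one_smul] at h1
      refine (hF.imprimitivity y).transport hF.toIsBanachBundle hF.toIsBanachBundle
        hF.toIsBanachBundle h1 (isFibreStarIso_semidirect h hF hG (h.s_mem y) t⁻¹)
        (isFibreIso_semidirect_prod y t) ?_ ?_ ?_ ?_
      · intro a e ha he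
        simp [semidirectFell]
      · intro e b he hb
        simp [semidirectFell]
      · intro e f he hf
        simp [semidirectFell]
      · intro e f he hf
        have hef : 𝒢.s (F.p (F.star e)) = 𝒢.r (F.p f) := by rw [hF.p_star, he, hf, h.s_inv]
        simp [semidirectFell, hG.mul_smul _ _ _ hef] }

end Semidirect

/-! ### Semidirect products for right actions -/

/-! ### Transport of Banach bundles along homeomorphisms -/

section BanachTransport

theorem IsBanachBundle.transport {X E X' E' : Type*} [TopologicalSpace X] [TopologicalSpace E]
    [TopologicalSpace X'] [TopologicalSpace E'] {B : BundleData X E} {B' : BundleData X' E'}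
    (h : IsBanachBundle B) (e : X' ≃ₜ X) (φ : E' ≃ₜ E) (hp : ∀ a, e (B'.p a) = B.p (φ a))
    (hzero : ∀ x, φ (B'.zero x) = B.zero (e x))
    (hadd : ∀ a b, φ (B'.add a b) = B.add (φ a) (φ b))
    (hsmul : ∀ c a, φ (B'.smul c a) = B.smul c (φ a))
    (hnorm : ∀ a, B'.norm a = B.norm (φ a)) : IsBanachBundle B' := by
  have hpp : ∀ {a b}, B'.p a = B'.p b ↔ B.p (φ a) = B.p (φ b) := fun {a b} => by
    rw [← hp, ← hp, e.injective.eq_iff]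
  have hpx : ∀ {a x}, B'.p a = x ↔ B.p (φ a) = e x := fun {a x} => by
    rw [← hp, e.injective.eq_iff]
  have hsub : ∀ a b, φ (B'.sub a b) = B.sub (φ a) (φ b) := fun a b => by
    rw [BundleData.sub, hadd, hsmul]
    rfl
  have hp_eq : B'.p = e.symm ∘ B.p ∘ φ := funext fun a => by
    rw [Function.comp, Function.comp, ← hp, e.symm_apply_apply]
  have hsec : ∀ f, f ∈ B'.sectionsVanishing ↔ (fun x => φ (f (e.symm x))) ∈ B.sectionsVanishing := by
    intro f
    refine and_congr ?_ (and_congr ?_ ?_)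
    · refine ⟨fun hf => φ.continuous.comp (hf.comp e.symm.continuous), fun hf => ?_⟩
      have := φ.symm.continuous.comp (hf.comp e.continuous)
      simpa [Function.comp_def] using this
    · refine ⟨fun hf x => ?_, fun hf x => ?_⟩
      · rw [← hp, hf, e.apply_symm_apply]
      · rw [hpx]
        simpa using hf (e x)
    · refine forall₂_congr fun ε _ => ?_
      have : {x | ε ≤ B.norm (φ (f (e.symm x)))} = e.symm ⁻¹' {x | ε ≤ B'.norm (f x)} := by
        ext x; simp [hnorm]
      rw [this, e.symm.isCompact_preimage]
  exact
  { continuous_p := hp_eq ▸ e.symm.continuous.comp (h.continuous_p.comp φ.continuous)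
    isOpenMap_p := hp_eq ▸ e.symm.isOpenMap.comp (h.isOpenMap_p.comp φ.isOpenMap)
    p_zero := fun x => by rw [hpx, hzero, h.p_zero]
    p_add := fun a b hab => by rw [hpp, hadd, h.p_add _ _ (hpp.1 hab)]
    p_smul := fun c a => by rw [hpp, hsmul, h.p_smul]
    add_assoc := fun a b c hab hbc => by
      apply φ.injective
      simp only [hadd, h.add_assoc _ _ _ (hpp.1 hab) (hpp.1 hbc)]
    add_comm := fun a b hab => by
      apply φ.injective
      rw [hadd, hadd, h.add_comm _ _ (hpp.1 hab)]
    add_zero := fun a => by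
      apply φ.injective
      rw [hadd, hzero, hp, h.add_zero]
    sub_self := fun a => by
      apply φ.injective
      rw [hsub, hzero, hp, h.sub_self]
    one_smul := fun a => by
      apply φ.injective
      rw [hsmul, h.one_smul]
    mul_smul := fun c d a => by
      apply φ.injective
      simp only [hsmul, h.mul_smul]
    add_smul := fun c d a => by
      apply φ.injective
      simp only [hsmul, hadd, h.add_smul]
    smul_add := fun c a b hab => by
      apply φ.injective
      simp only [hsmul, hadd, h.smul_add _ _ _ (hpp.1 hab)]
    norm_nonneg := fun a => hnorm a ▸ h.norm_nonneg _
    norm_eq_zero := fun a => by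
      rw [hnorm, h.norm_eq_zero, ← hp, ← hzero, φ.injective.eq_iff]
    norm_add_le := fun a b hab => by
      rw [hnorm, hnorm, hnorm, hadd]
      exact h.norm_add_le _ _ (hpp.1 hab)
    norm_smul := fun c a => by rw [hnorm, hnorm, hsmul, h.norm_smul]
    complete := fun x f hf hC => by
      simp only [hnorm, hsub] at hC
      obtain ⟨a, ha, hlim⟩ := h.complete (e x) (fun n => φ (f n)) (fun n => hpx.1 (hf n)) hC
      refine ⟨φ.symm a, hpx.2 (by rw [φ.apply_symm_apply, ha]), ?_⟩
      simpa only [hnorm, hsub, φ.apply_symm_apply] using hlim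
    upperSemicontinuous_norm := fun a c hc => by
      simp only [hnorm] at hc ⊢
      exact φ.continuous.continuousAt.eventually (h.upperSemicontinuous_norm (φ a) c hc)
    continuousOn_add := by
      rw [φ.isInducing.continuousOn_iff]
      have := h.continuousOn_add.comp (f := fun q : E' × E' => (φ q.1, φ q.2))
        (s := {q | B'.p q.1 = B'.p q.2}) (by fun_prop) fun q hq => hpp.1 hq
      simpa only [Function.comp_def, hadd] using this
    continuous_smul := fun c => by
      rw [φ.isInducing.continuous_iff]
      have := (h.continuous_smul c).comp φ.continuous
      simpa only [Function.comp_def, hsmul] using this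
    tendsto_zero := fun x l hpl hnl => by
      have h1 := h.tendsto_zero (e x) (map φ l) (by
        rw [tendsto_map'_iff, show B.p ∘ φ = e ∘ B'.p from funext fun a => (hp a).symm]
        exact (e.continuous.tendsto x).comp hpl) (by
        rw [tendsto_map'_iff, show B.norm ∘ φ = B'.norm from funext fun a => (hnorm a).symm]
        exact hnl)
      rw [← hzero] at h1
      rw [φ.isInducing.nhds_eq_comap]
      exact map_le_iff_le_comap.1 h1
    separable := by
      obtain ⟨S, hSc, hS, hd⟩ := h.separable
      refine ⟨(fun g x => φ.symm (g (e x))) '' S, hSc.image _, ?_, fun f hf ε hε => ?_⟩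
      · rintro _ ⟨g, hg, rfl⟩
        rw [hsec]
        simpa using hS hg
      · obtain ⟨g, hg, hfg⟩ := hd _ ((hsec f).1 hf) ε hε
        refine ⟨_, ⟨g, hg, rfl⟩, fun x => ?_⟩
        rw [hnorm, hsub, φ.apply_symm_apply]
        simpa using hfg (e x) }

end BanachTransport

/-! ### Groupoid and Fell bundle structure for right actions -/

section RightSemidirect

variable {Y B H : Type*} [Group H] {𝒢 : GroupoidData Y} {F : FellData Y B}

theorem isFibreIso_rightSemidirect_prod {actA : H → B → B} (x : Y) (t : H) :
    IsFibreIso F.toBundleData x (rightSemidirectFell F actA).toBundleData (t, x)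
      (fun a => (t, a)) where
  map_p _ ha := congrArg (fun x => (t, x)) ha
  surj := by
    rintro ⟨t', a⟩ ha
    obtain ⟨rfl, hx⟩ : t' = t ∧ F.p a = x := Prod.mk.inj ha
    exact ⟨a, hx, rfl⟩
  map_zero := rfl
  map_add _ _ _ _ := rfl
  map_smul _ _ _ := rfl
  map_norm _ _ := rfl

variable [MulAction Hᵐᵒᵖ Y] [MulAction Hᵐᵒᵖ B]

theorem rightSemidirectGroupoid_units :
    (rightSemidirectGroupoid 𝒢 fun (h : H) (y : Y) => op h • y).units
      = {1} ×ˢ {u | ∃ y, ∃ h : H, u = op h • 𝒢.r y} := by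
  ext ⟨t, y⟩
  constructor
  · rintro ⟨x, hx⟩
    obtain ⟨h1, h2⟩ : 1 = t ∧ op x.1⁻¹ • 𝒢.r x.2 = y := Prod.mk.inj hx
    exact ⟨h1.symm, _, _, h2.symm⟩
  · rintro ⟨ht, ⟨x, h, hx⟩⟩
    exact ⟨(h⁻¹, x), Prod.ext (Eq.symm ht) (by simpa [rightSemidirectGroupoid] using hx.symm)⟩

variable [TopologicalSpace Y] [TopologicalSpace B] [TopologicalSpace H]

theorem rightSemidirectGroupoid_units_eq (hH : ActsByGroupoidAut Hᵐᵒᵖ 𝒢) :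
    (rightSemidirectGroupoid 𝒢 fun (h : H) (y : Y) => op h • y).units = {1} ×ˢ 𝒢.units := by
  rw [rightSemidirectGroupoid_units]
  congr 1
  ext u
  constructor
  · rintro ⟨y, h, rfl⟩
    exact ⟨op h • y, hH.r_smul _ _⟩
  · rintro ⟨y, rfl⟩
    exact ⟨y, 1, by simp⟩

theorem rightSemidirectGroupoid_s_eq_r_iff (hH : ActsByGroupoidAut Hᵐᵒᵖ 𝒢) {x y : H × Y} :
    (rightSemidirectGroupoid 𝒢 fun (h : H) (y : Y) => op h • y).s x
      = (rightSemidirectGroupoid 𝒢 fun (h : H) (y : Y) => op h • y).r y ↔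
    𝒢.s (op y.1 • x.2) = 𝒢.r y.2 := by
  simp only [rightSemidirectGroupoid, Prod.mk.injEq, true_and]
  rw [op_inv, eq_inv_smul_iff, hH.s_smul]

theorem isLCGroupoid_rightSemidirect [IsTopologicalGroup H] [T2Space H] [LocallyCompactSpace H]
    [SecondCountableTopology H] (h : IsLCGroupoid 𝒢) (hH : ActsByGroupoidAut Hᵐᵒᵖ 𝒢) :
    IsLCGroupoid (rightSemidirectGroupoid 𝒢 fun (h : H) (y : Y) => op h • y) := by
  have := h.t2
  have := h.locallyCompact
  have := h.secondCountable
  have : ContinuousSMul Hᵐᵒᵖ Y := ⟨hH.continuous_smul⟩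
  have hc := h.continuous_inv
  have hiff := fun x y => rightSemidirectGroupoid_s_eq_r_iff (x := x) (y := y) hH
  exact
  { t2 := inferInstance
    locallyCompact := inferInstance
    secondCountable := inferInstance
    r_r := fun x => by simp [rightSemidirectGroupoid, hH.r_smul, h.r_r]
    s_r := fun x => by simp [rightSemidirectGroupoid, hH.s_smul, h.s_r]
    r_s := fun x => by simp [rightSemidirectGroupoid, h.r_s]
    s_s := fun x => by simp [rightSemidirectGroupoid, h.s_s]
    r_mul := fun x y hxy => by
      rw [hiff] at hxy
      simp [rightSemidirectGroupoid, h.r_mul _ _ hxy, hH.r_smul, mul_smul]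
    s_mul := fun x y hxy => by
      rw [hiff] at hxy
      simp [rightSemidirectGroupoid, h.s_mul _ _ hxy]
    mul_assoc := fun x y z hxy hyz => by
      rw [hiff] at hxy hyz
      have hxy' : 𝒢.s (op (y.1 * z.1) • x.2) = 𝒢.r (op z.1 • y.2) := by
        rw [op_mul, mul_smul, hH.s_smul, hxy, hH.r_smul]
      simp only [rightSemidirectGroupoid, Prod.mk.injEq, mul_assoc, true_and]
      rw [← h.mul_assoc _ _ _ hxy' hyz, ← hH.mul_smul _ _ _ hxy, op_mul, mul_smul]
    r_mul_self := fun x => by simp [rightSemidirectGroupoid, h.r_mul_self]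
    mul_s_self := fun x => by simp [rightSemidirectGroupoid, h.mul_s_self]
    r_inv := fun x => by simp [rightSemidirectGroupoid, hH.r_smul, h.r_inv]
    s_inv := fun x => by simp [rightSemidirectGroupoid, hH.s_smul, h.s_inv]
    mul_inv := fun x => by
      simp [rightSemidirectGroupoid, hH.mul_smul _ _ _ (h.r_inv x.2).symm, h.mul_inv]
    inv_mul := fun x => by simp [rightSemidirectGroupoid, h.inv_mul]
    continuous_inv := by
      simp only [rightSemidirectGroupoid]
      fun_prop
    continuousOn_mul := by
      have h1 : ContinuousOn (fun q : (H × Y) × (H × Y) => 𝒢.mul (op q.2.1 • q.1.2) q.2.2)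
          {q | 𝒢.s (op q.2.1 • q.1.2) = 𝒢.r q.2.2} :=
        h.continuousOn_mul.comp (f := fun q : (H × Y) × (H × Y) => (op q.2.1 • q.1.2, q.2.2))
          (by fun_prop) fun q hq => hq
      refine ContinuousOn.prodMk ?_ (h1.mono fun q hq => (hiff _ _).1 hq)
      fun_prop
    isOpenMap_r := by
      rw [isOpenMap_rangeFactorization_iff]
      rintro ⟨t, y⟩
      change 𝓝[(rightSemidirectGroupoid 𝒢 fun (h : H) (y : Y) => op h • y).units]
        (1, op t⁻¹ • 𝒢.r y) ≤ map (fun x : H × Y => (1, op x.1⁻¹ • 𝒢.r x.2)) (𝓝 (t, y))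
      -- Here the range depends on the group coordinate as well. It is enough to vary the second
      -- coordinate with `t` fixed: along `z ↦ (t, z · t)` the range map is `z ↦ (1, r z)`, which is
      -- open onto the units.
      have hcont : Tendsto (fun z : Y => (t, op t • z)) (𝓝 (op t⁻¹ • y)) (𝓝 (t, y)) := by
        have : Continuous fun z : Y => (t, op t • z) := by fun_prop
        simpa using this.tendsto (op t⁻¹ • y)
      have hmap : map (fun x : H × Y => ((1 : H), op x.1⁻¹ • 𝒢.r x.2))
          (map (fun z : Y => (t, op t • z)) (𝓝 (op t⁻¹ • y)))
            = pure 1 ×ˢ map 𝒢.r (𝓝 (op t⁻¹ • y)) := by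
        rw [map_map, pure_prod, map_map]
        congr 1
        funext z
        simp [hH.r_smul]
      rw [rightSemidirectGroupoid_units_eq hH, nhdsWithin_prod_eq, nhdsWithin_singleton,
        ← hH.r_smul]
      refine le_trans ?_ (map_mono hcont)
      rw [hmap]
      exact Filter.prod_mono le_rfl (h.nhdsWithin_units_le_map_r _) }

/-- In this convention it is the range of `(t, y)` that is translated by `t⁻¹`, so the left
coefficient algebra uses `g = op t⁻¹` and the right one `g = 1`. -/
theorem isFibreStarIso_rightSemidirect (h : IsLCGroupoid 𝒢) (hF : IsFellBundle 𝒢 F)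
    (hH : ActsByFellAut Hᵐᵒᵖ 𝒢 F) {u : Y} (hu : u ∈ 𝒢.units) (g : Hᵐᵒᵖ) :
    IsFibreStarIso F u (rightSemidirectFell F fun (h : H) (b : B) => op h • b) (1, g • u)
      (fun b => (1, g • b)) where
  map_p a ha := Prod.ext rfl ((hH.p_smul g a).trans (congrArg (g • ·) ha))
  surj := by
    rintro ⟨t, a⟩ ha
    obtain ⟨rfl, hu⟩ : t = 1 ∧ F.p a = g • u := Prod.mk.inj ha
    exact ⟨g⁻¹ • a, by rw [hH.p_smul, hu, inv_smul_smul], by simp⟩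
  map_zero := Prod.ext rfl (hH.zero_smul g u).symm
  map_add a b ha hb := Prod.ext rfl (hH.add_smul g a b (ha.trans hb.symm)).symm
  map_smul c a _ := Prod.ext rfl (hH.smul_smul g c a).symm
  map_norm a _ := hH.norm_smul g a
  p_mul _ _ ha hb := hF.p_mul_of_mem h hu ha hb
  p_star _ ha := hF.p_star_of_mem h hu ha
  map_mul a b ha hb := by
    have hab : 𝒢.s (F.p a) = 𝒢.r (F.p b) := by rw [ha, hb, h.s_of_mem hu, h.r_of_mem hu]
    simp [rightSemidirectFell, hH.mul_smul g _ _ hab]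
  map_star a _ := by simp [rightSemidirectFell, hH.star_smul]

theorem rightSemidirectFell_s_eq_r_iff (hH : ActsByFellAut Hᵐᵒᵖ 𝒢 F) {a b : H × B} :
    (rightSemidirectGroupoid 𝒢 fun (h : H) (y : Y) => op h • y).s
        ((rightSemidirectFell F fun (h : H) (b : B) => op h • b).p a)
      = (rightSemidirectGroupoid 𝒢 fun (h : H) (y : Y) => op h • y).r
        ((rightSemidirectFell F fun (h : H) (b : B) => op h • b).p b) ↔
    𝒢.s (F.p (op b.1 • a.2)) = 𝒢.r (F.p b.2) := by
  rw [rightSemidirectGroupoid_s_eq_r_iff hH.base, hH.p_smul]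
  rfl

theorem isFellBundle_rightSemidirect [IsTopologicalGroup H] [LocallyCompactSpace H]
    [SecondCountableTopology H] (h : IsLCGroupoid 𝒢) (hF : IsFellBundle 𝒢 F)
    (hH : ActsByFellAut Hᵐᵒᵖ 𝒢 F) :
    IsFellBundle (rightSemidirectGroupoid 𝒢 fun (h : H) (y : Y) => op h • y)
      (rightSemidirectFell F fun (h : H) (b : B) => op h • b) := by
  have := h.t2
  have := h.locallyCompact
  have := h.secondCountable
  have : ContinuousSMul Hᵐᵒᵖ B := ⟨hH.continuous_smul⟩
  have hc := hF.continuous_star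
  have hiff := fun a b => rightSemidirectFell_s_eq_r_iff (a := a) (b := b) hH
  exact
  -- As a Banach bundle this is the product `B × G` with the factors exchanged; the action plays no
  -- role.
  { toIsBanachBundle :=
      (isBanachBundle_semidirect (G := H) (actA := fun _ b => b) hF.toIsBanachBundle).transport
        (Homeomorph.prodComm H Y) (Homeomorph.prodComm H B) (fun _ => rfl) (fun _ => rfl)
        (fun _ _ => rfl) (fun _ _ => rfl) fun _ => rfl
    p_mul := fun a b hab => by
      rw [hiff] at hab
      simp [rightSemidirectFell, rightSemidirectGroupoid, hF.p_mul _ _ hab, hH.p_smul]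
    p_star := fun a => by
      simp [rightSemidirectFell, rightSemidirectGroupoid, hF.p_star, hH.p_smul]
    mul_assoc := fun a b c hab hbc => by
      rw [hiff] at hab hbc
      have hab' : 𝒢.s (F.p (op (b.1 * c.1) • a.2)) = 𝒢.r (F.p (op c.1 • b.2)) := by
        rw [op_mul, mul_smul, hH.s_p_smul, hab, hH.r_p_smul]
      simp only [rightSemidirectFell, Prod.mk.injEq, mul_assoc, true_and]
      rw [← hF.mul_assoc _ _ _ hab' hbc, ← hH.mul_smul _ _ _ hab, op_mul, mul_smul]
    add_mul := fun a a' b haa hab => by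
      rw [hiff] at hab
      simp only [rightSemidirectFell, Prod.mk.injEq, true_and] at haa ⊢
      rw [← hH.add_smul _ _ _ haa.2, hF.add_mul _ _ _ _ hab]
      rw [hH.p_smul, hH.p_smul, haa.2]
    mul_add := fun a b b' hbb hab => by
      rw [hiff] at hab
      simp only [rightSemidirectFell, Prod.mk.injEq, true_and] at hbb ⊢
      rw [← hbb.1, hF.mul_add _ _ _ hbb.2 hab]
    smul_mul := fun c a b hab => by
      rw [hiff] at hab
      simp [rightSemidirectFell, ← hH.smul_smul, hF.smul_mul _ _ _ hab]
    mul_smul' := fun c a b hab => by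
      rw [hiff] at hab
      simp [rightSemidirectFell, hF.mul_smul' _ _ _ hab]
    star_star := fun a => by simp [rightSemidirectFell, hH.star_smul, hF.star_star]
    star_add := fun a b hab => by
      simp only [rightSemidirectFell, Prod.mk.injEq, true_and] at hab ⊢
      rw [hF.star_add _ _ hab.2, ← hab.1, hH.add_smul]
      rw [hF.p_star, hF.p_star, hab.2]
    star_smul := fun c a => by simp [rightSemidirectFell, hF.star_smul, hH.smul_smul]
    star_mul := fun a b hab => by
      rw [hiff] at hab
      have hab' : 𝒢.s (F.p (F.star b.2)) = 𝒢.r (F.p (F.star (op b.1 • a.2))) := by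
        rw [hF.p_star, hF.p_star, h.s_inv, h.r_inv, hab]
      simp only [rightSemidirectFell, Prod.mk.injEq, mul_inv_rev, true_and]
      rw [hF.star_mul _ _ hab, ← hH.mul_smul _ _ _ hab', hH.star_smul, op_mul, mul_smul, mul_smul,
        op_inv b.1, inv_smul_smul]
    continuousOn_mul := by
      have h1 : ContinuousOn (fun q : (H × B) × (H × B) => F.mul (op q.2.1 • q.1.2) q.2.2)
          {q | 𝒢.s (F.p (op q.2.1 • q.1.2)) = 𝒢.r (F.p q.2.2)} :=
        hF.continuousOn_mul.comp (f := fun q : (H × B) × (H × B) => (op q.2.1 • q.1.2, q.2.2))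
          (by fun_prop) fun q hq => hq
      refine ContinuousOn.prodMk ?_ (h1.mono fun q hq => (hiff _ _).1 hq)
      fun_prop
    continuous_star := by
      simp only [rightSemidirectFell]
      fun_prop
    norm_mul_le := by
      rw [rightSemidirectGroupoid_units_eq hH.base]
      rintro ⟨_, u⟩ ⟨rfl, hu⟩ ⟨s, a⟩ ⟨t, b⟩ has hbt
      obtain ⟨rfl, ha⟩ : s = 1 ∧ F.p a = u := Prod.mk.inj has
      obtain ⟨rfl, hb⟩ : t = 1 ∧ F.p b = u := Prod.mk.inj hbt
      simpa [rightSemidirectFell] using hF.norm_mul_le u hu a b ha hb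
    norm_star_mul_self := by
      rw [rightSemidirectGroupoid_units_eq hH.base]
      rintro ⟨_, u⟩ ⟨rfl, hu⟩ ⟨s, a⟩ has
      obtain ⟨rfl, ha⟩ : s = 1 ∧ F.p a = u := Prod.mk.inj has
      simpa [rightSemidirectFell] using hF.norm_star_mul_self u hu a ha
    imprimitivity := by
      rintro ⟨t, y⟩
      have h1 := isFibreStarIso_rightSemidirect h hF hH (h.s_mem y) 1
      simp only [one_smul] at h1
      refine (hF.imprimitivity y).transport hF.toIsBanachBundle hF.toIsBanachBundle
        hF.toIsBanachBundle (isFibreStarIso_rightSemidirect h hF hH ⟨y, rfl⟩ (op t⁻¹)) h1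
        (isFibreIso_rightSemidirect_prod y t) ?_ ?_ ?_ ?_
      · intro a e ha he
        simp [rightSemidirectFell]
      · intro e b he hb
        simp [rightSemidirectFell]
      · intro e f he hf
        have hef : 𝒢.s (F.p e) = 𝒢.r (F.p (F.star f)) := by rw [hF.p_star, he, hf, h.r_inv]
        simp [rightSemidirectFell, hH.mul_smul _ _ _ hef]
      · intro e f he hf
        simp [rightSemidirectFell] }

end RightSemidirect

/-! ### Norms of products -/

section Norm

variable {X A : Type*} [TopologicalSpace X] [TopologicalSpace A] {𝒢 : GroupoidData X}
  {F : FellData X A}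

namespace IsFellBundle

/-- The left inner square of `a` and the right inner square of `a*` are the same element `a a*`. -/
theorem norm_star (hF : IsFellBundle 𝒢 F) (a : A) : F.norm (F.star a) = F.norm a := by
  have h1 := (hF.imprimitivity (F.p a)).norm_li_self a rfl
  have h2 := (hF.imprimitivity (F.p (F.star a))).norm_ri_self (F.star a) rfl
  rw [hF.star_star] at h2
  exact (pow_left_inj₀ (hF.norm_nonneg _) (hF.norm_nonneg _) two_ne_zero).1 (h2.symm.trans h1)

/-- By the C*-identity `‖a d‖² = ‖d* (a* a) d‖`, and the right side is a product in the C*-algebra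
over the source of `a`. -/
theorem norm_mul_le_of_unit (hF : IsFellBundle 𝒢 F) (h : IsLCGroupoid 𝒢) {a d : A}
    (hd : F.p d = 𝒢.s (F.p a)) : F.norm (F.mul a d) ≤ F.norm a * F.norm d := by
  have hu : 𝒢.s (F.p a) ∈ 𝒢.units := h.s_mem _
  have had : 𝒢.s (F.p a) = 𝒢.r (F.p d) := by rw [hd, h.r_s]
  have hsd : F.p (F.star d) = 𝒢.s (F.p a) := hF.p_star_of_mem h hu hd
  have hsa : 𝒢.s (F.p (F.star a)) = 𝒢.r (F.p a) := by rw [hF.p_star, h.s_inv]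
  have hds : 𝒢.s (F.p (F.star d)) = 𝒢.r (F.p (F.star a)) := by
    rw [hsd, hF.p_star, h.r_inv, h.s_s]
  have haa : F.p (F.mul (F.star a) a) = 𝒢.s (F.p a) := by
    rw [hF.p_mul _ _ hsa, hF.p_star, h.inv_mul]
  have hkey : F.mul (F.star (F.mul a d)) (F.mul a d)
      = F.mul (F.star d) (F.mul (F.mul (F.star a) a) d) := by
    rw [hF.star_mul _ _ had, hF.mul_assoc _ _ _ hds, hF.mul_assoc _ _ _ hsa had]
    rw [hF.p_mul _ _ had, h.r_mul _ _ had, hsa]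
  have h1 := (hF.imprimitivity (F.p (F.mul a d))).norm_ri_self _ rfl
  have h2 := hF.norm_mul_le _ hu _ _ hsd (hF.p_mul_of_mem h hu haa hd)
  have h3 := hF.norm_mul_le _ hu _ _ haa hd
  have h4 := (hF.imprimitivity (F.p a)).norm_ri_self a rfl
  rw [hF.norm_star, ← hkey, h1] at h2
  rw [h4] at h3
  refine le_of_sq_le_sq ?_ (mul_nonneg (hF.norm_nonneg _) (hF.norm_nonneg _))
  calc F.norm (F.mul a d) ^ 2 ≤ F.norm d * F.norm (F.mul (F.mul (F.star a) a) d) := h2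
    _ ≤ F.norm d * (F.norm a ^ 2 * F.norm d) := by
        gcongr
        exact hF.norm_nonneg _
    _ = (F.norm a * F.norm d) ^ 2 := by ring

/-- The norm of a Fell bundle is submultiplicative. -/
theorem norm_mul_le_mul_norm (hF : IsFellBundle 𝒢 F) (h : IsLCGroupoid 𝒢) {a b : A}
    (hab : 𝒢.s (F.p a) = 𝒢.r (F.p b)) : F.norm (F.mul a b) ≤ F.norm a * F.norm b := by
  -- Positivity replaces `b` by an element `c` of a unit fibre with `b b* = c* c`. Then `(a b)(a b)*
  -- = (a c*)(a c*)*`, so `‖a b‖ = ‖a c*‖` and `‖b‖ = ‖c‖`, and the case of a unit fibre applies.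
  obtain ⟨c, hc, hbc⟩ := (hF.imprimitivity (F.p b)).li_self_nonneg b rfl
  have hu : 𝒢.s (F.p a) ∈ 𝒢.units := h.s_mem _
  rw [← hab] at hc
  have hsc : F.p (F.star c) = 𝒢.s (F.p a) := hF.p_star_of_mem h hu hc
  have hsc' : 𝒢.s (F.p (F.star c)) = 𝒢.r (F.p c) := by rw [hsc, hc, h.s_s, h.r_s]
  have hac : 𝒢.s (F.p a) = 𝒢.r (F.p (F.star c)) := by rw [hsc, h.r_s]
  have hca : 𝒢.s (F.p c) = 𝒢.r (F.p (F.star a)) := by rw [hc, hF.p_star, h.r_inv, h.s_s]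
  have hba : 𝒢.s (F.p (F.star b)) = 𝒢.r (F.p (F.star a)) := by
    rw [hF.p_star, hF.p_star, h.s_inv, h.r_inv, hab]
  have hbb : 𝒢.s (F.p b) = 𝒢.r (F.p (F.star b)) := by rw [hF.p_star, h.r_inv]
  have hkey : F.mul (F.mul a b) (F.star (F.mul a b))
      = F.mul (F.mul a (F.star c)) (F.star (F.mul a (F.star c))) := by
    rw [hF.star_mul _ _ hab, hF.star_mul _ _ hac, hF.star_star,
      hF.mul_assoc a b _ hab, hF.mul_assoc a _ _ hac, ← hF.mul_assoc b _ _ hbb hba, hbc,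
      hF.mul_assoc _ _ _ hsc' hca]
    · rw [hF.p_mul _ _ hca, h.r_mul _ _ hca, hsc']
    · rw [hF.p_mul _ _ hba, h.r_mul _ _ hba, hbb]
  have h1 := (hF.imprimitivity (F.p (F.mul a b))).norm_li_self _ rfl
  have h2 := (hF.imprimitivity (F.p (F.mul a (F.star c)))).norm_li_self _ rfl
  have h3 := (hF.imprimitivity (F.p b)).norm_li_self b rfl
  have h4 := hF.norm_star_mul_self _ hu c hc
  have h5 := hF.norm_mul_le_of_unit h hsc
  rw [hF.norm_star] at h5
  rw [hbc, h4] at h3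
  rw [hkey, h2] at h1
  have e1 := (pow_left_inj₀ (hF.norm_nonneg _) (hF.norm_nonneg _) two_ne_zero).1 h1
  have e3 := (pow_left_inj₀ (hF.norm_nonneg _) (hF.norm_nonneg _) two_ne_zero).1 h3
  rw [← e1, ← e3]
  exact h5

end IsFellBundle

end Norm

/-! ### The action on an orbit bundle induced by a commuting action -/

section Commuting

variable {L K X A : Type*} [Group L] [Group K] [MulAction L X] [MulAction K X] [MulAction L A]
  [MulAction K A] [SMulCommClass L K X] [SMulCommClass L K A]

/-- The action on an orbit space induced by a commuting action. -/
@[reducible] def orbitMulAction (L K X : Type*) [Group L] [Group K] [MulAction L X]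
    [MulAction K X] [SMulCommClass L K X] : MulAction L (Orbits K X) where
  smul l := orbitMap (fun x => l • x) fun k x => smul_comm l k x
  one_smul P := by
    obtain ⟨x, rfl⟩ := orb_surjective P
    exact congrArg (orb K) (one_smul L x)
  mul_smul l m P := by
    obtain ⟨x, rfl⟩ := orb_surjective P
    exact congrArg (orb K) (mul_smul l m x)

variable [TopologicalSpace L] [TopologicalSpace K] [TopologicalSpace X] [TopologicalSpace A]
  {𝒢 : GroupoidData X} {F : FellData X A}

theorem continuous_orbitMulAction (hL : Continuous fun q : L × X => q.1 • q.2)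
    (hK : Continuous fun q : K × X => q.1 • q.2) :
    let _ := orbitMulAction L K X
    Continuous fun q : L × Orbits K X => q.1 • q.2 := by
  intro _
  have hπ := isOpenQuotientMap_orb hK
  rw [← (IsOpenQuotientMap.id.prodMap hπ).continuous_comp_iff]
  exact hπ.continuous.comp hL

/-- Stated symmetrically in the two groups, since it serves both for `G` acting on `A/H` and for
`Hᵐᵒᵖ` acting on `G\A`. -/
theorem actsByFellAut_orbit (hL : ActsByFellAut L 𝒢 F) (hK : ActsByFellAut K 𝒢 F)
    (hfp : IsFreeProper K X) :
    let _ := orbitMulAction L K X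
    let _ := orbitMulAction L K A
    ActsByFellAut L (orbitGroupoid 𝒢 hK.base) (orbitFell 𝒢 F hK) := by
  intro _ _
  have hX : ∀ (l : L) (x : X), l • orb K x = orb K (l • x) := fun _ _ => rfl
  have hA : ∀ (l : L) (a : A), l • orb K a = orb K (l • a) := fun _ _ => rfl
  exact
  { base :=
    { continuous_smul := continuous_orbitMulAction hL.base.continuous_smul hK.base.continuous_smul
      r_smul := fun l P => by
        obtain ⟨x, rfl⟩ := orb_surjective P
        exact congrArg (orb K) (hL.base.r_smul l x)
      s_smul := fun l P => by
        obtain ⟨x, rfl⟩ := orb_surjective P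
        exact congrArg (orb K) (hL.base.s_smul l x)
      inv_smul := fun l P => by
        obtain ⟨x, rfl⟩ := orb_surjective P
        exact congrArg (orb K) (hL.base.inv_smul l x)
      mul_smul := fun l P Q hPQ => by
        obtain ⟨x, rfl⟩ := orb_surjective P
        obtain ⟨y, rfl, hxy⟩ := exists_orb_r_eq hK.base hPQ
        rw [orbitGroupoid_mul_orb hK.base hfp hxy, hX, hX, hX, orbitGroupoid_mul_orb hK.base hfp,
          hL.base.mul_smul _ _ _ hxy]
        rw [hL.base.s_smul, hL.base.r_smul, hxy] }
    continuous_smul := continuous_orbitMulAction hL.continuous_smul hK.continuous_smul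
    p_smul := fun l P => by
      obtain ⟨a, rfl⟩ := orb_surjective P
      exact congrArg (orb K) (hL.p_smul l a)
    add_smul := fun l P Q hPQ => by
      obtain ⟨a, b, rfl, rfl, hab⟩ := exists_orb_p_eq_p hK hPQ
      rw [orbitFell_add_orb hK hfp hab, hA, hA, hA, orbitFell_add_orb hK hfp,
        hL.add_smul _ _ _ hab]
      rw [hL.p_smul, hL.p_smul, hab]
    zero_smul := fun l P => by
      obtain ⟨x, rfl⟩ := orb_surjective P
      exact congrArg (orb K) (hL.zero_smul l x)
    smul_smul := fun l c P => by
      obtain ⟨a, rfl⟩ := orb_surjective P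
      exact congrArg (orb K) (hL.smul_smul l c a)
    norm_smul := fun l P => by
      obtain ⟨a, rfl⟩ := orb_surjective P
      exact hL.norm_smul l a
    mul_smul := fun l P Q hPQ => by
      obtain ⟨a, b, rfl, rfl, hab⟩ := exists_orb_composable hK hPQ
      rw [orbitFell_mul_orb hK hfp hab, hA, hA, hA, orbitFell_mul_orb hK hfp,
        hL.mul_smul _ _ _ hab]
      rw [hL.s_p_smul, hL.r_p_smul, hab]
    star_smul := fun l P => by
      obtain ⟨a, rfl⟩ := orb_surjective P
      exact congrArg (orb K) (hL.star_smul l a) }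

end Commuting

/-! ### Composition of fibre isomorphisms -/

section FibreIsoComp

theorem IsFibreIso.comp {X E X' E' X'' E'' : Type*} {B : BundleData X E} {x : X}
    {B' : BundleData X' E'} {x' : X'} {B'' : BundleData X'' E''} {x'' : X''} {φ : E → E'}
    {ψ : E' → E''} (hψ : IsFibreIso B' x' B'' x'' ψ) (hφ : IsFibreIso B x B' x' φ) :
    IsFibreIso B x B'' x'' (ψ ∘ φ) where
  map_p a ha := hψ.map_p _ (hφ.map_p a ha)
  surj a'' ha'' := by
    obtain ⟨a', ha', rfl⟩ := hψ.surj a'' ha''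
    obtain ⟨a, ha, rfl⟩ := hφ.surj a' ha'
    exact ⟨a, ha, rfl⟩
  map_zero := (congrArg ψ hφ.map_zero).trans hψ.map_zero
  map_add a b ha hb :=
    (congrArg ψ (hφ.map_add a b ha hb)).trans (hψ.map_add _ _ (hφ.map_p a ha) (hφ.map_p b hb))
  map_smul c a ha := (congrArg ψ (hφ.map_smul c a ha)).trans (hψ.map_smul _ _ (hφ.map_p a ha))
  map_norm a ha := (hψ.map_norm _ (hφ.map_p a ha)).trans (hφ.map_norm a ha)

theorem IsFibreStarIso.comp {X A X' A' X'' A'' : Type*} {F : FellData X A} {u : X}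
    {F' : FellData X' A'} {u' : X'} {F'' : FellData X'' A''} {u'' : X''} {φ : A → A'}
    {ψ : A' → A''} (hψ : IsFibreStarIso F' u' F'' u'' ψ) (hφ : IsFibreStarIso F u F' u' φ) :
    IsFibreStarIso F u F'' u'' (ψ ∘ φ) where
  toIsFibreIso := hψ.toIsFibreIso.comp hφ.toIsFibreIso
  p_mul := hφ.p_mul
  p_star := hφ.p_star
  map_mul a b ha hb :=
    (congrArg ψ (hφ.map_mul a b ha hb)).trans (hψ.map_mul _ _ (hφ.map_p a ha) (hφ.map_p b hb))
  map_star a ha := (congrArg ψ (hφ.map_star a ha)).trans (hψ.map_star _ (hφ.map_p a ha))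

end FibreIsoComp

/-! ### The equivalence of groupoids -/

/-- The map is a homeomorphism of `S` onto the closed set `R`, hence a closed embedding. For an
action map, `R` consists of the pairs lying in one orbit and `g` recovers the arrow. -/
theorem isProperMap_of_inverse {α β : Type*} [TopologicalSpace α] [TopologicalSpace β]
    {S : Set α} {R : Set β} (hR : IsClosed R) {f : α → β} {g : β → α} (hf : ContinuousOn f S)
    (hg : ContinuousOn g R) (hfm : MapsTo f S R) (hgm : MapsTo g R S)
    (hgf : ∀ a ∈ S, g (f a) = a) (hfg : ∀ b ∈ R, f (g b) = b) :
    IsProperMap fun a : S => f a := by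
  let e : S ≃ₜ R :=
  { toFun := hfm.restrict f S R
    invFun := hgm.restrict g R S
    left_inv := fun a => Subtype.ext (hgf a.1 a.2)
    right_inv := fun b => Subtype.ext (hfg b.1 b.2)
    continuous_toFun := hf.mapsToRestrict hfm
    continuous_invFun := hg.mapsToRestrict hgm }
  exact hR.isClosedEmbedding_subtypeVal.isProperMap.comp e.isProperMap

section Equivalence

set_option linter.unusedSectionVars false

variable {G H X A : Type*} [Group G] [Group H] [MulAction G X] [MulAction Hᵐᵒᵖ X] [MulAction G A]
  [MulAction Hᵐᵒᵖ A]

/-- The anchor of the left action on `X`. -/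
def leftAnchor (G H : Type*) {X : Type*} [Group G] [Group H] [MulAction Hᵐᵒᵖ X]
    (𝒢 : GroupoidData X) (x : X) : Orbits Hᵐᵒᵖ X × G :=
  (orb Hᵐᵒᵖ (𝒢.r x), 1)

/-- The left action `(x · H, t) · y = x (t · y)`. -/
def leftAct (𝒢 : GroupoidData X) (q : Orbits Hᵐᵒᵖ X × G) (y : X) : X :=
  𝒢.mul (rep 𝒢.s q.1 (𝒢.r (q.2 • y))) (q.2 • y)

/-- The anchor of the right action on `X`. -/
def rightAnchor (G H : Type*) {X : Type*} [Group G] [Group H] [MulAction G X]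
    (𝒢 : GroupoidData X) (x : X) : H × Orbits G X :=
  (1, orb G (𝒢.s x))

/-- The right action `x · (h, G · y) = (x · h) y`. -/
def rightAct (𝒢 : GroupoidData X) (x : X) (q : H × Orbits G X) : X :=
  𝒢.mul (op q.1 • x) (rep 𝒢.r q.2 (𝒢.s (op q.1 • x)))

variable [SMulCommClass G Hᵐᵒᵖ X] [SMulCommClass G Hᵐᵒᵖ A]

@[simp] theorem leftOrbitAct_orb (g : G) (x : X) :
    leftOrbitAct g (orb Hᵐᵒᵖ x) = orb Hᵐᵒᵖ (g • x) := rfl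

@[simp] theorem rightOrbitAct_orb (h : H) (x : X) :
    rightOrbitAct h (orb G x) = orb G (op h • x) := rfl

variable [TopologicalSpace G] [TopologicalSpace H] [TopologicalSpace X] {𝒢 : GroupoidData X}

/-- The groupoid `X/H ⋊ G`. -/
abbrev leftGroupoid (G : Type*) {H X : Type*} [Group G] [Group H] [MulAction G X]
    [MulAction Hᵐᵒᵖ X] [SMulCommClass G Hᵐᵒᵖ X] [TopologicalSpace H] [TopologicalSpace X]
    {𝒢 : GroupoidData X} (hH : ActsByGroupoidAut Hᵐᵒᵖ 𝒢) : GroupoidData (Orbits Hᵐᵒᵖ X × G) :=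
  semidirectGroupoid (orbitGroupoid 𝒢 hH) leftOrbitAct

/-- The groupoid `H ⋉ G\X`. -/
abbrev rightGroupoid (H : Type*) {G X : Type*} [Group G] [Group H] [MulAction G X]
    [MulAction Hᵐᵒᵖ X] [SMulCommClass G Hᵐᵒᵖ X] [TopologicalSpace G] [TopologicalSpace X]
    {𝒢 : GroupoidData X} (hG : ActsByGroupoidAut G 𝒢) : GroupoidData (H × Orbits G X) :=
  rightSemidirectGroupoid (orbitGroupoid 𝒢 hG) rightOrbitAct

theorem leftGroupoid_s_eq_iff (hG : ActsByGroupoidAut G 𝒢) (hH : ActsByGroupoidAut Hᵐᵒᵖ 𝒢)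
    {x : X} {t : G} {y : X} :
    (leftGroupoid G hH).s (orb Hᵐᵒᵖ x, t) = leftAnchor G H 𝒢 y ↔
      orb Hᵐᵒᵖ (𝒢.s x) = orb Hᵐᵒᵖ (𝒢.r (t • y)) := by
  simp only [semidirectGroupoid, leftAnchor, Prod.mk.injEq, and_true, orbitGroupoid_s_orb,
    leftOrbitAct_orb, orb_eq_iff, hG.r_smul]
  refine exists_congr fun k => ?_
  rw [← smul_comm t k, eq_inv_smul_iff]

/-- The hypothesis compares orbits only. Translating the representative by `Hᵐᵒᵖ` makes it strictly
composable with `q.2 • y`, after which statements about the action become statements about products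
in `X`. -/
theorem exists_of_leftGroupoid_s_eq (hG : ActsByGroupoidAut G 𝒢)
    (hH : ActsByGroupoidAut Hᵐᵒᵖ 𝒢) {q : Orbits Hᵐᵒᵖ X × G} {y : X}
    (h : (leftGroupoid G hH).s q = leftAnchor G H 𝒢 y) :
    ∃ x, q = (orb Hᵐᵒᵖ x, q.2) ∧ 𝒢.s x = 𝒢.r (q.2 • y) := by
  obtain ⟨P, t⟩ := q
  obtain ⟨x, rfl⟩ := orb_surjective P
  have h' : (orbitGroupoid 𝒢 hH).s (orb Hᵐᵒᵖ x) = orb Hᵐᵒᵖ (𝒢.r (t • y)) :=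
    (leftGroupoid_s_eq_iff hG hH).1 h
  obtain ⟨x', hx', hs⟩ := exists_orb_s_eq hH h'
  exact ⟨x', by rw [hx'], hs⟩

theorem rightGroupoid_r_eq_iff (hG : ActsByGroupoidAut G 𝒢) (hH : ActsByGroupoidAut Hᵐᵒᵖ 𝒢)
    {x : X} {h : H} {y : X} :
    rightAnchor G H 𝒢 x = (rightGroupoid H hG).r (h, orb G y) ↔
      orb G (𝒢.s (op h • x)) = orb G (𝒢.r y) := by
  simp only [rightSemidirectGroupoid, rightAnchor, Prod.mk.injEq, true_and, orbitGroupoid_r_orb,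
    rightOrbitAct_orb, orb_eq_iff, hH.s_smul, op_inv]
  refine exists_congr fun k => ?_
  rw [smul_comm k, inv_smul_eq_iff]

theorem exists_of_rightGroupoid_r_eq (hG : ActsByGroupoidAut G 𝒢)
    (hH : ActsByGroupoidAut Hᵐᵒᵖ 𝒢) {q : H × Orbits G X} {x : X}
    (h : rightAnchor G H 𝒢 x = (rightGroupoid H hG).r q) :
    ∃ y, q = (q.1, orb G y) ∧ 𝒢.s (op q.1 • x) = 𝒢.r y := by
  obtain ⟨h', P⟩ := q
  obtain ⟨y, rfl⟩ := orb_surjective P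
  have hy : orb G (𝒢.s (op h' • x)) = (orbitGroupoid 𝒢 hG).r (orb G y) :=
    (rightGroupoid_r_eq_iff hG hH).1 h
  obtain ⟨y', hy', hs⟩ := exists_orb_r_eq hG hy
  exact ⟨y', by rw [hy'], hs⟩

theorem leftAct_orb (hH : ActsByGroupoidAut Hᵐᵒᵖ 𝒢) (hHfp : IsFreeProper Hᵐᵒᵖ X) {x : X} {t : G}
    {y : X} (h : 𝒢.s x = 𝒢.r (t • y)) : leftAct 𝒢 (orb Hᵐᵒᵖ x, t) y = 𝒢.mul x (t • y) := by
  rw [leftAct, rep_orb hHfp hH.s_smul h]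

theorem rightAct_orb (hG : ActsByGroupoidAut G 𝒢) (hGfp : IsFreeProper G X) {x : X} {h : H}
    {y : X} (hxy : 𝒢.s (op h • x) = 𝒢.r y) :
    rightAct 𝒢 x (h, orb G y) = 𝒢.mul (op h • x) y := by
  rw [rightAct, rep_orb hGfp hG.r_smul hxy.symm]

theorem leftGroupoid_mul_orb (hH : ActsByGroupoidAut Hᵐᵒᵖ 𝒢)
    (hHfp : IsFreeProper Hᵐᵒᵖ X) {x y : X} {t t' : G} (h : 𝒢.s x = 𝒢.r (t • y)) :
    (leftGroupoid G hH).mul (orb Hᵐᵒᵖ x, t) (orb Hᵐᵒᵖ y, t')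
      = (orb Hᵐᵒᵖ (𝒢.mul x (t • y)), t * t') :=
  Prod.ext (orbitGroupoid_mul_orb hH hHfp h) rfl

theorem rightGroupoid_mul_orb (hG : ActsByGroupoidAut G 𝒢) (hGfp : IsFreeProper G X) {x y : X}
    {h h' : H} (hxy : 𝒢.s (op h' • x) = 𝒢.r y) :
    (rightGroupoid H hG).mul (h, orb G x) (h', orb G y)
      = (h * h', orb G (𝒢.mul (op h' • x) y)) :=
  Prod.ext rfl (orbitGroupoid_mul_orb hG hGfp hxy)

theorem leftGroupoid_units (hH : ActsByGroupoidAut Hᵐᵒᵖ 𝒢) :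
    (leftGroupoid G hH).units = (orb Hᵐᵒᵖ '' 𝒢.units) ×ˢ {1} := by
  let _ := orbitMulAction G Hᵐᵒᵖ X
  rw [← orbitGroupoid_units hH]
  exact semidirectGroupoid_units (G := G) (𝒢 := orbitGroupoid 𝒢 hH)

theorem rightGroupoid_units (hG : ActsByGroupoidAut G 𝒢) (hH : ActsByGroupoidAut Hᵐᵒᵖ 𝒢) :
    (rightGroupoid H hG).units = {1} ×ˢ (orb G '' 𝒢.units) := by
  ext ⟨h, P⟩
  constructor
  · rintro ⟨⟨h', Q⟩, hQ⟩
    obtain ⟨x, rfl⟩ := orb_surjective Q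
    obtain ⟨rfl, rfl⟩ : 1 = h ∧ orb G (op h'⁻¹ • 𝒢.r x) = P := Prod.mk.inj hQ
    exact ⟨rfl, _, ⟨_, hH.r_smul _ _⟩, rfl⟩
  · rintro ⟨rfl, _, ⟨x, rfl⟩, rfl⟩
    exact ⟨(1, orb G x), by simp [rightSemidirectGroupoid]⟩

theorem isLeftAction_leftAct (h𝒢 : IsLCGroupoid 𝒢) (hG : ActsByGroupoidAut G 𝒢)
    (hH : ActsByGroupoidAut Hᵐᵒᵖ 𝒢) (hHfp : IsFreeProper Hᵐᵒᵖ X) :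
    IsLeftAction (leftGroupoid G hH) (leftAnchor G H 𝒢) (leftAct 𝒢) where
  anchor_mem x := by
    rw [leftGroupoid_units]
    exact ⟨⟨_, ⟨x, rfl⟩, rfl⟩, rfl⟩
  continuous_anchor := ((isOpenQuotientMap_orb hH.continuous_smul).continuous.comp
    h𝒢.continuous_r).prodMk continuous_const
  isOpenMap_anchor := by
    rw [isOpenMap_codRestrict_iff]
    intro x
    rw [leftGroupoid_units, leftAnchor, nhdsWithin_prod_eq, nhdsWithin_singleton]
    have : map (leftAnchor G H 𝒢) (𝓝 x) = map (orb Hᵐᵒᵖ) (map 𝒢.r (𝓝 x)) ×ˢ pure 1 := by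
      rw [prod_pure, map_map, map_map]
      rfl
    rw [this]
    refine Filter.prod_mono ?_ le_rfl
    exact (nhdsWithin_orb_le hH.continuous_smul hH.smul_mem_units _).trans
      (map_mono (h𝒢.nhdsWithin_units_le_map_r x))
  anchor_act q y hq := by
    obtain ⟨x, hx, hxy⟩ := exists_of_leftGroupoid_s_eq hG hH hq
    rw [hx, leftAct_orb hH hHfp hxy, leftAnchor, h𝒢.r_mul _ _ hxy]
    rfl
  mul_act q₁ q₂ z h₁ h₂ := by
    obtain ⟨y, hy, hyz⟩ := exists_of_leftGroupoid_s_eq hG hH h₂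
    rw [hy] at h₁ ⊢
    obtain ⟨x, hx, hxy⟩ := exists_of_leftGroupoid_s_eq hG hH (y := y) h₁
    -- Both sides of the identity are bracketings of `x (t₁ · y) (t₁ · t₂ · z)`, with `tᵢ` the group
    -- coordinate of `qᵢ`.
    have hyz' : 𝒢.s (q₁.2 • y) = 𝒢.r (q₁.2 • q₂.2 • z) := by
      rw [hG.s_smul, hyz, ← hG.r_smul]
    rw [hx, leftGroupoid_mul_orb hH hHfp hxy, leftAct_orb hH hHfp, leftAct_orb hH hHfp hyz,
      leftAct_orb hH hHfp, ← hG.mul_smul _ _ _ hyz, mul_smul, h𝒢.mul_assoc _ _ _ hxy hyz']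
    · rw [hxy, hG.r_smul, hG.r_smul, h𝒢.r_mul _ _ hyz]
    · rw [h𝒢.s_mul _ _ hxy, mul_smul, hyz']
  unit_act x := by
    rw [leftAnchor, leftAct_orb hH hHfp, one_smul, h𝒢.r_mul_self]
    rw [one_smul, h𝒢.s_r]
  continuousOn_act := by
    have : ContinuousSMul G X := ⟨hG.continuous_smul⟩
    have hc := h𝒢.continuous_r
    have h1 : ContinuousOn
        (fun q : (Orbits Hᵐᵒᵖ X × G) × X => rep 𝒢.s q.1.1 (𝒢.r (q.1.2 • q.2)))
        {q | orbitMap 𝒢.s hH.s_smul q.1.1 = orb Hᵐᵒᵖ (𝒢.r (q.1.2 • q.2))} :=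
      (continuousOn_rep hHfp hH.continuous_smul hH.s_smul h𝒢.continuous_s).comp
        (f := fun q : (Orbits Hᵐᵒᵖ X × G) × X => (q.1.1, 𝒢.r (q.1.2 • q.2)))
        (by fun_prop) fun q hq => hq
    refine (h𝒢.continuousOn_mul.comp (h1.prodMk (by fun_prop : ContinuousOn
      (fun q : (Orbits Hᵐᵒᵖ X × G) × X => q.1.2 • q.2) _)) fun q hq => (rep_spec hq).2).mono ?_
    rintro ⟨⟨P, t⟩, y⟩ hq
    obtain ⟨x, hx, hxy⟩ := exists_of_leftGroupoid_s_eq (q := (P, t)) (y := y) hG hH hq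
    obtain rfl := (Prod.mk.inj hx).1
    exact congrArg (orb Hᵐᵒᵖ) hxy

theorem isRightAction_rightAct (h𝒢 : IsLCGroupoid 𝒢) (hG : ActsByGroupoidAut G 𝒢)
    (hH : ActsByGroupoidAut Hᵐᵒᵖ 𝒢) (hGfp : IsFreeProper G X) :
    IsRightAction (rightGroupoid H hG) (rightAnchor G H 𝒢) (rightAct 𝒢) where
  anchor_mem x := by
    rw [rightGroupoid_units hG hH]
    exact ⟨rfl, _, h𝒢.s_mem x, rfl⟩
  continuous_anchor := continuous_const.prodMk
    ((isOpenQuotientMap_orb hG.continuous_smul).continuous.comp h𝒢.continuous_s)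
  isOpenMap_anchor := by
    rw [isOpenMap_codRestrict_iff]
    intro x
    rw [rightGroupoid_units hG hH, rightAnchor, nhdsWithin_prod_eq, nhdsWithin_singleton]
    have : map (rightAnchor G H 𝒢) (𝓝 x) = pure 1 ×ˢ map (orb G) (map 𝒢.s (𝓝 x)) := by
      rw [pure_prod, map_map, map_map]
      rfl
    rw [this]
    refine Filter.prod_mono le_rfl ?_
    exact (nhdsWithin_orb_le hG.continuous_smul hG.smul_mem_units _).trans
      (map_mono (h𝒢.nhdsWithin_units_le_map_s x))
  anchor_act x q hq := by
    obtain ⟨y, hy, hxy⟩ := exists_of_rightGroupoid_r_eq hG hH hq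
    rw [hy, rightAct_orb hG hGfp hxy, rightAnchor, h𝒢.s_mul _ _ hxy]
    rfl
  act_mul x q₁ q₂ h₁ h₂ := by
    obtain ⟨y, hy, hxy⟩ := exists_of_rightGroupoid_r_eq hG hH h₁
    rw [hy] at h₂ ⊢
    obtain ⟨z, hz, hyz⟩ := exists_of_rightGroupoid_r_eq hG hH (x := y) h₂
    have hxy' : 𝒢.s (op q₂.1 • op q₁.1 • x) = 𝒢.r (op q₂.1 • y) := by
      rw [hH.s_smul, hxy, ← hH.r_smul]
    rw [hz, rightGroupoid_mul_orb hG hGfp hyz, rightAct_orb hG hGfp, rightAct_orb hG hGfp hxy,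
      rightAct_orb hG hGfp, ← hH.mul_smul _ _ _ hxy, op_mul, mul_smul,
      h𝒢.mul_assoc _ _ _ hxy' hyz]
    · rw [hH.s_smul, h𝒢.s_mul _ _ hxy, ← hyz, hH.s_smul]
    · rw [h𝒢.r_mul _ _ hyz, op_mul, mul_smul, hxy']
  act_unit x := by
    rw [rightAnchor, rightAct_orb hG hGfp, op_one, one_smul, h𝒢.mul_s_self]
    rw [op_one, one_smul, h𝒢.r_s]
  continuousOn_act := by
    have : ContinuousSMul Hᵐᵒᵖ X := ⟨hH.continuous_smul⟩
    have hc := h𝒢.continuous_s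
    have h1 : ContinuousOn
        (fun q : X × (H × Orbits G X) => rep 𝒢.r q.2.2 (𝒢.s (op q.2.1 • q.1)))
        {q | orbitMap 𝒢.r hG.r_smul q.2.2 = orb G (𝒢.s (op q.2.1 • q.1))} :=
      (continuousOn_rep hGfp hG.continuous_smul hG.r_smul h𝒢.continuous_r).comp
        (f := fun q : X × (H × Orbits G X) => (q.2.2, 𝒢.s (op q.2.1 • q.1)))
        (by fun_prop) fun q hq => hq
    refine (h𝒢.continuousOn_mul.comp (ContinuousOn.prodMk (by fun_prop : ContinuousOn
      (fun q : X × (H × Orbits G X) => op q.2.1 • q.1) _) h1) fun q hq =>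
        (rep_spec hq).2.symm).mono ?_
    rintro ⟨x, ⟨h, P⟩⟩ hq
    obtain ⟨y, hy, hxy⟩ := exists_of_rightGroupoid_r_eq (q := (h, P)) (x := x) hG hH hq
    obtain rfl := (Prod.mk.inj hy).2
    exact congrArg (orb G) hxy.symm

/-- The arrow of `X/H ⋊ G` that takes `y` to `x`. -/
def leftArrow (G H : Type*) {X : Type*} [Group G] [Group H] [MulAction G X] [MulAction Hᵐᵒᵖ X]
    (𝒢 : GroupoidData X) (x y : X) : Orbits Hᵐᵒᵖ X × G :=
  (orb Hᵐᵒᵖ (𝒢.mul x (transl G (𝒢.s y) (𝒢.s x) • 𝒢.inv y)), transl G (𝒢.s y) (𝒢.s x))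

/-- The arrow of `H ⋉ G\X` that takes `x` to `y`. -/
def rightArrow (G H : Type*) {X : Type*} [Group G] [Group H] [MulAction G X] [MulAction Hᵐᵒᵖ X]
    (𝒢 : GroupoidData X) (x y : X) : H × Orbits G X :=
  (unop (transl Hᵐᵒᵖ (𝒢.r x) (𝒢.r y)),
    orb G (𝒢.mul (transl Hᵐᵒᵖ (𝒢.r x) (𝒢.r y) • 𝒢.inv x) y))

/-- With `t` matching the sources, `x (t · y)⁻¹` is defined in `X`, and multiplying it by `t · y`
returns `x`. -/
theorem leftArrow_spec (h𝒢 : IsLCGroupoid 𝒢) (hG : ActsByGroupoidAut G 𝒢)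
    (hH : ActsByGroupoidAut Hᵐᵒᵖ 𝒢) (hHfp : IsFreeProper Hᵐᵒᵖ X) {x y : X}
    (hxy : orb G (𝒢.s x) = orb G (𝒢.s y)) :
    (leftGroupoid G hH).s (leftArrow G H 𝒢 x y) = leftAnchor G H 𝒢 y ∧
      leftAct 𝒢 (leftArrow G H 𝒢 x y) y = x := by
  have ht : transl G (𝒢.s y) (𝒢.s x) • 𝒢.s y = 𝒢.s x := transl_smul hxy.symm
  rw [leftArrow]
  generalize transl G (𝒢.s y) (𝒢.s x) = t at ht
  have h1 : 𝒢.s x = 𝒢.s (t • y) := by rw [hG.s_smul, ht]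
  have h2 : 𝒢.s (𝒢.mul x (𝒢.inv (t • y))) = 𝒢.r (t • y) := by
    rw [h𝒢.s_mul _ _ (by rw [h1, h𝒢.r_inv]), h𝒢.s_inv]
  rw [← hG.inv_smul, leftGroupoid_s_eq_iff hG hH, leftAct_orb hH hHfp h2]
  exact ⟨congrArg _ h2, h𝒢.inv_mul_cancel_right h1⟩

theorem rightArrow_spec (h𝒢 : IsLCGroupoid 𝒢) (hG : ActsByGroupoidAut G 𝒢)
    (hH : ActsByGroupoidAut Hᵐᵒᵖ 𝒢) (hGfp : IsFreeProper G X) {x y : X}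
    (hxy : orb Hᵐᵒᵖ (𝒢.r x) = orb Hᵐᵒᵖ (𝒢.r y)) :
    rightAnchor G H 𝒢 x = (rightGroupoid H hG).r (rightArrow G H 𝒢 x y) ∧
      rightAct 𝒢 x (rightArrow G H 𝒢 x y) = y := by
  have ht : transl Hᵐᵒᵖ (𝒢.r x) (𝒢.r y) • 𝒢.r x = 𝒢.r y := transl_smul hxy
  rw [rightArrow]
  generalize transl Hᵐᵒᵖ (𝒢.r x) (𝒢.r y) = t at ht
  have h1 : 𝒢.r (t • x) = 𝒢.r y := by rw [hH.r_smul, ht]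
  have h2 : 𝒢.s (t • x) = 𝒢.r (𝒢.mul (𝒢.inv (t • x)) y) := by
    rw [h𝒢.r_mul _ _ (by rw [← h1, h𝒢.s_inv]), h𝒢.r_inv]
  rw [← hH.inv_smul, rightGroupoid_r_eq_iff hG hH, rightAct_orb hG hGfp (h := unop t) h2]
  exact ⟨congrArg _ h2, h𝒢.mul_inv_cancel_left h1⟩

/-- Replacing the representatives `x` and `z` by `op k • x` and `t • z` does not change their
orbits, and turns both sides into bracketings of `(op k • x) (t • op k • y) (t • z)`. -/
theorem leftAct_rightAct (h𝒢 : IsLCGroupoid 𝒢) (hG : ActsByGroupoidAut G 𝒢)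
    (hH : ActsByGroupoidAut Hᵐᵒᵖ 𝒢) (hGfp : IsFreeProper G X) (hHfp : IsFreeProper Hᵐᵒᵖ X)
    {q : Orbits Hᵐᵒᵖ X × G} {y : X} {q' : H × Orbits G X}
    (h : (leftGroupoid G hH).s q = leftAnchor G H 𝒢 y)
    (h' : rightAnchor G H 𝒢 y = (rightGroupoid H hG).r q') :
    leftAct 𝒢 q (rightAct 𝒢 y q') = rightAct 𝒢 (leftAct 𝒢 q y) q' := by
  obtain ⟨x, hx, hxy⟩ := exists_of_leftGroupoid_s_eq hG hH h
  obtain ⟨z, hz, hyz⟩ := exists_of_rightGroupoid_r_eq hG hH h'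
  obtain ⟨P, t⟩ := q
  obtain ⟨k, Q⟩ := q'
  simp only at hx hz hxy hyz
  rw [hx, hz, rightAct_orb hG hGfp hyz, leftAct_orb hH hHfp hxy,
    ← orb_smul (op k) x, ← orb_smul t z]
  have hyz' : 𝒢.s (t • op k • y) = 𝒢.r (t • z) := by rw [hG.s_smul, hyz, hG.r_smul]
  have hxy' : 𝒢.s (op k • x) = 𝒢.r (t • op k • y) := by
    rw [hH.s_smul, hxy, ← hH.r_smul, smul_comm t]
  rw [leftAct_orb hH hHfp, rightAct_orb hG hGfp, ← hG.mul_smul _ _ _ hyz,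
    ← hH.mul_smul _ _ _ hxy, ← smul_comm t (op k) y, h𝒢.mul_assoc _ _ _ hxy' hyz']
  · rw [← hH.mul_smul _ _ _ hxy, ← smul_comm t (op k) y, h𝒢.s_mul _ _ hxy', hyz']
  · rw [← hG.mul_smul _ _ _ hyz, h𝒢.r_mul _ _ hyz', hxy']

theorem isGroupoidEquivalence [IsTopologicalGroup G] [IsTopologicalGroup H]
    (h𝒢 : IsLCGroupoid 𝒢) (hG : ActsByGroupoidAut G 𝒢)
    (hH : ActsByGroupoidAut Hᵐᵒᵖ 𝒢) (hGfp : IsFreeProper G X) (hHfp : IsFreeProper Hᵐᵒᵖ X) :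
    IsGroupoidEquivalence (leftGroupoid G hH) (rightGroupoid H hG) (leftAnchor G H 𝒢)
      (leftAct 𝒢) (rightAnchor G H 𝒢) (rightAct 𝒢) := by
  have hla := isLeftAction_leftAct h𝒢 hG hH hHfp
  have hra := isRightAction_rightAct h𝒢 hG hH hGfp
  have hanchor_l : ∀ q y, (leftGroupoid G hH).s q = leftAnchor G H 𝒢 y →
      rightAnchor G H 𝒢 (leftAct 𝒢 q y) = rightAnchor G H 𝒢 y := fun q y hq => by
    obtain ⟨x, hx, hxy⟩ := exists_of_leftGroupoid_s_eq hG hH hq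
    rw [hx, leftAct_orb hH hHfp hxy, rightAnchor, h𝒢.s_mul _ _ hxy, hG.s_smul, orb_smul]
    rfl
  have hanchor_r : ∀ x q, rightAnchor G H 𝒢 x = (rightGroupoid H hG).r q →
      leftAnchor G H 𝒢 (rightAct 𝒢 x q) = leftAnchor G H 𝒢 x := fun x q hq => by
    obtain ⟨y, hy, hxy⟩ := exists_of_rightGroupoid_r_eq hG hH hq
    rw [hy, rightAct_orb hG hGfp hxy, leftAnchor, h𝒢.r_mul _ _ hxy, hH.r_smul, orb_smul]
    rfl
  have hcs := h𝒢.continuous_s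
  have hcr := h𝒢.continuous_r
  have hci := h𝒢.continuous_inv
  have : ContinuousSMul G X := ⟨hG.continuous_smul⟩
  have : ContinuousSMul Hᵐᵒᵖ X := ⟨hH.continuous_smul⟩
  have hπG := (isOpenQuotientMap_orb hG.continuous_smul).continuous
  have hπH := (isOpenQuotientMap_orb hH.continuous_smul).continuous
  have := hGfp.proper
  have := hHfp.proper
  have : T2Space (Orbits G X) := t2Space_quotient_mulAction_of_properSMul
  have : T2Space (Orbits Hᵐᵒᵖ X) := t2Space_quotient_mulAction_of_properSMul
  exact
  { t2 := h𝒢.t2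
    locallyCompact := h𝒢.locallyCompact
    secondCountable := h𝒢.secondCountable
    left_action := hla
    -- Comparison of sources shows that the group coordinate fixes `s y`, so it is `1` by freeness
    -- on `X`; then `x y = y` forces `x` to be a unit.
    left_free := fun q y hq hfix => by
      obtain ⟨x, hx, hxy⟩ := exists_of_leftGroupoid_s_eq hG hH hq
      rw [hx, leftAct_orb hH hHfp hxy] at hfix
      have h1 : q.2 • 𝒢.s y = 𝒢.s y := by rw [← hG.s_smul, ← h𝒢.s_mul _ _ hxy, hfix]
      have h2 := hGfp.free _ _ h1
      rw [h2, one_smul] at hfix hxy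
      rw [hx, h2, leftGroupoid_units]
      exact ⟨⟨x, h𝒢.mem_units_of_mul_eq_right hxy hfix, rfl⟩, rfl⟩
    left_proper := by
      -- The set of pairs in one orbit of the left groupoid; it is closed because `G\X` is
      -- Hausdorff.
      have hR : IsClosed {q : X × X | orb G (𝒢.s q.1) = orb G (𝒢.s q.2)} :=
        isClosed_eq (by fun_prop) (by fun_prop)
      have ht : ContinuousOn (fun q : X × X => transl G (𝒢.s q.2) (𝒢.s q.1))
          {q : X × X | orb G (𝒢.s q.1) = orb G (𝒢.s q.2)} :=
        (continuousOn_transl hGfp).comp (f := fun q : X × X => (𝒢.s q.2, 𝒢.s q.1))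
          (by fun_prop) fun q hq => Eq.symm hq
      -- The inverse of the action map; its continuity rests on that of the translating element.
      have hinv : ContinuousOn (fun q : X × X => (leftArrow G H 𝒢 q.1 q.2, q.2))
          {q : X × X | orb G (𝒢.s q.1) = orb G (𝒢.s q.2)} := by
        refine ContinuousOn.prodMk (ContinuousOn.prodMk (hπH.comp_continuousOn ?_) ht)
          continuousOn_snd
        refine h𝒢.continuousOn_mul.comp (f := fun q : X × X =>
          (q.1, transl G (𝒢.s q.2) (𝒢.s q.1) • 𝒢.inv q.2)) (continuousOn_fst.prodMk
            (ht.smul (hci.comp continuous_snd).continuousOn)) fun q hq => ?_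
        simp only [mem_ofPred_eq, hG.r_smul, h𝒢.r_inv]
        exact (transl_smul (Eq.symm hq)).symm
      refine isProperMap_of_inverse
        (S := {q : (Orbits Hᵐᵒᵖ X × G) × X | (leftGroupoid G hH).s q.1 = leftAnchor G H 𝒢 q.2})
        (f := fun q => (leftAct 𝒢 q.1 q.2, q.2)) hR
        (hla.continuousOn_act.prodMk continuousOn_snd) hinv ?_ ?_ ?_ ?_
      · exact fun q hq => (Prod.mk.inj (hanchor_l q.1 q.2 hq)).2
      · exact fun q hq => (leftArrow_spec h𝒢 hG hH hHfp hq).1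
      · rintro ⟨q, y⟩ hq
        obtain ⟨x, hx, hxy⟩ := exists_of_leftGroupoid_s_eq (q := q) (y := y) hG hH hq
        simp only
        rw [hx, leftAct_orb hH hHfp hxy, leftArrow, h𝒢.s_mul _ _ hxy, hG.s_smul,
          transl_eq hGfp rfl, ← hG.inv_smul, h𝒢.mul_inv_cancel_right hxy]
      · exact fun q hq => Prod.ext (leftArrow_spec h𝒢 hG hH hHfp hq).2 rfl
    right_action := hra
    right_free := fun x q hq hfix => by
      obtain ⟨y, hy, hxy⟩ := exists_of_rightGroupoid_r_eq hG hH hq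
      rw [hy, rightAct_orb hG hGfp hxy] at hfix
      have h1 : op q.1 • 𝒢.r x = 𝒢.r x := by rw [← hH.r_smul, ← h𝒢.r_mul _ _ hxy, hfix]
      have h2 := hHfp.free _ _ h1
      rw [h2, one_smul] at hfix hxy
      rw [hy, (op_eq_one_iff _).1 h2, rightGroupoid_units hG hH]
      exact ⟨rfl, y, h𝒢.mem_units_of_mul_eq_left hxy hfix, rfl⟩
    right_proper := by
      have hR : IsClosed {q : X × X | orb Hᵐᵒᵖ (𝒢.r q.1) = orb Hᵐᵒᵖ (𝒢.r q.2)} :=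
        isClosed_eq (by fun_prop) (by fun_prop)
      have ht : ContinuousOn (fun q : X × X => transl Hᵐᵒᵖ (𝒢.r q.1) (𝒢.r q.2))
          {q : X × X | orb Hᵐᵒᵖ (𝒢.r q.1) = orb Hᵐᵒᵖ (𝒢.r q.2)} :=
        (continuousOn_transl hHfp).comp (f := fun q : X × X => (𝒢.r q.1, 𝒢.r q.2))
          (by fun_prop) fun q hq => hq
      have hinv : ContinuousOn (fun q : X × X => (q.1, rightArrow G H 𝒢 q.1 q.2))
          {q : X × X | orb Hᵐᵒᵖ (𝒢.r q.1) = orb Hᵐᵒᵖ (𝒢.r q.2)} := by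
        -- On this side the translating element takes the range of `x` to that of `y`, and `unop`
        -- returns it from `Hᵐᵒᵖ` to `H`.
        refine ContinuousOn.prodMk continuousOn_fst
          (ContinuousOn.prodMk (continuous_unop.comp_continuousOn ht) (hπG.comp_continuousOn ?_))
        refine h𝒢.continuousOn_mul.comp (f := fun q : X × X =>
          (transl Hᵐᵒᵖ (𝒢.r q.1) (𝒢.r q.2) • 𝒢.inv q.1, q.2)) (ContinuousOn.prodMk
            (ht.smul (hci.comp continuous_fst).continuousOn) continuousOn_snd) fun q hq => ?_
        simp only [mem_ofPred_eq, hH.s_smul, h𝒢.s_inv]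
        exact transl_smul hq
      refine isProperMap_of_inverse
        (S := {q : X × (H × Orbits G X) | rightAnchor G H 𝒢 q.1 = (rightGroupoid H hG).r q.2})
        (f := fun q => (q.1, rightAct 𝒢 q.1 q.2)) hR
        (continuousOn_fst.prodMk hra.continuousOn_act) hinv ?_ ?_ ?_ ?_
      · exact fun q hq => (Prod.mk.inj (hanchor_r q.1 q.2 hq)).1.symm
      · exact fun q hq => (rightArrow_spec h𝒢 hG hH hGfp hq).1
      · rintro ⟨x, q⟩ hq
        obtain ⟨y, hy, hxy⟩ := exists_of_rightGroupoid_r_eq (q := q) (x := x) hG hH hq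
        simp only
        rw [hy, rightAct_orb hG hGfp hxy, rightArrow, h𝒢.r_mul _ _ hxy, hH.r_smul,
          transl_eq hHfp rfl, ← hH.inv_smul, h𝒢.inv_mul_cancel_left hxy]
        rfl
      · exact fun q hq => Prod.ext rfl (rightArrow_spec h𝒢 hG hH hGfp hq).2
    anchor_lact := hanchor_l
    anchor_ract := hanchor_r
    commute := fun q y q' h h' => leftAct_rightAct h𝒢 hG hH hGfp hHfp h h'
    surj_left := by
      rintro _ ⟨⟨P, t⟩, rfl⟩
      obtain ⟨x, rfl⟩ := orb_surjective P
      exact ⟨x, rfl⟩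
    orbit_right := fun x y hxy =>
      ⟨_, rightArrow_spec h𝒢 hG hH hGfp (Prod.mk.inj hxy).1⟩
    surj_right := by
      rw [rightGroupoid_units hG hH]
      rintro ⟨_, _⟩ ⟨rfl, u, hu, rfl⟩
      exact ⟨u, Prod.ext rfl (congrArg (orb G) (h𝒢.s_of_mem hu))⟩
    orbit_left := fun x y hxy =>
      ⟨_, leftArrow_spec h𝒢 hG hH hHfp (Prod.mk.inj hxy).2.symm⟩ }

end Equivalence

/-! ### The equivalence of Fell bundles: the actions -/

section FellEquivalence

set_option linter.unusedSectionVars false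

variable {G H X A : Type*} [Group G] [Group H] [MulAction G X] [MulAction Hᵐᵒᵖ X] [MulAction G A]
  [MulAction Hᵐᵒᵖ A]

/-- The left action `(a · H, t) · b = a (t · b)`. -/
def leftFellAct (𝒢 : GroupoidData X) (F : FellData X A) (q : Orbits Hᵐᵒᵖ A × G) (b : A) : A :=
  F.mul (rep (fun a => 𝒢.s (F.p a)) q.1 (𝒢.r (F.p (q.2 • b)))) (q.2 • b)

/-- The right action `a · (h, G · b) = (a · h) b`. -/
def rightFellAct (𝒢 : GroupoidData X) (F : FellData X A) (a : A) (q : H × Orbits G A) : A :=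
  F.mul (op q.1 • a) (rep (fun b => 𝒢.r (F.p b)) q.2 (𝒢.s (F.p (op q.1 • a))))

variable [SMulCommClass G Hᵐᵒᵖ X] [SMulCommClass G Hᵐᵒᵖ A]

variable [TopologicalSpace G] [TopologicalSpace H] [TopologicalSpace X] [TopologicalSpace A]
  {𝒢 : GroupoidData X} {F : FellData X A}

/-- The Fell bundle `A/H ⋊ G`. -/
abbrev leftFell (G : Type*) {H X A : Type*} [Group G] [Group H] [MulAction Hᵐᵒᵖ X]
    [MulAction G A] [MulAction Hᵐᵒᵖ A] [SMulCommClass G Hᵐᵒᵖ A] [TopologicalSpace H]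
    [TopologicalSpace X] [TopologicalSpace A] {𝒢 : GroupoidData X} {F : FellData X A}
    (hH : ActsByFellAut Hᵐᵒᵖ 𝒢 F) : FellData (Orbits Hᵐᵒᵖ X × G) (Orbits Hᵐᵒᵖ A × G) :=
  semidirectFell (orbitFell 𝒢 F hH) leftOrbitAct

/-- The Fell bundle `H ⋉ G\A`. -/
abbrev rightFell (H : Type*) {G X A : Type*} [Group G] [Group H] [MulAction G X]
    [MulAction G A] [MulAction Hᵐᵒᵖ A] [SMulCommClass G Hᵐᵒᵖ A] [TopologicalSpace G]
    [TopologicalSpace X] [TopologicalSpace A] {𝒢 : GroupoidData X} {F : FellData X A}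
    (hG : ActsByFellAut G 𝒢 F) : FellData (H × Orbits G X) (H × Orbits G A) :=
  rightSemidirectFell (orbitFell 𝒢 F hG) rightOrbitAct

theorem leftFell_s_eq_iff (hG : ActsByFellAut G 𝒢 F) (hH : ActsByFellAut Hᵐᵒᵖ 𝒢 F) {a : A} {t : G}
    {e : A} :
    (leftGroupoid G hH.base).s ((leftFell G hH).p (orb Hᵐᵒᵖ a, t)) = leftAnchor G H 𝒢 (F.p e) ↔
      orb Hᵐᵒᵖ (𝒢.s (F.p a)) = orb Hᵐᵒᵖ (𝒢.r (F.p (t • e))) := by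
  rw [hG.p_smul]
  exact leftGroupoid_s_eq_iff hG.base hH.base

theorem exists_of_leftFell_s_eq (hG : ActsByFellAut G 𝒢 F) (hH : ActsByFellAut Hᵐᵒᵖ 𝒢 F)
    {P : Orbits Hᵐᵒᵖ A} {t : G} {e : A}
    (h : (leftGroupoid G hH.base).s ((leftFell G hH).p (P, t)) = leftAnchor G H 𝒢 (F.p e)) :
    ∃ a, orb Hᵐᵒᵖ a = P ∧ 𝒢.s (F.p a) = 𝒢.r (F.p (t • e)) := by
  obtain ⟨a, rfl⟩ := orb_surjective P
  have ha : orbitMap (fun a => 𝒢.s (F.p a)) hH.s_p_smul (orb Hᵐᵒᵖ a)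
      = orb Hᵐᵒᵖ (𝒢.r (F.p (t • e))) := (leftFell_s_eq_iff hG hH).1 h
  exact exists_orb_eq ha

theorem rightFell_r_eq_iff (hG : ActsByFellAut G 𝒢 F) (hH : ActsByFellAut Hᵐᵒᵖ 𝒢 F) {e : A} {h : H}
    {b : A} :
    rightAnchor G H 𝒢 (F.p e) = (rightGroupoid H hG.base).r ((rightFell H hG).p (h, orb G b)) ↔
      orb G (𝒢.s (F.p (op h • e))) = orb G (𝒢.r (F.p b)) := by
  rw [hH.p_smul]
  exact rightGroupoid_r_eq_iff hG.base hH.base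

theorem exists_of_rightFell_r_eq (hG : ActsByFellAut G 𝒢 F) (hH : ActsByFellAut Hᵐᵒᵖ 𝒢 F)
    {P : Orbits G A} {h : H} {e : A}
    (hq : rightAnchor G H 𝒢 (F.p e) = (rightGroupoid H hG.base).r ((rightFell H hG).p (h, P))) :
    ∃ b, orb G b = P ∧ 𝒢.s (F.p (op h • e)) = 𝒢.r (F.p b) := by
  obtain ⟨b, rfl⟩ := orb_surjective P
  have hb : orbitMap (fun b => 𝒢.r (F.p b)) hG.r_p_smul (orb G b)
      = orb G (𝒢.s (F.p (op h • e))) := ((rightFell_r_eq_iff hG hH).1 hq).symm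
  obtain ⟨b', hb, hs⟩ := exists_orb_eq hb
  exact ⟨b', hb, hs.symm⟩

theorem leftFellAct_orb (hH : ActsByFellAut Hᵐᵒᵖ 𝒢 F) (hHfp : IsFreeProper Hᵐᵒᵖ X) {a : A} {t : G}
    {b : A} (h : 𝒢.s (F.p a) = 𝒢.r (F.p (t • b))) :
    leftFellAct 𝒢 F (orb Hᵐᵒᵖ a, t) b = F.mul a (t • b) := by
  rw [leftFellAct, rep_orb (f := fun a => 𝒢.s (F.p a)) hHfp hH.s_p_smul h]

theorem rightFellAct_orb (hG : ActsByFellAut G 𝒢 F) (hGfp : IsFreeProper G X) {a : A} {h : H}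
    {b : A} (hab : 𝒢.s (F.p (op h • a)) = 𝒢.r (F.p b)) :
    rightFellAct 𝒢 F a (h, orb G b) = F.mul (op h • a) b := by
  rw [rightFellAct, rep_orb (f := fun b => 𝒢.r (F.p b)) hGfp hG.r_p_smul hab.symm]

theorem leftFell_mul_orb (hH : ActsByFellAut Hᵐᵒᵖ 𝒢 F) (hHfp : IsFreeProper Hᵐᵒᵖ X) {a b : A}
    {t t' : G} (h : 𝒢.s (F.p a) = 𝒢.r (F.p (t • b))) :
    (leftFell G hH).mul (orb Hᵐᵒᵖ a, t) (orb Hᵐᵒᵖ b, t')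
      = (orb Hᵐᵒᵖ (F.mul a (t • b)), t * t') :=
  Prod.ext (orbitFell_mul_orb hH hHfp h) rfl

theorem rightFell_mul_orb (hG : ActsByFellAut G 𝒢 F) (hGfp : IsFreeProper G X) {a b : A}
    {h h' : H} (hab : 𝒢.s (F.p (op h' • a)) = 𝒢.r (F.p b)) :
    (rightFell H hG).mul (h, orb G a) (h', orb G b)
      = (h * h', orb G (F.mul (op h' • a) b)) :=
  Prod.ext rfl (orbitFell_mul_orb hG hGfp hab)

theorem leftFell_add_orb (hH : ActsByFellAut Hᵐᵒᵖ 𝒢 F) (hHfp : IsFreeProper Hᵐᵒᵖ X) {a b : A}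
    {t t' : G} (h : F.p a = F.p b) :
    (leftFell G hH).add (orb Hᵐᵒᵖ a, t) (orb Hᵐᵒᵖ b, t') = (orb Hᵐᵒᵖ (F.add a b), t) :=
  Prod.ext (orbitFell_add_orb hH hHfp h) rfl

theorem rightFell_add_orb (hG : ActsByFellAut G 𝒢 F) (hGfp : IsFreeProper G X) {a b : A}
    {h h' : H} (hab : F.p a = F.p b) :
    (rightFell H hG).add (h, orb G a) (h', orb G b) = (h, orb G (F.add a b)) :=
  Prod.ext rfl (orbitFell_add_orb hG hGfp hab)

/-- Each clause reduces to a property of multiplication in `F` once the orbit is represented by an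
element composable with `t • e`. The norm estimate needs submultiplicativity between arbitrary
fibres, together with invariance of the norm under `G`. -/
theorem isLeftFellAction_leftFellAct (h𝒢 : IsLCGroupoid 𝒢) (hF : IsFellBundle 𝒢 F)
    (hG : ActsByFellAut G 𝒢 F) (hH : ActsByFellAut Hᵐᵒᵖ 𝒢 F) (hHfp : IsFreeProper Hᵐᵒᵖ X) :
    IsLeftFellAction (leftGroupoid G hH.base) (leftFell G hH) F.toBundleData (leftAnchor G H 𝒢)
      (leftAct 𝒢) (leftFellAct 𝒢 F) where
  p_la := by
    rintro ⟨P, t⟩ e h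
    obtain ⟨a, rfl, hae⟩ := exists_of_leftFell_s_eq hG hH h
    have hpe : 𝒢.s (F.p a) = 𝒢.r (t • F.p e) := by rw [hae, hG.p_smul]
    rw [leftFellAct_orb hH hHfp hae, hF.p_mul _ _ hae, hG.p_smul]
    exact (leftAct_orb hH.base hHfp hpe).symm
  mul_la := by
    rintro ⟨P, t⟩ ⟨Q, t'⟩ e h₁ h₂
    obtain ⟨b, rfl, hbe⟩ := exists_of_leftFell_s_eq hG hH h₂
    obtain ⟨a, rfl, hab⟩ := exists_of_leftFell_s_eq hG hH (e := b) h₁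
    have hbe' : 𝒢.s (F.p (t • b)) = 𝒢.r (F.p (t • t' • e)) := by
      rw [hG.s_p_smul, hbe, ← hG.r_p_smul]
    rw [leftFell_mul_orb hH hHfp hab, leftFellAct_orb hH hHfp, leftFellAct_orb hH hHfp hbe,
      leftFellAct_orb hH hHfp, ← hG.mul_smul _ _ _ hbe, mul_smul, hF.mul_assoc _ _ _ hab hbe']
    · rw [hab, hG.r_p_smul, hG.r_p_smul, hF.p_mul _ _ hbe, h𝒢.r_mul _ _ hbe]
    · rw [hF.p_mul _ _ hab, h𝒢.s_mul _ _ hab, mul_smul, hbe']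
  norm_la_le := by
    rintro ⟨P, t⟩ e h
    obtain ⟨a, rfl, hae⟩ := exists_of_leftFell_s_eq hG hH h
    rw [leftFellAct_orb hH hHfp hae, ← hG.norm_smul t e]
    exact hF.norm_mul_le_mul_norm h𝒢 hae
  add_la := by
    rintro ⟨P, t⟩ ⟨Q, t'⟩ e h₁ h₂
    obtain ⟨hPQ, rfl⟩ : (orbitFell 𝒢 F hH).p P = (orbitFell 𝒢 F hH).p Q ∧ t = t' := Prod.mk.inj h₁
    obtain ⟨a, rfl, hae⟩ := exists_of_leftFell_s_eq hG hH h₂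
    obtain ⟨a', rfl, haa'⟩ := exists_orb_p_eq hH hPQ.symm
    rw [leftFell_add_orb hH hHfp haa'.symm, leftFellAct_orb hH hHfp, leftFellAct_orb hH hHfp hae,
      leftFellAct_orb hH hHfp, hF.add_mul _ _ _ haa'.symm hae]
    · rw [haa', hae]
    · rw [hF.p_add _ _ haa'.symm, hae]
  la_add := by
    rintro ⟨P, t⟩ e e' h₁ h₂
    obtain ⟨a, rfl, hae⟩ := exists_of_leftFell_s_eq hG hH h₂
    have hpe : F.p (t • e) = F.p (t • e') := by rw [hG.p_smul, hG.p_smul, h₁]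
    rw [leftFellAct_orb hH hHfp, leftFellAct_orb hH hHfp hae, leftFellAct_orb hH hHfp,
      ← hG.add_smul _ _ _ h₁, hF.mul_add _ _ _ hpe hae]
    · rw [hae, hpe]
    · rw [hae, hG.p_smul, hG.p_smul, hF.p_add _ _ h₁]
  smul_la := by
    rintro c ⟨P, t⟩ e h
    obtain ⟨a, rfl, hae⟩ := exists_of_leftFell_s_eq hG hH h
    rw [leftFellAct_orb hH hHfp hae, ← hF.smul_mul _ _ _ hae]
    exact leftFellAct_orb hH hHfp (by rw [hF.p_smul, hae])
  la_smul := by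
    rintro c ⟨P, t⟩ e h
    obtain ⟨a, rfl, hae⟩ := exists_of_leftFell_s_eq hG hH h
    rw [leftFellAct_orb hH hHfp hae, leftFellAct_orb hH hHfp, ← hF.mul_smul' _ _ _ hae,
      hG.smul_smul]
    rw [hae, hG.p_smul, hG.p_smul, hF.p_smul]
  continuousOn_la := by
    have : ContinuousSMul G A := ⟨hG.continuous_smul⟩
    have hcr := h𝒢.continuous_r
    have hcs := h𝒢.continuous_s
    have hcp := hF.continuous_p
    have h1 : ContinuousOn (fun q : (Orbits Hᵐᵒᵖ A × G) × A =>
          rep (fun a => 𝒢.s (F.p a)) q.1.1 (𝒢.r (F.p (q.1.2 • q.2))))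
        {q | orbitMap (fun a => 𝒢.s (F.p a)) hH.s_p_smul q.1.1
          = orb Hᵐᵒᵖ (𝒢.r (F.p (q.1.2 • q.2)))} :=
      (continuousOn_rep hHfp hH.continuous_smul hH.s_p_smul (by fun_prop)).comp
        (f := fun q : (Orbits Hᵐᵒᵖ A × G) × A => (q.1.1, 𝒢.r (F.p (q.1.2 • q.2))))
        (by fun_prop) fun q hq => hq
    refine (hF.continuousOn_mul.comp (h1.prodMk (by fun_prop : ContinuousOn
      (fun q : (Orbits Hᵐᵒᵖ A × G) × A => q.1.2 • q.2) _)) fun q hq => (rep_spec hq).2).mono ?_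
    rintro ⟨⟨P, t⟩, e⟩ hq
    obtain ⟨a, rfl, hae⟩ := exists_of_leftFell_s_eq (P := P) (t := t) (e := e) hG hH hq
    exact congrArg (orb Hᵐᵒᵖ) hae

theorem isRightFellAction_rightFellAct (h𝒢 : IsLCGroupoid 𝒢) (hF : IsFellBundle 𝒢 F)
    (hG : ActsByFellAut G 𝒢 F) (hH : ActsByFellAut Hᵐᵒᵖ 𝒢 F) (hGfp : IsFreeProper G X) :
    IsRightFellAction (rightGroupoid H hG.base) (rightFell H hG) F.toBundleData
      (rightAnchor G H 𝒢) (rightAct 𝒢) (rightFellAct 𝒢 F) where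
  p_ra := by
    rintro e ⟨k, P⟩ h
    obtain ⟨b, rfl, heb⟩ := exists_of_rightFell_r_eq hG hH h
    have hpe : 𝒢.s (op k • F.p e) = 𝒢.r (F.p b) := by rw [← heb, hH.p_smul]
    rw [rightFellAct_orb hG hGfp heb, hF.p_mul _ _ heb, hH.p_smul]
    exact (rightAct_orb hG.base hGfp hpe).symm
  ra_mul := by
    rintro e ⟨k, P⟩ ⟨l, Q⟩ h₁ h₂
    obtain ⟨a, rfl, hea⟩ := exists_of_rightFell_r_eq hG hH h₁
    obtain ⟨b, rfl, hab⟩ := exists_of_rightFell_r_eq hG hH (e := a) h₂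
    have hea' : 𝒢.s (F.p (op l • op k • e)) = 𝒢.r (F.p (op l • a)) := by
      rw [hH.s_p_smul, hea, ← hH.r_p_smul]
    rw [rightFell_mul_orb hG hGfp hab, rightFellAct_orb hG hGfp, rightFellAct_orb hG hGfp hea,
      rightFellAct_orb hG hGfp, ← hH.mul_smul _ _ _ hea, op_mul, mul_smul,
      hF.mul_assoc _ _ _ hea' hab]
    · rw [hH.s_p_smul, hF.p_mul _ _ hea, h𝒢.s_mul _ _ hea, ← hab, hH.s_p_smul]
    · rw [hF.p_mul _ _ hab, h𝒢.r_mul _ _ hab, op_mul, mul_smul, hea']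
  norm_ra_le := by
    rintro e ⟨k, P⟩ h
    obtain ⟨b, rfl, heb⟩ := exists_of_rightFell_r_eq hG hH h
    rw [rightFellAct_orb hG hGfp heb, ← hH.norm_smul (op k) e]
    exact hF.norm_mul_le_mul_norm h𝒢 heb
  add_ra := by
    rintro e e' ⟨k, P⟩ h₁ h₂
    obtain ⟨b, rfl, heb⟩ := exists_of_rightFell_r_eq hG hH h₂
    have hpe : F.p (op k • e) = F.p (op k • e') := by rw [hH.p_smul, hH.p_smul, h₁]
    rw [rightFellAct_orb hG hGfp, rightFellAct_orb hG hGfp heb, rightFellAct_orb hG hGfp,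
      ← hH.add_smul _ _ _ h₁, hF.add_mul _ _ _ hpe heb]
    · rw [← heb, hpe]
    · rw [← heb, hH.p_smul, hH.p_smul, hF.p_add _ _ h₁]
  ra_add := by
    rintro e ⟨k, P⟩ ⟨k', Q⟩ h₁ h₂
    obtain ⟨rfl, hPQ⟩ : k = k' ∧ (orbitFell 𝒢 F hG).p P = (orbitFell 𝒢 F hG).p Q :=
      Prod.mk.inj h₁
    obtain ⟨b, rfl, heb⟩ := exists_of_rightFell_r_eq hG hH h₂
    obtain ⟨b', rfl, hbb'⟩ := exists_orb_p_eq hG hPQ.symm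
    rw [rightFell_add_orb hG hGfp hbb'.symm, rightFellAct_orb hG hGfp,
      rightFellAct_orb hG hGfp heb, rightFellAct_orb hG hGfp, hF.mul_add _ _ _ hbb'.symm heb]
    · rw [hbb', heb]
    · rw [hF.p_add _ _ hbb'.symm, heb]
  smul_ra := by
    rintro c e ⟨k, P⟩ h
    obtain ⟨b, rfl, heb⟩ := exists_of_rightFell_r_eq hG hH h
    rw [rightFellAct_orb hG hGfp heb, rightFellAct_orb hG hGfp, ← hF.smul_mul _ _ _ heb,
      hH.smul_smul]
    rw [← heb, hH.p_smul, hH.p_smul, hF.p_smul]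
  ra_smul := by
    rintro c e ⟨k, P⟩ h
    obtain ⟨b, rfl, heb⟩ := exists_of_rightFell_r_eq hG hH h
    rw [rightFellAct_orb hG hGfp heb, ← hF.mul_smul' _ _ _ heb]
    exact rightFellAct_orb hG hGfp (by rw [hF.p_smul, heb])
  continuousOn_ra := by
    have : ContinuousSMul Hᵐᵒᵖ A := ⟨hH.continuous_smul⟩
    have hcr := h𝒢.continuous_r
    have hcs := h𝒢.continuous_s
    have hcp := hF.continuous_p
    have h1 : ContinuousOn (fun q : A × (H × Orbits G A) =>
          rep (fun b => 𝒢.r (F.p b)) q.2.2 (𝒢.s (F.p (op q.2.1 • q.1))))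
        {q | orbitMap (fun b => 𝒢.r (F.p b)) hG.r_p_smul q.2.2
          = orb G (𝒢.s (F.p (op q.2.1 • q.1)))} :=
      (continuousOn_rep hGfp hG.continuous_smul hG.r_p_smul (by fun_prop)).comp
        (f := fun q : A × (H × Orbits G A) => (q.2.2, 𝒢.s (F.p (op q.2.1 • q.1))))
        (by fun_prop) fun q hq => hq
    refine (hF.continuousOn_mul.comp (ContinuousOn.prodMk (by fun_prop : ContinuousOn
      (fun q : A × (H × Orbits G A) => op q.2.1 • q.1) _) h1) fun q hq =>
        (rep_spec hq).2.symm).mono ?_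
    rintro ⟨e, ⟨k, P⟩⟩ hq
    obtain ⟨b, rfl, heb⟩ := exists_of_rightFell_r_eq (h := k) (P := P) (e := e) hG hH hq
    exact congrArg (orb G) heb.symm

/-- As on the base, suitable representatives make both sides bracketings of `(op k • a) (t • op k •
e) (t • b)`. -/
theorem leftFellAct_rightFellAct (h𝒢 : IsLCGroupoid 𝒢) (hF : IsFellBundle 𝒢 F)
    (hG : ActsByFellAut G 𝒢 F) (hH : ActsByFellAut Hᵐᵒᵖ 𝒢 F) (hGfp : IsFreeProper G X)
    (hHfp : IsFreeProper Hᵐᵒᵖ X) {q : Orbits Hᵐᵒᵖ A × G} {e : A} {q' : H × Orbits G A}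
    (h : (leftGroupoid G hH.base).s ((leftFell G hH).p q) = leftAnchor G H 𝒢 (F.p e))
    (h' : rightAnchor G H 𝒢 (F.p e) = (rightGroupoid H hG.base).r ((rightFell H hG).p q')) :
    leftFellAct 𝒢 F q (rightFellAct 𝒢 F e q') = rightFellAct 𝒢 F (leftFellAct 𝒢 F q e) q' := by
  obtain ⟨P, t⟩ := q
  obtain ⟨k, Q⟩ := q'
  obtain ⟨a, rfl, hae⟩ := exists_of_leftFell_s_eq hG hH h
  obtain ⟨b, rfl, heb⟩ := exists_of_rightFell_r_eq hG hH h'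
  rw [rightFellAct_orb hG hGfp heb, leftFellAct_orb hH hHfp hae, ← orb_smul (op k) a,
    ← orb_smul t b]
  have heb' : 𝒢.s (F.p (t • op k • e)) = 𝒢.r (F.p (t • b)) := by
    rw [hG.s_p_smul, heb, hG.r_p_smul]
  have hae' : 𝒢.s (F.p (op k • a)) = 𝒢.r (F.p (t • op k • e)) := by
    rw [hH.s_p_smul, hae, ← hH.r_p_smul, smul_comm t]
  rw [leftFellAct_orb hH hHfp, rightFellAct_orb hG hGfp, ← hG.mul_smul _ _ _ heb,
    ← hH.mul_smul _ _ _ hae, ← smul_comm t (op k) e, hF.mul_assoc _ _ _ hae' heb']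
  · rw [← hH.mul_smul _ _ _ hae, ← smul_comm t (op k) e, hF.p_mul _ _ hae', h𝒢.s_mul _ _ hae',
      heb']
  · rw [← hG.mul_smul _ _ _ heb, hF.p_mul _ _ heb', h𝒢.r_mul _ _ heb', hae']

end FellEquivalence

/-! ### The equivalence of Fell bundles: the inner products -/

section InnerProducts

set_option linter.unusedSectionVars false

variable {G H X A : Type*} [Group G] [Group H] [MulAction G X] [MulAction Hᵐᵒᵖ X] [MulAction G A]
  [MulAction Hᵐᵒᵖ A]

/-- The left inner product `(a (t · b*) · H, t)`, where `t` takes the source of `b` to that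
of `a`. -/
def leftInner (G H : Type*) {X A : Type*} [Group G] [Group H] [MulAction G X] [MulAction G A]
    [MulAction Hᵐᵒᵖ A] (𝒢 : GroupoidData X) (F : FellData X A) (a b : A) : Orbits Hᵐᵒᵖ A × G :=
  (orb Hᵐᵒᵖ (F.mul a (transl G (𝒢.s (F.p b)) (𝒢.s (F.p a)) • F.star b)),
    transl G (𝒢.s (F.p b)) (𝒢.s (F.p a)))

/-- The right inner product `(h, G · (a* · h) b)`, where `h` takes the range of `a` to that
of `b`. -/
def rightInner (G H : Type*) {X A : Type*} [Group G] [Group H] [MulAction Hᵐᵒᵖ X] [MulAction G A]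
    [MulAction Hᵐᵒᵖ A] (𝒢 : GroupoidData X) (F : FellData X A) (a b : A) : H × Orbits G A :=
  (unop (transl Hᵐᵒᵖ (𝒢.r (F.p a)) (𝒢.r (F.p b))),
    orb G (F.mul (transl Hᵐᵒᵖ (𝒢.r (F.p a)) (𝒢.r (F.p b)) • F.star a) b))

variable [SMulCommClass G Hᵐᵒᵖ X] [SMulCommClass G Hᵐᵒᵖ A]

variable [TopologicalSpace G] [TopologicalSpace H] [TopologicalSpace X] [TopologicalSpace A]
  {𝒢 : GroupoidData X} {F : FellData X A}

theorem leftInner_eq (hGfp : IsFreeProper G X) {a b : A} {t : G}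
    (ht : 𝒢.s (F.p a) = t • 𝒢.s (F.p b)) :
    leftInner G H 𝒢 F a b = (orb Hᵐᵒᵖ (F.mul a (t • F.star b)), t) := by
  rw [leftInner, transl_eq hGfp ht.symm]

theorem rightInner_eq (hHfp : IsFreeProper Hᵐᵒᵖ X) {a b : A} {k : Hᵐᵒᵖ}
    (hk : k • 𝒢.r (F.p a) = 𝒢.r (F.p b)) :
    rightInner G H 𝒢 F a b = (unop k, orb G (F.mul (k • F.star a) b)) := by
  rw [rightInner, transl_eq hHfp hk]

theorem exists_smul_of_rightAnchor_eq {x y : X}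
    (h : rightAnchor G H 𝒢 x = rightAnchor G H 𝒢 y) : ∃ t : G, 𝒢.s x = t • 𝒢.s y :=
  (orb_eq_iff.1 (Prod.mk.inj h).2).imp fun _ => Eq.symm

theorem exists_smul_of_leftAnchor_eq {x y : X}
    (h : leftAnchor G H 𝒢 x = leftAnchor G H 𝒢 y) : ∃ k : Hᵐᵒᵖ, k • 𝒢.r x = 𝒢.r y :=
  orb_eq_iff.1 (Prod.mk.inj h).1.symm

/-- The elements `a` and `t · b*` are composable if `t` takes the source of `b` to that of `a`. -/
theorem s_p_eq_r_p_smul_star (h𝒢 : IsLCGroupoid 𝒢) (hF : IsFellBundle 𝒢 F)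
    (hG : ActsByFellAut G 𝒢 F) {a b : A} {t : G} (ht : 𝒢.s (F.p a) = t • 𝒢.s (F.p b)) :
    𝒢.s (F.p a) = 𝒢.r (F.p (t • F.star b)) := by
  rw [ht, hG.r_p_smul, hF.p_star, h𝒢.r_inv]

/-- The elements `k · a*` and `b` are composable if `k` takes the range of `a` to that of `b`. -/
theorem s_p_smul_star_eq_r_p (h𝒢 : IsLCGroupoid 𝒢) (hF : IsFellBundle 𝒢 F)
    (hH : ActsByFellAut Hᵐᵒᵖ 𝒢 F) {a b : A} {k : Hᵐᵒᵖ} (hk : k • 𝒢.r (F.p a) = 𝒢.r (F.p b)) :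
    𝒢.s (F.p (k • F.star a)) = 𝒢.r (F.p b) := by
  rw [← hk, hH.s_p_smul, hF.p_star, h𝒢.s_inv]

/-- The inner product is the arrow formula with a star in place of the inverse, so the condition on
its base arrow is left to `leftArrow_spec`. -/
theorem p_leftInner (h𝒢 : IsLCGroupoid 𝒢) (hF : IsFellBundle 𝒢 F) (hG : ActsByFellAut G 𝒢 F)
    (hH : ActsByFellAut Hᵐᵒᵖ 𝒢 F) {a b : A}
    (h : rightAnchor G H 𝒢 (F.p a) = rightAnchor G H 𝒢 (F.p b)) :
    (leftFell G hH).p (leftInner G H 𝒢 F a b) = leftArrow G H 𝒢 (F.p a) (F.p b) := by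
  have ht : 𝒢.s (F.p a) = transl G (𝒢.s (F.p b)) (𝒢.s (F.p a)) • 𝒢.s (F.p b) :=
    (transl_smul (Prod.mk.inj h).2.symm).symm
  refine Prod.ext (congrArg (orb Hᵐᵒᵖ) ?_) rfl
  rw [hF.p_mul _ _ (s_p_eq_r_p_smul_star h𝒢 hF hG ht), hG.p_smul, hF.p_star]

theorem p_rightInner (h𝒢 : IsLCGroupoid 𝒢) (hF : IsFellBundle 𝒢 F) (hG : ActsByFellAut G 𝒢 F)
    (hH : ActsByFellAut Hᵐᵒᵖ 𝒢 F) {a b : A}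
    (h : leftAnchor G H 𝒢 (F.p a) = leftAnchor G H 𝒢 (F.p b)) :
    (rightFell H hG).p (rightInner G H 𝒢 F a b) = rightArrow G H 𝒢 (F.p a) (F.p b) := by
  have hk : transl Hᵐᵒᵖ (𝒢.r (F.p a)) (𝒢.r (F.p b)) • 𝒢.r (F.p a) = 𝒢.r (F.p b) :=
    transl_smul (Prod.mk.inj h).1
  refine Prod.ext rfl (congrArg (orb G) ?_)
  rw [hF.p_mul _ _ (s_p_smul_star_eq_r_p h𝒢 hF hH hk), hH.p_smul, hF.p_star]

theorem continuousOn_leftInner (h𝒢 : IsLCGroupoid 𝒢) (hF : IsFellBundle 𝒢 F)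
    (hG : ActsByFellAut G 𝒢 F) (hH : ActsByFellAut Hᵐᵒᵖ 𝒢 F) (hGfp : IsFreeProper G X) :
    ContinuousOn (fun q : A × A => leftInner G H 𝒢 F q.1 q.2)
      {q | rightAnchor G H 𝒢 (F.p q.1) = rightAnchor G H 𝒢 (F.p q.2)} := by
  have hcs := h𝒢.continuous_s
  have hcp := hF.continuous_p
  have hcst := hF.continuous_star
  have ht : ContinuousOn (fun q : A × A => transl G (𝒢.s (F.p q.2)) (𝒢.s (F.p q.1)))
      {q | rightAnchor G H 𝒢 (F.p q.1) = rightAnchor G H 𝒢 (F.p q.2)} :=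
    (continuousOn_transl hGfp).comp (f := fun q : A × A => (𝒢.s (F.p q.2), 𝒢.s (F.p q.1)))
      (by fun_prop) fun q hq => (Prod.mk.inj hq).2.symm
  refine ContinuousOn.prodMk
    ((isOpenQuotientMap_orb hH.continuous_smul).continuous.comp_continuousOn ?_) ht
  refine hF.continuousOn_mul.comp (f := fun q : A × A =>
    (q.1, transl G (𝒢.s (F.p q.2)) (𝒢.s (F.p q.1)) • F.star q.2)) (continuousOn_fst.prodMk
      (hG.continuous_smul.comp_continuousOn (ht.prodMk (by fun_prop)))) fun q hq => ?_
  exact s_p_eq_r_p_smul_star h𝒢 hF hG (transl_smul (Prod.mk.inj hq).2.symm).symm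

theorem continuousOn_rightInner (h𝒢 : IsLCGroupoid 𝒢) (hF : IsFellBundle 𝒢 F)
    (hG : ActsByFellAut G 𝒢 F) (hH : ActsByFellAut Hᵐᵒᵖ 𝒢 F) (hHfp : IsFreeProper Hᵐᵒᵖ X) :
    ContinuousOn (fun q : A × A => rightInner G H 𝒢 F q.1 q.2)
      {q | leftAnchor G H 𝒢 (F.p q.1) = leftAnchor G H 𝒢 (F.p q.2)} := by
  have hcr := h𝒢.continuous_r
  have hcp := hF.continuous_p
  have hcst := hF.continuous_star
  have ht : ContinuousOn (fun q : A × A => transl Hᵐᵒᵖ (𝒢.r (F.p q.1)) (𝒢.r (F.p q.2)))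
      {q | leftAnchor G H 𝒢 (F.p q.1) = leftAnchor G H 𝒢 (F.p q.2)} :=
    (continuousOn_transl hHfp).comp (f := fun q : A × A => (𝒢.r (F.p q.1), 𝒢.r (F.p q.2)))
      (by fun_prop) fun q hq => (Prod.mk.inj hq).1
  refine ContinuousOn.prodMk (continuous_unop.comp_continuousOn ht)
    ((isOpenQuotientMap_orb hG.continuous_smul).continuous.comp_continuousOn ?_)
  refine hF.continuousOn_mul.comp (f := fun q : A × A =>
    (transl Hᵐᵒᵖ (𝒢.r (F.p q.1)) (𝒢.r (F.p q.2)) • F.star q.1, q.2)) (ContinuousOn.prodMk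
      (hH.continuous_smul.comp_continuousOn (ht.prodMk (by fun_prop))) continuousOn_snd)
      fun q hq => ?_
  exact s_p_smul_star_eq_r_p h𝒢 hF hH (transl_smul (Prod.mk.inj hq).1)

/-! ### Sesquilinearity of the inner products -/

section Sesquilinear

theorem leftInner_add_left (h𝒢 : IsLCGroupoid 𝒢) (hF : IsFellBundle 𝒢 F)
    (hG : ActsByFellAut G 𝒢 F) (hH : ActsByFellAut Hᵐᵒᵖ 𝒢 F) (hGfp : IsFreeProper G X)
    (hHfp : IsFreeProper Hᵐᵒᵖ X) {e e' f : A} (hp : F.p e = F.p e')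
    (h : rightAnchor G H 𝒢 (F.p e) = rightAnchor G H 𝒢 (F.p f)) :
    leftInner G H 𝒢 F (F.add e e') f
      = (leftFell G hH).add (leftInner G H 𝒢 F e f) (leftInner G H 𝒢 F e' f) := by
  obtain ⟨t, ht⟩ := exists_smul_of_rightAnchor_eq h
  have hc := s_p_eq_r_p_smul_star h𝒢 hF hG ht
  have hc' := hc
  rw [hp] at hc'
  have ht' : 𝒢.s (F.p e') = t • 𝒢.s (F.p f) := hp ▸ ht
  rw [leftInner_eq hGfp ht, leftInner_eq hGfp ht', leftInner_eq hGfp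
    (by rw [hF.p_add _ _ hp, ht]), leftFell_add_orb hH hHfp, hF.add_mul _ _ _ hp hc]
  rw [hF.p_mul _ _ hc, hF.p_mul _ _ hc', hp]

theorem leftInner_add_right (h𝒢 : IsLCGroupoid 𝒢) (hF : IsFellBundle 𝒢 F)
    (hG : ActsByFellAut G 𝒢 F) (hH : ActsByFellAut Hᵐᵒᵖ 𝒢 F) (hGfp : IsFreeProper G X)
    (hHfp : IsFreeProper Hᵐᵒᵖ X) {e f f' : A} (hp : F.p f = F.p f')
    (h : rightAnchor G H 𝒢 (F.p e) = rightAnchor G H 𝒢 (F.p f)) :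
    leftInner G H 𝒢 F e (F.add f f')
      = (leftFell G hH).add (leftInner G H 𝒢 F e f) (leftInner G H 𝒢 F e f') := by
  obtain ⟨t, ht⟩ := exists_smul_of_rightAnchor_eq h
  have ht' : 𝒢.s (F.p e) = t • 𝒢.s (F.p f') := hp ▸ ht
  have hc := s_p_eq_r_p_smul_star h𝒢 hF hG ht
  have hc' := s_p_eq_r_p_smul_star h𝒢 hF hG ht'
  have hps : F.p (F.star f) = F.p (F.star f') := by rw [hF.p_star, hF.p_star, hp]
  have hpt : F.p (t • F.star f) = F.p (t • F.star f') := by rw [hG.p_smul, hG.p_smul, hps]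
  rw [leftInner_eq hGfp ht, leftInner_eq hGfp ht', leftInner_eq hGfp
    (by rw [hF.p_add _ _ hp, ht]), leftFell_add_orb hH hHfp, hF.star_add _ _ hp,
    ← hG.add_smul _ _ _ hps, hF.mul_add _ _ _ hpt hc]
  rw [hF.p_mul _ _ hc, hF.p_mul _ _ hc', hpt]

theorem leftInner_smul_left (h𝒢 : IsLCGroupoid 𝒢) (hF : IsFellBundle 𝒢 F)
    (hG : ActsByFellAut G 𝒢 F) (hH : ActsByFellAut Hᵐᵒᵖ 𝒢 F) (hGfp : IsFreeProper G X) (c : ℂ)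
    {e f : A} (h : rightAnchor G H 𝒢 (F.p e) = rightAnchor G H 𝒢 (F.p f)) :
    leftInner G H 𝒢 F (F.smul c e) f = (leftFell G hH).smul c (leftInner G H 𝒢 F e f) := by
  obtain ⟨t, ht⟩ := exists_smul_of_rightAnchor_eq h
  rw [leftInner_eq hGfp ht, leftInner_eq hGfp (by rw [hF.p_smul, ht]),
    hF.smul_mul _ _ _ (s_p_eq_r_p_smul_star h𝒢 hF hG ht)]
  rfl

theorem leftInner_smul_right (h𝒢 : IsLCGroupoid 𝒢) (hF : IsFellBundle 𝒢 F)
    (hG : ActsByFellAut G 𝒢 F) (hH : ActsByFellAut Hᵐᵒᵖ 𝒢 F) (hGfp : IsFreeProper G X) (c : ℂ)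
    {e f : A} (h : rightAnchor G H 𝒢 (F.p e) = rightAnchor G H 𝒢 (F.p f)) :
    leftInner G H 𝒢 F e (F.smul c f)
      = (leftFell G hH).smul ((starRingEnd ℂ) c) (leftInner G H 𝒢 F e f) := by
  obtain ⟨t, ht⟩ := exists_smul_of_rightAnchor_eq h
  rw [leftInner_eq hGfp ht, leftInner_eq hGfp (by rw [hF.p_smul, ht]), hF.star_smul,
    ← hG.smul_smul, hF.mul_smul' _ _ _ (s_p_eq_r_p_smul_star h𝒢 hF hG ht)]
  rfl

theorem rightInner_add_left (h𝒢 : IsLCGroupoid 𝒢) (hF : IsFellBundle 𝒢 F)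
    (hG : ActsByFellAut G 𝒢 F) (hH : ActsByFellAut Hᵐᵒᵖ 𝒢 F) (hGfp : IsFreeProper G X)
    (hHfp : IsFreeProper Hᵐᵒᵖ X) {e e' f : A} (hp : F.p e = F.p e')
    (h : leftAnchor G H 𝒢 (F.p e) = leftAnchor G H 𝒢 (F.p f)) :
    rightInner G H 𝒢 F (F.add e e') f
      = (rightFell H hG).add (rightInner G H 𝒢 F e f) (rightInner G H 𝒢 F e' f) := by
  obtain ⟨k, hk⟩ := exists_smul_of_leftAnchor_eq h
  have hk' : k • 𝒢.r (F.p e') = 𝒢.r (F.p f) := hp ▸ hk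
  have hc := s_p_smul_star_eq_r_p h𝒢 hF hH hk
  have hc' := s_p_smul_star_eq_r_p h𝒢 hF hH hk'
  have hps : F.p (F.star e) = F.p (F.star e') := by rw [hF.p_star, hF.p_star, hp]
  have hpk : F.p (k • F.star e) = F.p (k • F.star e') := by rw [hH.p_smul, hH.p_smul, hps]
  rw [rightInner_eq hHfp hk, rightInner_eq hHfp hk', rightInner_eq hHfp
    (by rw [hF.p_add _ _ hp, hk]), rightFell_add_orb hG hGfp, hF.star_add _ _ hp,
    ← hH.add_smul _ _ _ hps, hF.add_mul _ _ _ hpk hc]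
  rw [hF.p_mul _ _ hc, hF.p_mul _ _ hc', hpk]

theorem rightInner_add_right (h𝒢 : IsLCGroupoid 𝒢) (hF : IsFellBundle 𝒢 F)
    (hG : ActsByFellAut G 𝒢 F) (hH : ActsByFellAut Hᵐᵒᵖ 𝒢 F) (hGfp : IsFreeProper G X)
    (hHfp : IsFreeProper Hᵐᵒᵖ X) {e f f' : A} (hp : F.p f = F.p f')
    (h : leftAnchor G H 𝒢 (F.p e) = leftAnchor G H 𝒢 (F.p f)) :
    rightInner G H 𝒢 F e (F.add f f')
      = (rightFell H hG).add (rightInner G H 𝒢 F e f) (rightInner G H 𝒢 F e f') := by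
  obtain ⟨k, hk⟩ := exists_smul_of_leftAnchor_eq h
  have hc := s_p_smul_star_eq_r_p h𝒢 hF hH hk
  have hc' := hc
  rw [hp] at hc'
  have hk' : k • 𝒢.r (F.p e) = 𝒢.r (F.p f') := hp ▸ hk
  rw [rightInner_eq hHfp hk, rightInner_eq hHfp hk', rightInner_eq hHfp
    (by rw [hF.p_add _ _ hp, hk]), rightFell_add_orb hG hGfp, hF.mul_add _ _ _ hp hc]
  rw [hF.p_mul _ _ hc, hF.p_mul _ _ hc', hp]

theorem rightInner_smul_left (h𝒢 : IsLCGroupoid 𝒢) (hF : IsFellBundle 𝒢 F)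
    (hG : ActsByFellAut G 𝒢 F) (hH : ActsByFellAut Hᵐᵒᵖ 𝒢 F) (hHfp : IsFreeProper Hᵐᵒᵖ X) (c : ℂ)
    {e f : A} (h : leftAnchor G H 𝒢 (F.p e) = leftAnchor G H 𝒢 (F.p f)) :
    rightInner G H 𝒢 F (F.smul c e) f
      = (rightFell H hG).smul ((starRingEnd ℂ) c) (rightInner G H 𝒢 F e f) := by
  obtain ⟨k, hk⟩ := exists_smul_of_leftAnchor_eq h
  rw [rightInner_eq hHfp hk, rightInner_eq hHfp (by rw [hF.p_smul, hk]), hF.star_smul,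
    ← hH.smul_smul, hF.smul_mul _ _ _ (s_p_smul_star_eq_r_p h𝒢 hF hH hk)]
  rfl

theorem rightInner_smul_right (h𝒢 : IsLCGroupoid 𝒢) (hF : IsFellBundle 𝒢 F)
    (hG : ActsByFellAut G 𝒢 F) (hH : ActsByFellAut Hᵐᵒᵖ 𝒢 F) (hHfp : IsFreeProper Hᵐᵒᵖ X) (c : ℂ)
    {e f : A} (h : leftAnchor G H 𝒢 (F.p e) = leftAnchor G H 𝒢 (F.p f)) :
    rightInner G H 𝒢 F e (F.smul c f) = (rightFell H hG).smul c (rightInner G H 𝒢 F e f) := by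
  obtain ⟨k, hk⟩ := exists_smul_of_leftAnchor_eq h
  rw [rightInner_eq hHfp hk, rightInner_eq hHfp (by rw [hF.p_smul, hk]),
    hF.mul_smul' _ _ _ (s_p_smul_star_eq_r_p h𝒢 hF hH hk)]
  rfl

end Sesquilinear

/-- If `t` takes the source of `f` to that of `e`, then `t⁻¹` goes back, and `t⁻¹ · (e (t · f*))* =
f (t⁻¹ · e*)`; the translation by `t⁻¹` is the one in the star of the semidirect product. -/
theorem star_leftInner (h𝒢 : IsLCGroupoid 𝒢) (hF : IsFellBundle 𝒢 F) (hG : ActsByFellAut G 𝒢 F)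
    (hH : ActsByFellAut Hᵐᵒᵖ 𝒢 F) (hGfp : IsFreeProper G X) {e f : A}
    (h : rightAnchor G H 𝒢 (F.p e) = rightAnchor G H 𝒢 (F.p f)) :
    (leftFell G hH).star (leftInner G H 𝒢 F e f) = leftInner G H 𝒢 F f e := by
  obtain ⟨t, ht⟩ := exists_smul_of_rightAnchor_eq h
  have hc := s_p_eq_r_p_smul_star h𝒢 hF hG ht
  have hs : F.mul f (t⁻¹ • F.star e) = t⁻¹ • F.star (F.mul e (t • F.star f)) := by
    rw [hF.star_mul _ _ hc, hG.star_smul, hF.star_star, ← hG.mul_smul, inv_smul_smul]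
    rw [hG.s_p_smul, ← ht, hF.p_star, h𝒢.r_inv]
  rw [leftInner_eq hGfp ht, leftInner_eq hGfp (t := t⁻¹) (by rw [ht, inv_smul_smul]), hs]
  rfl

theorem star_rightInner (h𝒢 : IsLCGroupoid 𝒢) (hF : IsFellBundle 𝒢 F) (hG : ActsByFellAut G 𝒢 F)
    (hH : ActsByFellAut Hᵐᵒᵖ 𝒢 F) (hHfp : IsFreeProper Hᵐᵒᵖ X) {e f : A}
    (h : leftAnchor G H 𝒢 (F.p e) = leftAnchor G H 𝒢 (F.p f)) :
    (rightFell H hG).star (rightInner G H 𝒢 F e f) = rightInner G H 𝒢 F f e := by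
  obtain ⟨k, hk⟩ := exists_smul_of_leftAnchor_eq h
  have hc := s_p_smul_star_eq_r_p h𝒢 hF hH hk
  have hs : F.mul (k⁻¹ • F.star f) e = k⁻¹ • F.star (F.mul (k • F.star e) f) := by
    rw [hF.star_mul _ _ hc, hH.star_smul, hF.star_star, ← hH.mul_smul, inv_smul_smul]
    rw [hH.r_p_smul, hk, hF.p_star, h𝒢.s_inv]
  rw [rightInner_eq hHfp hk, rightInner_eq hHfp (k := k⁻¹) (by rw [← hk, inv_smul_smul]), hs]
  rfl

theorem mul_leftInner (h𝒢 : IsLCGroupoid 𝒢) (hF : IsFellBundle 𝒢 F) (hG : ActsByFellAut G 𝒢 F)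
    (hH : ActsByFellAut Hᵐᵒᵖ 𝒢 F) (hGfp : IsFreeProper G X) (hHfp : IsFreeProper Hᵐᵒᵖ X)
    {q : Orbits Hᵐᵒᵖ A × G} {e f : A}
    (hq : (leftGroupoid G hH.base).s ((leftFell G hH).p q) = leftAnchor G H 𝒢 (F.p e))
    (h : rightAnchor G H 𝒢 (F.p e) = rightAnchor G H 𝒢 (F.p f)) :
    (leftFell G hH).mul q (leftInner G H 𝒢 F e f)
      = leftInner G H 𝒢 F (leftFellAct 𝒢 F q e) f := by
  obtain ⟨P, t'⟩ := q
  obtain ⟨a, rfl, hae⟩ := exists_of_leftFell_s_eq hG hH hq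
  obtain ⟨t, ht⟩ := exists_smul_of_rightAnchor_eq h
  have hc := s_p_eq_r_p_smul_star h𝒢 hF hG ht
  have hc' : 𝒢.s (F.p (t' • e)) = 𝒢.r (F.p (t' • t • F.star f)) := by
    rw [hG.s_p_smul, hc, ← hG.r_p_smul]
  -- The translating element for the pair `a (t' · e)`, `f` is `t' * t`, which matches the group
  -- coordinate of the product on the left.
  have hs : 𝒢.s (F.p (F.mul a (t' • e))) = (t' * t) • 𝒢.s (F.p f) := by
    rw [hF.p_mul _ _ hae, h𝒢.s_mul _ _ hae, hG.s_p_smul, ht, mul_smul]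
  rw [leftInner_eq hGfp ht, leftFellAct_orb hH hHfp hae, leftInner_eq hGfp hs,
    leftFell_mul_orb hH hHfp, ← hG.mul_smul _ _ _ hc, mul_smul, hF.mul_assoc _ _ _ hae hc']
  rw [← hG.mul_smul _ _ _ hc, hF.p_mul _ _ hc', h𝒢.r_mul _ _ hc', hae]

theorem rightInner_mul (h𝒢 : IsLCGroupoid 𝒢) (hF : IsFellBundle 𝒢 F) (hG : ActsByFellAut G 𝒢 F)
    (hH : ActsByFellAut Hᵐᵒᵖ 𝒢 F) (hGfp : IsFreeProper G X) (hHfp : IsFreeProper Hᵐᵒᵖ X)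
    {q : H × Orbits G A} {e f : A}
    (h : leftAnchor G H 𝒢 (F.p e) = leftAnchor G H 𝒢 (F.p f))
    (hq : rightAnchor G H 𝒢 (F.p f) = (rightGroupoid H hG.base).r ((rightFell H hG).p q)) :
    (rightFell H hG).mul (rightInner G H 𝒢 F e f) q
      = rightInner G H 𝒢 F e (rightFellAct 𝒢 F f q) := by
  obtain ⟨l, P⟩ := q
  obtain ⟨b, rfl, hfb⟩ := exists_of_rightFell_r_eq hG hH hq
  obtain ⟨k, hk⟩ := exists_smul_of_leftAnchor_eq h
  have hc := s_p_smul_star_eq_r_p h𝒢 hF hH hk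
  have hc' : 𝒢.s (F.p (op l • k • F.star e)) = 𝒢.r (F.p (op l • f)) := by
    rw [hH.s_p_smul, hc, ← hH.r_p_smul]
  have hs : (op l * k) • 𝒢.r (F.p e) = 𝒢.r (F.p (F.mul (op l • f) b)) := by
    rw [hF.p_mul _ _ hfb, h𝒢.r_mul _ _ hfb, hH.r_p_smul, ← hk, mul_smul]
  rw [rightInner_eq hHfp hk, rightFellAct_orb hG hGfp hfb, rightInner_eq hHfp hs,
    rightFell_mul_orb hG hGfp, ← hH.mul_smul _ _ _ hc, mul_smul, hF.mul_assoc _ _ _ hc' hfb]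
  · rfl
  · rw [← hH.mul_smul _ _ _ hc, hF.p_mul _ _ hc', h𝒢.s_mul _ _ hc', hfb]

/-- The left inner product is represented by a translate under `k`, the right one by a translate
under `t`. Since the two actions commute, both sides are then bracketings of `(k • e) (t • k • f*)
(t • g)`. -/
theorem leftInner_act_eq (h𝒢 : IsLCGroupoid 𝒢) (hF : IsFellBundle 𝒢 F) (hG : ActsByFellAut G 𝒢 F)
    (hH : ActsByFellAut Hᵐᵒᵖ 𝒢 F) (hGfp : IsFreeProper G X) (hHfp : IsFreeProper Hᵐᵒᵖ X)
    {e f g : A} (h : rightAnchor G H 𝒢 (F.p e) = rightAnchor G H 𝒢 (F.p f))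
    (h' : leftAnchor G H 𝒢 (F.p f) = leftAnchor G H 𝒢 (F.p g)) :
    leftFellAct 𝒢 F (leftInner G H 𝒢 F e f) g = rightFellAct 𝒢 F e (rightInner G H 𝒢 F f g) := by
  obtain ⟨t, ht⟩ := exists_smul_of_rightAnchor_eq h
  obtain ⟨k, hk⟩ := exists_smul_of_leftAnchor_eq h'
  have hc := s_p_eq_r_p_smul_star h𝒢 hF hG ht
  have hd := s_p_smul_star_eq_r_p h𝒢 hF hH hk
  have hc' : 𝒢.s (F.p (k • e)) = 𝒢.r (F.p (t • k • F.star f)) := by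
    rw [hH.s_p_smul, hc, ← hH.r_p_smul, smul_comm t]
  have hd' : 𝒢.s (F.p (t • k • F.star f)) = 𝒢.r (F.p (t • g)) := by
    rw [hG.s_p_smul, hd, ← hG.r_p_smul]
  rw [leftInner_eq hGfp ht, rightInner_eq hHfp hk, ← orb_smul k (F.mul e _),
    ← orb_smul t (F.mul _ g), ← hH.mul_smul _ _ _ hc, ← hG.mul_smul _ _ _ hd,
    ← smul_comm t k (F.star f), leftFellAct_orb hH hHfp, rightFellAct_orb hG hGfp (h := unop k)]
  · exact hF.mul_assoc _ _ _ hc' hd'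
  · rw [hF.p_mul _ _ hd', h𝒢.r_mul _ _ hd']
    exact hc'
  · rw [hF.p_mul _ _ hc', h𝒢.s_mul _ _ hc', hd']

end InnerProducts

/-! ### Assembly of the equivalence -/

section Main

set_option linter.unusedSectionVars false

variable {G H X A : Type*} [Group G] [Group H] [MulAction G X] [MulAction Hᵐᵒᵖ X] [MulAction G A]
  [MulAction Hᵐᵒᵖ A] [SMulCommClass G Hᵐᵒᵖ X] [SMulCommClass G Hᵐᵒᵖ A] [TopologicalSpace G]
  [TopologicalSpace H] [TopologicalSpace X] [TopologicalSpace A] {𝒢 : GroupoidData X}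
  {F : FellData X A}

theorem isLCGroupoid_leftGroupoid [IsTopologicalGroup G] [T2Space G] [LocallyCompactSpace G]
    [SecondCountableTopology G] (h𝒢 : IsLCGroupoid 𝒢) (hG : ActsByFellAut G 𝒢 F)
    (hH : ActsByFellAut Hᵐᵒᵖ 𝒢 F) (hHfp : IsFreeProper Hᵐᵒᵖ X) :
    IsLCGroupoid (leftGroupoid G hH.base) := by
  -- `leftOrbitAct` is definitionally the scalar action of this instance, so the general results on
  -- semidirect products apply.
  let _ := orbitMulAction G Hᵐᵒᵖ X
  let _ := orbitMulAction G Hᵐᵒᵖ A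
  exact isLCGroupoid_semidirect (isLCGroupoid_orbitGroupoid h𝒢 hH.base hHfp)
    (actsByFellAut_orbit hG hH hHfp).base

theorem isFellBundle_leftFell [IsTopologicalGroup G] [LocallyCompactSpace G]
    [SecondCountableTopology G] (h𝒢 : IsLCGroupoid 𝒢) (hF : IsFellBundle 𝒢 F)
    (hG : ActsByFellAut G 𝒢 F) (hH : ActsByFellAut Hᵐᵒᵖ 𝒢 F) (hHfp : IsFreeProper Hᵐᵒᵖ X) :
    IsFellBundle (leftGroupoid G hH.base) (leftFell G hH) := by
  let _ := orbitMulAction G Hᵐᵒᵖ X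
  let _ := orbitMulAction G Hᵐᵒᵖ A
  exact isFellBundle_semidirect (isLCGroupoid_orbitGroupoid h𝒢 hH.base hHfp)
    (isFellBundle_orbitFell hH h𝒢 hHfp hF) (actsByFellAut_orbit hG hH hHfp)

/-- The passage to orbits and the inclusion at the group element `1` are composed, so that the
coefficient algebra at `ρ x` is identified with the fibre of `F` over `r x`. -/
theorem isFibreStarIso_leftFell (h𝒢 : IsLCGroupoid 𝒢) (hF : IsFellBundle 𝒢 F)
    (hG : ActsByFellAut G 𝒢 F) (hH : ActsByFellAut Hᵐᵒᵖ 𝒢 F) (hHfp : IsFreeProper Hᵐᵒᵖ X)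
    (x : X) :
    IsFibreStarIso F (𝒢.r x) (leftFell G hH) (leftAnchor G H 𝒢 x)
      (fun a => (orb Hᵐᵒᵖ a, 1)) := by
  let _ := orbitMulAction G Hᵐᵒᵖ X
  let _ := orbitMulAction G Hᵐᵒᵖ A
  have h := (isFibreStarIso_semidirect (isLCGroupoid_orbitGroupoid h𝒢 hH.base hHfp)
    (isFellBundle_orbitFell hH h𝒢 hHfp hF) (actsByFellAut_orbit hG hH hHfp)
    (⟨orb Hᵐᵒᵖ x, rfl⟩ : orb Hᵐᵒᵖ (𝒢.r x) ∈ (orbitGroupoid 𝒢 hH.base).units) (1 : G)).comp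
      (isFibreStarIso_orb hH h𝒢 hHfp hF ⟨x, rfl⟩)
  have he : (fun P : Orbits Hᵐᵒᵖ A => ((1 : G) • P, (1 : G))) ∘ orb Hᵐᵒᵖ
      = fun a => (orb Hᵐᵒᵖ a, 1) :=
    funext fun a => congrArg (fun P => (P, (1 : G))) (one_smul G (orb Hᵐᵒᵖ a))
  rw [he, one_smul] at h
  exact h

theorem isLCGroupoid_rightGroupoid [IsTopologicalGroup H] [T2Space H] [LocallyCompactSpace H]
    [SecondCountableTopology H] (h𝒢 : IsLCGroupoid 𝒢) (hG : ActsByFellAut G 𝒢 F)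
    (hH : ActsByFellAut Hᵐᵒᵖ 𝒢 F) (hGfp : IsFreeProper G X) :
    IsLCGroupoid (rightGroupoid H hG.base) := by
  have := SMulCommClass.symm G Hᵐᵒᵖ X
  have := SMulCommClass.symm G Hᵐᵒᵖ A
  let _ := orbitMulAction Hᵐᵒᵖ G X
  let _ := orbitMulAction Hᵐᵒᵖ G A
  exact isLCGroupoid_rightSemidirect (isLCGroupoid_orbitGroupoid h𝒢 hG.base hGfp)
    (actsByFellAut_orbit hH hG hGfp).base

theorem isFellBundle_rightFell [IsTopologicalGroup H] [LocallyCompactSpace H]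
    [SecondCountableTopology H] (h𝒢 : IsLCGroupoid 𝒢) (hF : IsFellBundle 𝒢 F)
    (hG : ActsByFellAut G 𝒢 F) (hH : ActsByFellAut Hᵐᵒᵖ 𝒢 F) (hGfp : IsFreeProper G X) :
    IsFellBundle (rightGroupoid H hG.base) (rightFell H hG) := by
  have := SMulCommClass.symm G Hᵐᵒᵖ X
  have := SMulCommClass.symm G Hᵐᵒᵖ A
  let _ := orbitMulAction Hᵐᵒᵖ G X
  let _ := orbitMulAction Hᵐᵒᵖ G A
  exact isFellBundle_rightSemidirect (isLCGroupoid_orbitGroupoid h𝒢 hG.base hGfp)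
    (isFellBundle_orbitFell hG h𝒢 hGfp hF) (actsByFellAut_orbit hH hG hGfp)

theorem isFibreStarIso_rightFell (h𝒢 : IsLCGroupoid 𝒢) (hF : IsFellBundle 𝒢 F)
    (hG : ActsByFellAut G 𝒢 F) (hH : ActsByFellAut Hᵐᵒᵖ 𝒢 F) (hGfp : IsFreeProper G X) (x : X) :
    IsFibreStarIso F (𝒢.s x) (rightFell H hG) (rightAnchor G H 𝒢 x)
      (fun a => (1, orb G a)) := by
  have := SMulCommClass.symm G Hᵐᵒᵖ X
  have := SMulCommClass.symm G Hᵐᵒᵖ A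
  let _ := orbitMulAction Hᵐᵒᵖ G X
  let _ := orbitMulAction Hᵐᵒᵖ G A
  have hu : orb G (𝒢.s x) ∈ (orbitGroupoid 𝒢 hG.base).units := by
    rw [orbitGroupoid_units]
    exact ⟨_, h𝒢.s_mem x, rfl⟩
  have h := (isFibreStarIso_rightSemidirect (isLCGroupoid_orbitGroupoid h𝒢 hG.base hGfp)
    (isFellBundle_orbitFell hG h𝒢 hGfp hF) (actsByFellAut_orbit hH hG hGfp) hu
    (1 : Hᵐᵒᵖ)).comp (isFibreStarIso_orb hG h𝒢 hGfp hF (h𝒢.s_mem x))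
  have he : (fun P : Orbits G A => ((1 : H), (1 : Hᵐᵒᵖ) • P)) ∘ orb G
      = fun a => (1, orb G a) :=
    funext fun a => congrArg (fun P => ((1 : H), P)) (one_smul Hᵐᵒᵖ (orb G a))
  rw [he, one_smul] at h
  exact h

/-- Within the single fibre over `x` all sources agree and all ranges agree, so every translating
element is `1` and the four operations reduce to those of `F`. The bimodule of `F` over `x` is thus
transported with the identity on the module and isomorphisms on the two coefficient algebras. -/
theorem isImprimitivityBimodule_fibre (h𝒢 : IsLCGroupoid 𝒢) (hF : IsFellBundle 𝒢 F)
    (hG : ActsByFellAut G 𝒢 F) (hH : ActsByFellAut Hᵐᵒᵖ 𝒢 F) (hGfp : IsFreeProper G X)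
    (hHfp : IsFreeProper Hᵐᵒᵖ X) (x : X) :
    IsImprimitivityBimodule (leftFell G hH) (leftAnchor G H 𝒢 x) (rightFell H hG)
      (rightAnchor G H 𝒢 x) F.toBundleData x (leftFellAct 𝒢 F) (rightFellAct 𝒢 F)
      (leftInner G H 𝒢 F) (rightInner G H 𝒢 F) := by
  have hid : IsFibreIso F.toBundleData x F.toBundleData x id :=
    ⟨fun _ h => h, fun a h => ⟨a, h, rfl⟩, rfl, fun _ _ _ _ => rfl, fun _ _ _ => rfl,
      fun _ _ => rfl⟩
  refine (hF.imprimitivity x).transport hF.toIsBanachBundle hF.toIsBanachBundle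
    hF.toIsBanachBundle (isFibreStarIso_leftFell h𝒢 hF hG hH hHfp x)
    (isFibreStarIso_rightFell h𝒢 hF hG hH hGfp x) hid ?_ ?_ ?_ ?_
  · intro a e ha he
    simp only [id]
    rw [leftFellAct_orb hH hHfp, one_smul]
    rw [one_smul, ha, he, h𝒢.s_r]
  · intro e b he hb
    simp only [id]
    rw [rightFellAct_orb hG hGfp, op_one, one_smul]
    rw [op_one, one_smul, he, hb, h𝒢.r_s]
  · intro e f he hf
    simp only [id]
    rw [leftInner_eq (t := 1) hGfp, one_smul]
    rw [one_smul, he, hf]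
  · intro e f he hf
    simp only [id]
    rw [rightInner_eq (k := 1) hHfp, one_smul, unop_one]
    rw [one_smul, he, hf]

variable (G H) in
/-- The operations of the equivalence between `A/H ⋊ G` and `H ⋉ G\A`. -/
def equivalenceData (𝒢 : GroupoidData X) (F : FellData X A) :
    EquivalenceData (Orbits Hᵐᵒᵖ X × G) (Orbits Hᵐᵒᵖ A × G) (H × Orbits G X) (H × Orbits G A)
      X A where
  ρ := leftAnchor G H 𝒢
  lact := leftAct 𝒢
  σ := rightAnchor G H 𝒢
  ract := rightAct 𝒢
  la := leftFellAct 𝒢 F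
  ra := rightFellAct 𝒢 F
  li := leftInner G H 𝒢 F
  ri := rightInner G H 𝒢 F

theorem isFellBundleEquivalence_equivalenceData [IsTopologicalGroup G] [LocallyCompactSpace G]
    [T2Space G] [SecondCountableTopology G] [IsTopologicalGroup H] [LocallyCompactSpace H]
    [T2Space H] [SecondCountableTopology H] (h𝒢 : IsLCGroupoid 𝒢) (hF : IsFellBundle 𝒢 F)
    (hG : ActsByFellAut G 𝒢 F) (hH : ActsByFellAut Hᵐᵒᵖ 𝒢 F) (hGfp : IsFreeProper G X)
    (hHfp : IsFreeProper Hᵐᵒᵖ X) :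
    IsFellBundleEquivalence (leftGroupoid G hH.base) (leftFell G hH) (rightGroupoid H hG.base)
      (rightFell H hG) F.toBundleData (equivalenceData G H 𝒢 F) where
  left_groupoid := isLCGroupoid_leftGroupoid h𝒢 hG hH hHfp
  left_fell := isFellBundle_leftFell h𝒢 hF hG hH hHfp
  right_groupoid := isLCGroupoid_rightGroupoid h𝒢 hG hH hGfp
  right_fell := isFellBundle_rightFell h𝒢 hF hG hH hGfp
  banach := hF.toIsBanachBundle
  base := isGroupoidEquivalence h𝒢 hG.base hH.base hGfp hHfp
  left_action := isLeftFellAction_leftFellAct h𝒢 hF hG hH hHfp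
  right_action := isRightFellAction_rightFellAct h𝒢 hF hG hH hGfp
  commute _ _ _ h h' := leftFellAct_rightFellAct h𝒢 hF hG hH hGfp hHfp h h'
  continuousOn_li := continuousOn_leftInner h𝒢 hF hG hH hGfp
  add_li _ _ _ hp h := leftInner_add_left h𝒢 hF hG hH hGfp hHfp hp h
  smul_li c _ _ h := leftInner_smul_left h𝒢 hF hG hH hGfp c h
  li_add _ _ _ hp h := leftInner_add_right h𝒢 hF hG hH hGfp hHfp hp h
  li_smul c _ _ h := leftInner_smul_right h𝒢 hF hG hH hGfp c h
  continuousOn_ri := continuousOn_rightInner h𝒢 hF hG hH hHfp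
  add_ri _ _ _ hp h := rightInner_add_left h𝒢 hF hG hH hGfp hHfp hp h
  smul_ri c _ _ h := rightInner_smul_left h𝒢 hF hG hH hHfp c h
  ri_add _ _ _ hp h := rightInner_add_right h𝒢 hF hG hH hGfp hHfp hp h
  ri_smul c _ _ h := rightInner_smul_right h𝒢 hF hG hH hHfp c h
  p_li e f h := by
    simp only [equivalenceData]
    rw [p_leftInner h𝒢 hF hG hH h]
    exact leftArrow_spec h𝒢 hG.base hH.base hHfp (Prod.mk.inj h).2
  p_ri e f h := by
    simp only [equivalenceData]
    rw [p_rightInner h𝒢 hF hG hH h]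
    exact rightArrow_spec h𝒢 hG.base hH.base hGfp (Prod.mk.inj h).1
  star_li _ _ h := star_leftInner h𝒢 hF hG hH hGfp h
  star_ri _ _ h := star_rightInner h𝒢 hF hG hH hHfp h
  mul_li _ _ _ hq h := mul_leftInner h𝒢 hF hG hH hGfp hHfp hq h
  ri_mul _ _ _ h hq := rightInner_mul h𝒢 hF hG hH hGfp hHfp h hq
  li_la_eq_ra_ri _ _ _ h h' := leftInner_act_eq h𝒢 hF hG hH hGfp hHfp h h'
  imprimitivity := isImprimitivityBimodule_fibre h𝒢 hF hG hH hGfp hHfp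

end Main

end FellBundles

end

theorem theorem3p1 {G H X A : Type*}
    [Group G] [TopologicalSpace G] [IsTopologicalGroup G]
    [LocallyCompactSpace G] [T2Space G] [SecondCountableTopology G]
    [Group H] [TopologicalSpace H] [IsTopologicalGroup H]
    [LocallyCompactSpace H] [T2Space H] [SecondCountableTopology H]
    [TopologicalSpace X] [TopologicalSpace A]
    [MulAction G X] [MulAction Hᵐᵒᵖ X] [MulAction G A] [MulAction Hᵐᵒᵖ A]
    [SMulCommClass G Hᵐᵒᵖ X] [SMulCommClass G Hᵐᵒᵖ A]
    (𝒢 : GroupoidData X) (F : FellData X A)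
    (h𝒢 : IsLCGroupoid 𝒢) (hF : IsFellBundle 𝒢 F)
    (hG : ActsByFellAut G 𝒢 F) (hH : ActsByFellAut Hᵐᵒᵖ 𝒢 F)
    (hGfp : IsFreeProper G X) (hHfp : IsFreeProper Hᵐᵒᵖ X) :
    ∃ D : EquivalenceData (Orbits Hᵐᵒᵖ X × G) (Orbits Hᵐᵒᵖ A × G)
        (H × Orbits G X) (H × Orbits G A) X A,
      -- the actions of the base groupoids on the space `X`
      (∀ x, D.ρ x = (orb Hᵐᵒᵖ (𝒢.r x), 1)) ∧
      (∀ x (t : G) y, 𝒢.s x = 𝒢.r (t • y) →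
        D.lact (orb Hᵐᵒᵖ x, t) y = 𝒢.mul x (t • y)) ∧
      (∀ x, D.σ x = (1, orb G (𝒢.s x))) ∧
      (∀ x (h : H) y, 𝒢.s (op h • x) = 𝒢.r y →
        D.ract x (h, orb G y) = 𝒢.mul (op h • x) y) ∧
      -- (i) the left action
      (∀ a (t : G) b, 𝒢.s (F.p a) = 𝒢.r (F.p (t • b)) →
        D.la (orb Hᵐᵒᵖ a, t) b = F.mul a (t • b)) ∧
      -- (ii) the left inner product
      (∀ a b, orb G (𝒢.s (F.p a)) = orb G (𝒢.s (F.p b)) →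
        (∃! t : G, 𝒢.s (F.p a) = t • 𝒢.s (F.p b)) ∧
        ∀ t : G, 𝒢.s (F.p a) = t • 𝒢.s (F.p b) →
          D.li a b = (orb Hᵐᵒᵖ (F.mul a (t • F.star b)), t)) ∧
      -- (iii) the right action
      (∀ a (h : H) b, 𝒢.s (F.p (op h • a)) = 𝒢.r (F.p b) →
        D.ra a (h, orb G b) = F.mul (op h • a) b) ∧
      -- (iv) the right inner product
      (∀ a b, orb Hᵐᵒᵖ (𝒢.r (F.p a)) = orb Hᵐᵒᵖ (𝒢.r (F.p b)) →
        (∃! h : H, op h • 𝒢.r (F.p a) = 𝒢.r (F.p b)) ∧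
        ∀ h : H, op h • 𝒢.r (F.p a) = 𝒢.r (F.p b) →
          D.ri a b = (h, orb G (F.mul (op h • F.star a) b))) ∧
      -- with these operations the bundle is an equivalence
      IsFellBundleEquivalence
        (semidirectGroupoid (orbitGroupoid 𝒢 hH.base) leftOrbitAct)
        (semidirectFell (orbitFell 𝒢 F hH) leftOrbitAct)
        (rightSemidirectGroupoid (orbitGroupoid 𝒢 hG.base) rightOrbitAct)
        (rightSemidirectFell (orbitFell 𝒢 F hG) rightOrbitAct)
        F.toBundleData D := by
  refine ⟨equivalenceData G H 𝒢 F, fun _ => rfl,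
    fun _ _ _ h => leftAct_orb hH.base hHfp h, fun _ => rfl,
    fun _ _ _ h => rightAct_orb hG.base hGfp h, fun _ _ _ h => leftFellAct_orb hH hHfp h,
    fun a b hab => ⟨?_, fun t ht => leftInner_eq hGfp ht⟩,
    fun _ _ _ h => rightFellAct_orb hG hGfp h,
    fun a b hab => ⟨?_, fun h hh => rightInner_eq hHfp hh⟩,
    isFellBundleEquivalence_equivalenceData h𝒢 hF hG hH hGfp hHfp⟩
  -- Freeness on `X`, applied at the source of `b`, gives uniqueness.
  · obtain ⟨t, ht⟩ := orb_eq_iff.1 hab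
    exact ⟨t, ht.symm, fun t' ht' => hGfp.eq_of_smul_eq (ht'.symm.trans ht.symm)⟩
  · obtain ⟨k, hk⟩ := orb_eq_iff.1 hab.symm
    exact ⟨unop k, hk, fun h hh => op_injective (hHfp.eq_of_smul_eq (hh.trans hk.symm))⟩
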